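/- Let $I=[0,1]$, let $\mathrm{Homeo}_+(I)$ be the group of orientation preserving homeomorphisms of $I$, and let $F\le\mathrm{Homeo}_+(I)$ be Thompson's group of piecewise linear homeomorphisms with finitely many breakpoints, all dyadic rationals, and all slopes integral powers of $2$. Groups $G$ embed into groups $H$ by injective homomorphisms. *EA-class.* $EG_0$ is the class of groups that are abelian or finite; $EG_{\alpha+1}$ is the class of groups obtained from groups in $EG_\alpha$ by one extension or one directed union; $EG_\alpha=\bigcup_{\beta<\alpha}EG_\beta$ for limit $\alpha$. The EA-class $\mathrm{EA}(G)$ is the least $\alpha$ with $G\in EG_\alpha$. *Fast families and diagrams.* A bump of $f\in\mathrm{Homeo}_+(I)$ is the restriction $a$ of $f$ to a component $(u,v)$ of its support; it is positive if it moves points to the right and negative otherwise. If a marker $s\in(u,v)$ is chosen, the feet of $a$ are the left foot $(u,s)$ and the right foot $[t,v)$, where $t$ is the image of $s$ under $a$ if $a$ is positive and under $a^{-1}$ if $a$ is negative. A finite family in $\mathrm{Homeo}_+(I)$ whose members have finitely many bumps, with markers chosen, is geometrically fast if feet of different bumps (of the same or of different members) are disjoint. Its dynamical diagram is the directed graph whose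 vertices are the feet, ordered from left to right, and whose edges are the bumps, each joining its two feet, directed to the right if positive and to the left if negative, and labelled by the member of the family to which it belongs. Consider the following two diagrams, where $x^L,x^R$ denote the left and right foot of a bump $x$. - $D_{B+\mathbb Z}$: $a$ has a negative bump $a_1$ and a positive bump $a_2$; $b$ and $c$ are positive bumps; the order of the feet is $$a_1^L<b^L<a_1^R<a_2^L<b^R<a_2^R<c^L<c^R .$$ - $D_G$: $f$ has negative bumps $f_1,f_2$ and positive bumps $f_3,f_4$; $g$ and $h$ are positive bumps; the order of the feet is $$f_1^L<g^L<f_1^R<f_2^L<h^L<f_2^R<f_3^L<h^R<f_3^R<f_4^L<g^R<f_4^R .$$ **Theorem.** Both diagrams are dynamical diagrams of geometrically fast families in $F$. Let $(a,b,c)$ and $(f,g,h)$ be any geometrically fast families in $\mathrm{Homeo}_+(I)$ with dynamical diagrams $D_{B+\mathbb Z}$ and $D_G$ respectively. Then: 1. $\langle a,b,c\rangle\cong B+\mathbb Z$ (direct sum), where $B=\langle a,b\rangle$ is the Brin–Navas group; the groups $\langle a,b,c\rangle$ and $G=\langle f,g,h\rangle$ are finitely generated and embed into $F$. 2. $\mathrm{EA}(B+\mathbb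 Z)=\mathrm{EA}(G)=\omega+2$. 3. $B+\mathbb Z$ does not embed into $G$. 4. $G$ does not embed into $B+\mathbb Z$. Consequently there are finitely generated subgroups $H_0,H_1$ of $F$, both of EA-class $\omega+2$, neither of which embeds into the other, and the embeddability order on finitely generated subgroups of $F$ is not linear. -/

import Mathlib

open scoped unitInterval Ordinal

/-! ### Elementary amenable groups and their classes -/

/-- `ExtensionOf P G`: the group `G` is an extension of a group satisfying `P` by a group
satisfying `P`. -/
def ExtensionOf.{u} (P : ∀ (G : Type u) [Group G], Prop) (G : Type u) [Group G] : Prop :=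
  ∃ (N : Subgroup G) (_ : N.Normal), P N ∧ P (G ⧸ N)

/-- `DirectedUnionOf P G`: the group `G` is the union of a nonempty set, directed under inclusion,
of subgroups satisfying `P`. -/
def DirectedUnionOf.{u} (P : ∀ (G : Type u) [Group G], Prop) (G : Type u) [Group G] : Prop :=
  ∃ 𝓢 : Set (Subgroup G), 𝓢.Nonempty ∧ DirectedOn (· ≤ ·) 𝓢 ∧ (∀ H ∈ 𝓢, P H) ∧
    ∀ g : G, ∃ H ∈ 𝓢, g ∈ H

/-- The classes `EG_α`: `EG_0` is the class of the groups that are abelian or finite, `EG_{α+1}`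
consists of the groups obtained from groups in `EG_α` by one extension or one directed union, and
`EG_α` is the union of the `EG_β` with `β < α` if `α` is a limit ordinal. -/
noncomputable def InEG.{u} (α : Ordinal.{u}) : ∀ (G : Type u) [Group G], Prop :=
  Ordinal.limitRecOn (motive := fun _ => ∀ (G : Type u) [Group G], Prop) α
    (fun G _ => (∀ x y : G, x * y = y * x) ∨ Finite G)
    (fun _ P G _ => ExtensionOf P G ∨ DirectedUnionOf P G)
    (fun α _ P G _ => ∃ (β : Ordinal.{u}) (hβ : β < α), P β hβ G)

/-- `HasEAClass G α`: the group `G` is elementary amenable and its elementary amenability class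
`EA(G)`, the least ordinal `β` such that `G` is in `EG_β`, is equal to `α`. -/
def HasEAClass.{u} (G : Type u) [Group G] (α : Ordinal.{u}) : Prop :=
  IsLeast {β : Ordinal.{u} | InEG β G} α

/-- The group `G` embeds into the group `H`. -/
def Embeds (G H : Type*) [Group G] [Group H] : Prop :=
  ∃ φ : G →* H, Function.Injective φ

/-! ### Homeomorphisms of the unit interval and Thompson's group `F` -/

/-- The group of orientation preserving homeomorphisms of the unit interval, that is, of its order
automorphisms. The product `f * g` is the composition `x ↦ f (g x)`. -/
abbrev HomeoI : Type := I ≃o I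

/-- Dyadic rationals. -/
def IsDyadic (r : ℝ) : Prop := ∃ (m : ℤ) (n : ℕ), r = m / 2 ^ n

/-- `f` is piecewise linear with finitely many breakpoints, all of them in the finite set `D` of
dyadic rationals, and all slopes of `f` are integral powers of two. -/
def IsDyadicPLWith (f : HomeoI) (D : Finset I) : Prop :=
  (∀ d ∈ D, IsDyadic d) ∧
    ∀ u v : I, u < v → (∀ d ∈ D, d ∉ Set.Ioo u v) →
      ∃ k : ℤ, ∀ x ∈ Set.Icc u v, ∀ y ∈ Set.Icc u v, (f y : ℝ) - f x = 2 ^ k * ((y : ℝ) - x)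

theorem IsDyadic.add {r s : ℝ} (hr : IsDyadic r) (hs : IsDyadic s) : IsDyadic (r + s) := by
  obtain ⟨m, n, rfl⟩ := hr
  obtain ⟨m', n', rfl⟩ := hs
  refine ⟨m * 2 ^ n' + m' * 2 ^ n, n + n', ?_⟩
  push_cast
  field_simp
  ring

theorem IsDyadic.neg {r : ℝ} (hr : IsDyadic r) : IsDyadic (-r) := by
  obtain ⟨m, n, rfl⟩ := hr
  exact ⟨-m, n, by push_cast; ring⟩

theorem IsDyadic.zpow_mul {r : ℝ} (hr : IsDyadic r) (k : ℤ) : IsDyadic (2 ^ k * r) := by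
  obtain ⟨m, n, rfl⟩ := hr
  obtain ⟨j, rfl | rfl⟩ := k.eq_nat_or_neg
  · exact ⟨m * 2 ^ j, n, by push_cast; rw [zpow_natCast]; ring⟩
  · refine ⟨m, n + j, ?_⟩
    rw [zpow_neg, zpow_natCast]
    field_simp
    ring

theorem isDyadic_zero : IsDyadic 0 := ⟨0, 0, by simp⟩

theorem IsDyadicPLWith.map_dyadic {f : HomeoI} {D : Finset I} (h : IsDyadicPLWith f D) :
    ∀ (n : ℕ) (x : I), ((insert 0 D).filter (· < x)).card = n → IsDyadic x →
      IsDyadic (f x) := by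
  intro n
  induction n using Nat.strong_induction_on with
  | _ n ih =>
    intro x hn hx
    rcases eq_or_ne x 0 with rfl | hx0
    · have : f 0 = 0 := f.map_bot
      rw [this]
      exact isDyadic_zero
    · have hne : ((insert 0 D).filter (· < x)).Nonempty :=
        ⟨0, by simp [unitInterval.pos_iff_ne_zero.2 hx0]⟩
      obtain ⟨p, hp, hmax⟩ := Finset.exists_max_image _ id hne
      have hp' := Finset.mem_filter.1 hp
      have hpd : IsDyadic (p : ℝ) := by
        rcases Finset.mem_insert.1 hp'.1 with rfl | hpD
        · exact isDyadic_zero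
        · exact h.1 p hpD
      have hlt : ((insert 0 D).filter (· < p)).card < n := by
        rw [← hn]
        apply Finset.card_lt_card
        refine ⟨fun d hd => ?_, fun hc => ?_⟩
        · have := Finset.mem_filter.1 hd
          exact Finset.mem_filter.2 ⟨this.1, this.2.trans hp'.2⟩
        · exact lt_irrefl _ (Finset.mem_filter.1 (hc hp)).2
      have hfp := ih _ hlt p rfl hpd
      obtain ⟨k, hk⟩ := h.2 p x hp'.2 (by
        intro d hd hdm
        have := hmax d (Finset.mem_filter.2 ⟨Finset.mem_insert_of_mem hd, hdm.2⟩)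
        exact absurd hdm.1 (not_lt.2 this))
      have e := hk p ⟨le_rfl, hp'.2.le⟩ x ⟨hp'.2.le, le_rfl⟩
      have e' : (f x : ℝ) = f p + 2 ^ k * ((x : ℝ) + -p) := by
        rw [← sub_eq_add_neg]; linarith
      rw [e']
      exact hfp.add ((hx.add hpd.neg).zpow_mul k)

theorem IsDyadicPLWith.inv {f : HomeoI} {D : Finset I} (h : IsDyadicPLWith f D) :
    IsDyadicPLWith f⁻¹ (D.map f.toEquiv.toEmbedding) := by
  have hs : ∀ x : I, f (f⁻¹ x) = x := fun x => f.apply_symm_apply x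
  have hm : ∀ {x y : I}, x ≤ y → f⁻¹ x ≤ f⁻¹ y := fun hxy => f.symm.monotone hxy
  refine ⟨fun d hd => ?_, fun u v huv hD => ?_⟩
  · obtain ⟨e, he, rfl⟩ := Finset.mem_map.1 hd
    exact h.map_dyadic _ e rfl (h.1 e he)
  · obtain ⟨k, hk⟩ := h.2 (f⁻¹ u) (f⁻¹ v) (f.symm.strictMono huv) (by
      intro d hd hdm
      refine hD (f d) (Finset.mem_map.2 ⟨d, hd, rfl⟩) ⟨?_, ?_⟩
      · have := f.strictMono hdm.1
        rwa [hs] at this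
      · have := f.strictMono hdm.2
        rwa [hs] at this)
    refine ⟨-k, fun x hx y hy => ?_⟩
    have := hk (f⁻¹ x) ⟨hm hx.1, hm hx.2⟩ (f⁻¹ y) ⟨hm hy.1, hm hy.2⟩
    rw [hs, hs] at this
    rw [this, zpow_neg, inv_mul_cancel_left₀ (by positivity)]

theorem IsDyadicPLWith.mul {f g : HomeoI} {D E : Finset I} (hf : IsDyadicPLWith f D)
    (hg : IsDyadicPLWith g E) :
    ∃ K : Finset I, IsDyadicPLWith (f * g) K := by
  classical
  have hs : ∀ x : I, g⁻¹ (g x) = x := fun x => g.symm_apply_apply x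
  refine ⟨E ∪ D.map (g⁻¹ : HomeoI).toEquiv.toEmbedding, fun d hd => ?_, fun u v huv hK => ?_⟩
  · rcases Finset.mem_union.1 hd with hd | hd
    · exact hg.1 d hd
    · obtain ⟨e, he, rfl⟩ := Finset.mem_map.1 hd
      exact hg.inv.map_dyadic _ e rfl (hf.1 e he)
  · obtain ⟨k, hk⟩ := hg.2 u v huv fun d hd => hK d (Finset.mem_union_left _ hd)
    obtain ⟨l, hl⟩ := hf.2 (g u) (g v) (g.strictMono huv) (by
      intro d hd hdm
      refine hK (g⁻¹ d) (Finset.mem_union_right _ (Finset.mem_map.2 ⟨d, hd, rfl⟩)) ⟨?_, ?_⟩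
      · have := g.symm.strictMono hdm.1
        rwa [g.symm_apply_apply] at this
      · have := g.symm.strictMono hdm.2
        rwa [g.symm_apply_apply] at this)
    refine ⟨l + k, fun x hx y hy => ?_⟩
    have e := hl (g x) ⟨g.monotone hx.1, g.monotone hx.2⟩ (g y)
      ⟨g.monotone hy.1, g.monotone hy.2⟩
    rw [hk x hx y hy] at e
    rw [zpow_add₀ two_ne_zero, mul_assoc]
    exact e

/-- Thompson's group `F`: the piecewise linear orientation preserving homeomorphisms of the unit
interval with finitely many breakpoints, all at dyadic rationals, and with all slopes integral
powers of two. -/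
def thompsonF : Subgroup HomeoI where
  carrier := {f | ∃ D : Finset I, IsDyadicPLWith f D}
  mul_mem' := by
    rintro f g ⟨D, hf⟩ ⟨E, hg⟩
    exact hf.mul hg
  one_mem' := ⟨∅, by simp, fun u v _ _ => ⟨0, fun x _ y _ => by simp⟩⟩
  inv_mem' := by
    rintro f ⟨D, hf⟩
    exact ⟨_, hf.inv⟩

/-! ### Bumps, feet, fast families and dynamical diagrams -/

/-- An orbital of `f`: a connected component `(left, right)` of the support of `f`. -/
@[ext]
structure Orbital (f : HomeoI) where
  left : I
  right : I
  left_lt_right : left < right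
  map_left : f left = left
  map_right : f right = right
  map_ne : ∀ x ∈ Set.Ioo left right, f x ≠ x

/-- The bumps of a family `S` of homeomorphisms: pairs of an index `l` and an orbital of `S l`
(standing for the restriction of `S l` to that orbital). -/
abbrev Bump {Λ : Type} (S : Λ → HomeoI) : Type := Σ l : Λ, Orbital (S l)

/-- A marking of the bumps of `S`: a point in the support of each of them. -/
abbrev Marking {Λ : Type} (S : Λ → HomeoI) : Type :=
  ∀ b : Bump S, Set.Ioo b.2.left b.2.right

section Feet

variable {Λ : Type} {S : Λ → HomeoI}

/-- A bump is positive if it moves the points of its support to the right. -/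
def Bump.IsPositive (b : Bump S) : Prop := ∀ x ∈ Set.Ioo b.2.left b.2.right, x < S b.1 x

open Classical in
/-- The point `t` at which the right foot begins: the image of the marker `s` under the bump if
the bump is positive, and under its inverse if the bump is negative. -/
noncomputable def Marking.endMarker (m : Marking S) (b : Bump S) : I :=
  if b.IsPositive then S b.1 (m b) else (S b.1)⁻¹ (m b)

/-- The feet of a bump: the left foot `(u, s)` (for `false`) and the right foot `[t, v)`
(for `true`), where `(u, v)` is the support of the bump. -/
noncomputable def Marking.foot (m : Marking S) (b : Bump S) : Bool → Set I
  | false => Set.Ioo b.2.left (m b)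
  | true => Set.Ico (m.endMarker b) b.2.right

/-- A family of marked homeomorphisms is geometrically fast if it has only finitely many bumps and
the feet of distinct bumps are disjoint. (In particular no bump is a bump of two members of the
family.) -/
def Marking.IsFast (m : Marking S) : Prop :=
  Finite (Bump S) ∧
    ∀ b b' : Bump S, b ≠ b' → ∀ i j : Bool, Disjoint (m.foot b i) (m.foot b' j)

end Feet

/-- Directed graphs with an order relation on the vertices and with edges labeled in `Λ`. -/
structure Diagram (Λ : Type) where
  Vertex : Type
  Edge : Type
  lt : Vertex → Vertex → Prop
  source : Edge → Vertex
  target : Edge → Vertex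
  label : Edge → Λ

/-- Isomorphism of diagrams: bijections between vertices and between edges which preserve the
order of the vertices, the sources and targets of the edges, and the labels. -/
def Diagram.Isomorphic {Λ : Type} (D D' : Diagram Λ) : Prop :=
  ∃ (ν : D.Vertex ≃ D'.Vertex) (ε : D.Edge ≃ D'.Edge),
    (∀ p q, D.lt p q ↔ D'.lt (ν p) (ν q)) ∧
    (∀ e, D'.source (ε e) = ν (D.source e)) ∧
    (∀ e, D'.target (ε e) = ν (D.target e)) ∧
    (∀ e, D'.label (ε e) = D.label e)

open Classical in
/-- The dynamical diagram of a marked family `S`: the vertices are the feet (a bump together with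
a side, `false` for left and `true` for right), ordered from left to right as subsets of the unit
interval; the edges are the bumps, joining their two feet, where positive bumps are directed to the
right and negative bumps to the left; each bump is labeled by the member of `S` it comes from. -/
noncomputable def Marking.diagram {Λ : Type} {S : Λ → HomeoI} (m : Marking S) : Diagram Λ where
  Vertex := Bump S × Bool
  Edge := Bump S
  lt p q := ∀ x ∈ m.foot p.1 p.2, ∀ y ∈ m.foot q.1 q.2, x < y
  source b := if b.IsPositive then (b, false) else (b, true)
  target b := if b.IsPositive then (b, true) else (b, false)
  label b := b.1

/-- The family `S`, for a suitable marking, is geometrically fast with dynamical diagram `D`. -/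
def IsFastWithDiagram {Λ : Type} (S : Λ → HomeoI) (D : Diagram Λ) : Prop :=
  ∃ m : Marking S, m.IsFast ∧ m.diagram.Isomorphic D

/-- The diagram of the generating set `a, b, c` (labels `0, 1, 2`) of `B + ℤ`. From left to right
the eight feet are: left foot of the negative bump of `a`, left foot of `b`, right foot of the
negative bump of `a`, left foot of the positive bump of `a`, right foot of `b`, right foot of the
positive bump of `a`, left foot of `c`, right foot of `c`; the bumps `b` and `c` are positive. -/
def diagramBZ : Diagram (Fin 3) where
  Vertex := Fin 8
  Edge := Fin 4
  lt := (· < ·)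
  source := ![2, 3, 1, 6]
  target := ![0, 5, 4, 7]
  label := ![0, 0, 1, 2]

/-- The diagram of the generating set `f, g, h` (labels `0, 1, 2`) of `G`. The bumps of `f` are,
from left to right, `f₁, f₂` (negative) and `f₃, f₄` (positive), and `g` and `h` are positive
bumps. From left to right the twelve feet are: left foot of `f₁`, left foot of `g`, right foot of
`f₁`, left foot of `f₂`, left foot of `h`, right foot of `f₂`, left foot of `f₃`, right foot of
`h`, right foot of `f₃`, left foot of `f₄`, right foot of `g`, right foot of `f₄`. -/
def diagramG : Diagram (Fin 3) where
  Vertex := Fin 12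
  Edge := Fin 6
  lt := (· < ·)
  source := ![2, 5, 6, 9, 1, 4]
  target := ![0, 3, 8, 11, 10, 7]
  label := ![0, 0, 0, 0, 1, 2]

/-!
The group generated by a fast family with one of the two diagrams does not depend on the family: it
is isomorphic to a model that involves no homeomorphisms. For a linear order `L` let `levelPerm ℓ`
be the permutation of the finitely supported sequences `L →₀ ℤ` which adds one to the coordinate `ℓ`
of all sequences vanishing above `ℓ`, and fixes all others. These permutations generate a directed
union of iterated wreath products of infinite cyclic groups. An order automorphism `θ` of `L` acts
by the shift `shiftHom θ`, which conjugates `levelPerm ℓ` to `levelPerm (θ ℓ)`, and `shiftGroup θ`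
is generated by all of these. The Brin–Navas group is the model for the translation of `L = ℤ`, and
`G` is the model for the translation of two copies of `ℤ`, one below the other.

To compare a realization with the model, consider the conjugates by the powers of `a` (of `f`) of
the bumps of the other generators. Since a foot of a bump of `b` lies between the feet of a bump of
`a`, the support of each conjugate is contained in a fundamental domain of the next one. Such a
family is a tower (`IsTower`), and the products of decreasing powers of its elements move suitable
points of the interval in the same way as the model moves sequences. Hence relations of the model
hold in the realization and conversely (`IsTower.nonempty_mulEquiv`). The bump `c` has its support
disjoint from those of `a` and `b`, and contributes a direct factor `ℤ`.

Triangular permutations which change only `n` coordinates are in `EG_n`, since the change of the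
highest of these coordinates is a homomorphism to an abelian group (`inEG_of_le_fixingGroup`). So
the group of all translations is in `EG_{ω+1}`, and `shiftGroup θ`, in which it contains the
commutators, is in `EG_{ω+2}`. Conversely, a finitely generated group in `EG_{ω+1}` is in some
`EG_n`, whereas the wreath product of `2 ^ (n + 1)` levels is not in `EG_n`: a normal subgroup
either meets the group of the upper half of the levels trivially, so that this group embeds into the
quotient, or it has the group of the lower half as a section (`inEG_levelGroup_of_normal`,
`not_inEG_levelGroup_Ico`).

The non-embeddings rest on the level of a translation, the highest coordinate which it changes. An
element with a nontrivial shift part changes levels by conjugation, so it commutes with no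
nontrivial element of the group of translations (`mem_levelGroup_of_commute`). If `B + ℤ` were
embedded in `G`, the central factor would commute with a nontrivial commutator, so it would be
mapped to translations; as `B` commutes with it, `B` would be mapped to translations as well, and
then `B` would be in some `EG_n` (`not_embeds_shiftGroup_prod`). If `G` were embedded in `B + ℤ`,
the projection to `B` would map translations to translations, whose levels now are integers.
Conjugation by the image of the shift lowers the levels of the images of the upper translations
beyond all bounds. As each of these separates the supports of the lower translations, the
commutators of the images of the latter would have arbitrarily low levels, so they would be trivial
(`not_embeds_shiftGroup_succIsoTwo`).

Realizations in Thompson's group are products of piecewise linear homeomorphisms with slopes `2`,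
`1` and `1 / 2` and their inverses; where a bump has to have small feet, a power of such a
homeomorphism is used.
-/

/-! ### The hierarchy of elementary amenable groups -/

section Classes

universe u

theorem inEG_zero {G : Type u} [Group G] :
    InEG 0 G ↔ (∀ x y : G, x * y = y * x) ∨ Finite G := by
  unfold InEG
  rw [Ordinal.limitRecOn_zero]

theorem inEG_succ {α : Ordinal.{u}} {G : Type u} [Group G] :
    InEG (α + 1) G ↔ ExtensionOf (InEG α) G ∨ DirectedUnionOf (InEG α) G := by
  unfold InEG
  rw [Ordinal.limitRecOn_add_one]

theorem inEG_limit {α : Ordinal.{u}} (hα : Order.IsSuccLimit α) {G : Type u} [Group G] :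
    InEG α G ↔ ∃ β < α, InEG β G := by
  unfold InEG
  rw [Ordinal.limitRecOn_limit _ _ _ _ hα]
  simp only [exists_prop]

/-- The class `EG_α` is closed under passing to subgroups. -/
theorem InEG.of_injective {α : Ordinal.{u}} : ∀ {G K : Type u} [Group G] [Group K] (f : K →* G),
    Function.Injective f → InEG α G → InEG α K := by
  induction α using Ordinal.limitRecOn with
  | zero =>
    intro G K _ _ f hf h
    rw [inEG_zero] at h ⊢
    refine h.imp (fun h x y => hf ?_) (fun (_ : Finite G) => Finite.of_injective f hf)
    rw [map_mul, map_mul, h]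
  | add_one α ih =>
    intro G K _ _ f hf h
    rw [inEG_succ] at h ⊢
    refine h.imp ?_ ?_
    · rintro ⟨N, hN, h1, h2⟩
      refine ⟨N.comap f, inferInstance, ?_, ?_⟩
      · refine ih (f.subgroupComap N) ?_ h1
        intro x y hxy
        exact Subtype.ext (hf (congrArg Subtype.val hxy))
      · refine ih (QuotientGroup.map (N.comap f) N f le_rfl) ?_ h2
        rw [injective_iff_map_eq_one]
        intro x
        induction x using QuotientGroup.induction_on with
        | H x =>
          intro hx
          rw [QuotientGroup.map_mk, QuotientGroup.eq_one_iff] at hx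
          rw [QuotientGroup.eq_one_iff]
          exact hx
    · rintro ⟨𝓢, ⟨H₀, hH₀⟩, hd, hP, hu⟩
      refine ⟨Subgroup.comap f '' 𝓢, ⟨_, H₀, hH₀, rfl⟩, ?_, ?_, ?_⟩
      · rintro _ ⟨A, hA, rfl⟩ _ ⟨B, hB, rfl⟩
        obtain ⟨C, hC, hAC, hBC⟩ := hd A hA B hB
        exact ⟨_, ⟨C, hC, rfl⟩, Subgroup.comap_mono hAC, Subgroup.comap_mono hBC⟩
      · rintro _ ⟨A, hA, rfl⟩
        refine ih (f.subgroupComap A) ?_ (hP A hA)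
        intro x y hxy
        exact Subtype.ext (hf (congrArg Subtype.val hxy))
      · intro g
        obtain ⟨H, hH, hg⟩ := hu (f g)
        exact ⟨_, ⟨H, hH, rfl⟩, hg⟩
  | limit α hα ih =>
    intro G K _ _ f hf h
    rw [inEG_limit hα] at h ⊢
    obtain ⟨β, hβ, h⟩ := h
    exact ⟨β, hβ, ih β hβ f hf h⟩

/-- The class `EG_α` is closed under passing to quotients. -/
theorem InEG.of_surjective {α : Ordinal.{u}} : ∀ {G K : Type u} [Group G] [Group K] (f : G →* K),
    Function.Surjective f → InEG α G → InEG α K := by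
  induction α using Ordinal.limitRecOn with
  | zero =>
    intro G K _ _ f hf h
    rw [inEG_zero] at h ⊢
    refine h.imp (fun h x y => ?_) (fun (_ : Finite G) => Finite.of_surjective f hf)
    obtain ⟨x, rfl⟩ := hf x
    obtain ⟨y, rfl⟩ := hf y
    rw [← map_mul, ← map_mul, h]
  | add_one α ih =>
    intro G K _ _ f hf h
    rw [inEG_succ] at h ⊢
    refine h.imp ?_ ?_
    · rintro ⟨N, hN, h1, h2⟩
      have : (N.map f).Normal := hN.map f hf
      refine ⟨N.map f, inferInstance, ?_, ?_⟩
      · exact ih (f.subgroupMap N) (f.subgroupMap_surjective N) h1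
      · refine ih (QuotientGroup.map N (N.map f) f (Subgroup.le_comap_map f N)) ?_ h2
        intro x
        induction x using QuotientGroup.induction_on with
        | H x =>
          obtain ⟨x, rfl⟩ := hf x
          exact ⟨x, rfl⟩
    · rintro ⟨𝓢, ⟨H₀, hH₀⟩, hd, hP, hu⟩
      refine ⟨Subgroup.map f '' 𝓢, ⟨_, H₀, hH₀, rfl⟩, ?_, ?_, ?_⟩
      · rintro _ ⟨A, hA, rfl⟩ _ ⟨B, hB, rfl⟩
        obtain ⟨C, hC, hAC, hBC⟩ := hd A hA B hB
        exact ⟨_, ⟨C, hC, rfl⟩, Subgroup.map_mono hAC, Subgroup.map_mono hBC⟩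
      · rintro _ ⟨A, hA, rfl⟩
        exact ih (f.subgroupMap A) (f.subgroupMap_surjective A) (hP A hA)
      · intro g
        obtain ⟨g, rfl⟩ := hf g
        obtain ⟨H, hH, hg⟩ := hu g
        exact ⟨_, ⟨H, hH, rfl⟩, g, hg, rfl⟩
  | limit α hα ih =>
    intro G K _ _ f hf h
    rw [inEG_limit hα] at h ⊢
    obtain ⟨β, hβ, h⟩ := h
    exact ⟨β, hβ, ih β hβ f hf h⟩

theorem InEG.congr {α : Ordinal.{u}} {G K : Type u} [Group G] [Group K] (e : G ≃* K)
    (h : InEG α G) : InEG α K :=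
  h.of_surjective e.toMonoidHom e.surjective

theorem inEG_of_subsingleton (α : Ordinal.{u}) : ∀ (G : Type u) [Group G] [Subsingleton G],
    InEG α G := by
  induction α using Ordinal.limitRecOn with
  | zero => exact fun G _ _ => inEG_zero.2 (Or.inr inferInstance)
  | add_one α ih =>
    intro G _ _
    exact inEG_succ.2 (Or.inl ⟨⊤, inferInstance, ih _,
      have := QuotientGroup.subsingleton_quotient_top (G := G); ih _⟩)
  | limit α hα ih =>
    intro G _ _
    exact (inEG_limit hα).2 ⟨0, hα.bot_lt, ih 0 hα.bot_lt G⟩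

theorem InEG.mono {α β : Ordinal.{u}} (hαβ : α ≤ β) {G : Type u} [Group G] (h : InEG α G) :
    InEG β G := by
  induction β using Ordinal.limitRecOn with
  | zero => rwa [nonpos_iff_eq_zero.1 hαβ] at h
  | add_one β ih =>
    rcases hαβ.eq_or_lt with rfl | hlt
    · exact h
    · have h' := ih (Order.lt_add_one_iff.1 hlt)
      have := QuotientGroup.subsingleton_quotient_top (G := G)
      exact inEG_succ.2 (Or.inl ⟨⊤, inferInstance, h'.congr Subgroup.topEquiv.symm,
        inEG_of_subsingleton β _⟩)
  | limit β hβ ih =>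
    rcases hαβ.eq_or_lt with rfl | hlt
    · exact h
    · exact (inEG_limit hβ).2 ⟨α, hlt, h⟩

/-- An extension of a group in `EG_α` by an abelian group is in `EG_{α+1}`. -/
theorem inEG_succ_of_hom {α : Ordinal.{u}} {G : Type u} {A : Type*} [Group G] [CommGroup A]
    (f : G →* A) (h : InEG α f.ker) : InEG (α + 1) G := by
  refine inEG_succ.2 (Or.inl ⟨f.ker, inferInstance, h, InEG.mono (zero_le) ?_⟩)
  refine inEG_zero.2 (Or.inl fun x y => QuotientGroup.kerLift_injective f ?_)
  rw [map_mul, map_mul, mul_comm]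

/-- The class `EG_α` is closed under passing to sections; here the section is given by a
correspondence between a subgroup of `G` and the section `K`. -/
theorem InEG.of_correspondence {α : Ordinal.{u}} {G K : Type u} [Group G] [Group K]
    (R : Subgroup (G × K)) (hfst : ∀ k, (1, k) ∈ R → k = 1) (hsnd : ∀ k, ∃ g, (g, k) ∈ R)
    (h : InEG α G) : InEG α K := by
  have h' : InEG α R := by
    refine h.of_injective ((MonoidHom.fst G K).comp R.subtype) ?_
    rw [injective_iff_map_eq_one]
    rintro ⟨⟨g, k⟩, hR⟩ (rfl : g = 1)
    obtain rfl := hfst k hR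
    rfl
  refine h'.of_surjective ((MonoidHom.snd G K).comp R.subtype) fun k => ?_
  obtain ⟨g, hg⟩ := hsnd k
  exact ⟨⟨_, hg⟩, rfl⟩

/-- A directed union exhausting a finitely generated group contains the whole group. -/
theorem DirectedUnionOf.of_fg {P : ∀ (G : Type u) [Group G], Prop} {G : Type u} [Group G]
    (hG : Group.FG G) (h : DirectedUnionOf P G) : ∃ H : Subgroup G, P H ∧ H = ⊤ := by
  obtain ⟨𝓢, hne, hd, hP, hu⟩ := h
  obtain ⟨S, hS⟩ := Group.fg_def.1 hG
  obtain ⟨H, hH, hSH⟩ : ∃ H ∈ 𝓢, (S : Set G) ⊆ H := by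
    clear hS
    induction S using Finset.cons_induction with
    | empty =>
      obtain ⟨H, hH⟩ := hne
      exact ⟨H, hH, by simp⟩
    | cons a s _ ih =>
      obtain ⟨A, hA, hsA⟩ := ih
      obtain ⟨B, hB, haB⟩ := hu a
      obtain ⟨C, hC, hAC, hBC⟩ := hd A hA B hB
      refine ⟨C, hC, ?_⟩
      rw [Finset.coe_cons, Set.insert_subset_iff]
      exact ⟨hBC haB, hsA.trans hAC⟩
  exact ⟨H, hP H hH, top_unique (hS ▸ (Subgroup.closure_le H).2 hSH)⟩

theorem InEG.extensionOf_of_fg {α : Ordinal.{u}} {G : Type u} [Group G] (hG : Group.FG G)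
    (h : InEG (α + 1) G) : InEG α G ∨ ExtensionOf (InEG α) G := by
  rcases inEG_succ.1 h with h | h
  · exact Or.inr h
  · obtain ⟨H, hH, rfl⟩ := h.of_fg hG
    exact Or.inl (hH.congr Subgroup.topEquiv)

theorem InEG.exists_nat {G : Type u} [Group G] (h : InEG ω G) :
    ∃ n : ℕ, InEG (n : Ordinal.{u}) G := by
  obtain ⟨β, hβ, h⟩ := (inEG_limit Ordinal.isSuccLimit_omega0).1 h
  obtain ⟨n, rfl⟩ := Ordinal.lt_omega0.1 hβ
  exact ⟨n, h⟩

/-- A finitely generated group in `EG_{ω+1}` is already in `EG_n` for some natural number `n`. -/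
theorem InEG.exists_nat_of_fg {G : Type u} [Group G] (hG : Group.FG G)
    (h : InEG (ω + 1) G) : ∃ n : ℕ, InEG (n : Ordinal.{u}) G := by
  rcases h.extensionOf_of_fg hG with h | ⟨N, hN, h1, h2⟩
  · exact h.exists_nat
  · obtain ⟨m, hm⟩ := h1.exists_nat
    obtain ⟨n, hn⟩ := h2.exists_nat
    refine ⟨max m n + 1, ?_⟩
    rw [Nat.cast_add_one]
    exact inEG_succ.2 (Or.inl ⟨N, hN, hm.mono (by exact_mod_cast le_max_left m n),
      hn.mono (by exact_mod_cast le_max_right m n)⟩)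

/-- A finitely generated group in `EG_{ω+2}` which is in no `EG_n` with `n` finite has
EA-class `ω + 2`. -/
theorem hasEAClass_omega_add_two {G : Type u} [Group G] (hG : Group.FG G)
    (h : InEG (ω + 1 + 1) G) (hn : ∀ n : ℕ, ¬ InEG (n : Ordinal.{u}) G) :
    HasEAClass G (ω + 2) := by
  have e : (ω + 2 : Ordinal.{u}) = ω + 1 + 1 := by
    rw [add_assoc, one_add_one_eq_two]
  rw [HasEAClass, e]
  refine ⟨h, fun β hβ => ?_⟩
  by_contra! hlt
  obtain ⟨n, h'⟩ := (InEG.mono (Order.lt_add_one_iff.1 hlt) hβ).exists_nat_of_fg hG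
  exact hn n h'

theorem HasEAClass.congr {α : Ordinal.{u}} {G K : Type u} [Group G] [Group K] (e : G ≃* K)
    (h : HasEAClass G α) : HasEAClass K α :=
  ⟨h.1.congr e, fun _ hβ => h.2 (InEG.congr e.symm hβ)⟩

end Classes

theorem Embeds.trans {G H K : Type*} [Group G] [Group H] [Group K] (h₁ : Embeds G H)
    (h₂ : Embeds H K) : Embeds G K := by
  obtain ⟨f, hf⟩ := h₁
  obtain ⟨g, hg⟩ := h₂
  exact ⟨g.comp f, hg.comp hf⟩

theorem MulEquiv.embeds {G H : Type*} [Group G] [Group H] (e : G ≃* H) : Embeds G H :=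
  ⟨e.toMonoidHom, e.injective⟩

/-! ### Families permuted by a conjugation -/

section ConjugateFamilies

variable {L Γ : Type*} [LE L] [Group Γ] (θ : L ≃o L) (a : Γ) (b : L → Γ)

theorem zpow_conj_eq (hab : ∀ ℓ, a * b ℓ * a⁻¹ = b (θ ℓ)) (m : ℤ) (ℓ : L) :
    a ^ m * b ℓ * (a ^ m)⁻¹ = b ((θ ^ m) ℓ) := by
  induction m using Int.induction_on generalizing ℓ with
  | zero => simp
  | succ m ih =>
    rw [add_comm, zpow_one_add, zpow_one_add, RelIso.mul_apply, ← hab, ← ih]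
    group
  | pred m ih =>
    have h' : a⁻¹ * b ((θ ^ (-m : ℤ)) ℓ) * a = b ((θ ^ (-m - 1 : ℤ)) ℓ) := by
      have := hab ((θ ^ (-m - 1 : ℤ)) ℓ)
      rw [← RelIso.mul_apply, ← zpow_one_add, add_sub_cancel] at this
      rw [← this]
      group
    rw [← h', ← ih, zpow_sub_one]
    group

/-- An element conjugating a family into itself normalizes the group generated by the family, so
that every element of the group generated by both is a product of two factors. -/
theorem exists_eq_mul_zpow_of_mem_closure (hab : ∀ ℓ, a * b ℓ * a⁻¹ = b (θ ℓ)) {x : Γ}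
    (hx : x ∈ Subgroup.closure (insert a (Set.range b))) :
    ∃ w ∈ Subgroup.closure (Set.range b), ∃ m : ℤ, x = w * a ^ m := by
  have hc : ∀ m : ℤ, ∀ w ∈ Subgroup.closure (Set.range b),
      a ^ m * w * (a ^ m)⁻¹ ∈ Subgroup.closure (Set.range b) := by
    intro m
    have : Subgroup.closure (Set.range b) ≤
        (Subgroup.closure (Set.range b)).comap (MulAut.conj (a ^ m)).toMonoidHom := by
      refine (Subgroup.closure_le _).2 ?_
      rintro _ ⟨ℓ, rfl⟩
      rw [SetLike.mem_coe, Subgroup.mem_comap]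
      change a ^ m * b ℓ * (a ^ m)⁻¹ ∈ _
      rw [zpow_conj_eq θ a b hab]
      exact Subgroup.subset_closure ⟨_, rfl⟩
    exact fun w hw => this hw
  induction hx using Subgroup.closure_induction with
  | mem x hx =>
    rcases hx with rfl | ⟨ℓ, rfl⟩
    · exact ⟨1, one_mem _, 1, by simp⟩
    · exact ⟨_, Subgroup.subset_closure ⟨ℓ, rfl⟩, 0, by simp⟩
  | one => exact ⟨1, one_mem _, 0, by simp⟩
  | mul x y _ _ hx hy =>
    obtain ⟨w, hw, m, rfl⟩ := hx
    obtain ⟨w', hw', n, rfl⟩ := hy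
    refine ⟨w * (a ^ m * w' * (a ^ m)⁻¹), mul_mem hw (hc m _ hw'), m + n, ?_⟩
    group
  | inv x _ hx =>
    obtain ⟨w, hw, m, rfl⟩ := hx
    refine ⟨a ^ (-m) * w⁻¹ * (a ^ (-m))⁻¹, hc (-m) _ (inv_mem hw), -m, ?_⟩
    group

end ConjugateFamilies

/-! ### Translations of finitely supported integer sequences by levels -/

section LevelTranslations

universe u

variable {L : Type u}

theorem perm_apply_inv_self {X : Type*} (τ : Equiv.Perm X) (x : X) : τ (τ⁻¹ x) = x :=
  τ.apply_symm_apply x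

/-- The permutations which change no coordinate in `U`. -/
def fixingGroup (U : Set L) : Subgroup (Equiv.Perm (L →₀ ℤ)) where
  carrier := {τ | ∀ x, ∀ j ∈ U, τ x j = x j}
  mul_mem' := by
    intro θ τ h1 h2 x j hj
    rw [Equiv.Perm.mul_apply, h1 _ j hj, h2 _ j hj]
  one_mem' := fun x j _ => rfl
  inv_mem' := by
    intro τ h x j hj
    have := h (τ⁻¹ x) j hj
    rw [← this, perm_apply_inv_self]

theorem eq_one_of_mem_fixingGroup_univ {τ : Equiv.Perm (L →₀ ℤ)}
    (h : τ ∈ fixingGroup (Set.univ : Set L)) : τ = 1 :=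
  Equiv.ext fun x => Finsupp.ext fun j => h x j trivial

variable [LinearOrder L]

open Classical in
/-- The translation by `k` in the coordinate `ℓ`, applied only to those sequences which vanish in
all coordinates above `ℓ`. -/
noncomputable def levelMap (ℓ : L) (k : ℤ) (x : L →₀ ℤ) : L →₀ ℤ :=
  if ∀ j, ℓ < j → x j = 0 then x + Finsupp.single ℓ k else x

theorem levelMap_of_zero {ℓ : L} {x : L →₀ ℤ} (k : ℤ) (h : ∀ j, ℓ < j → x j = 0) :
    levelMap ℓ k x = x + Finsupp.single ℓ k := if_pos h

theorem levelMap_of_ne {ℓ j : L} {x : L →₀ ℤ} (k : ℤ) (hj : ℓ < j) (h : x j ≠ 0) :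
    levelMap ℓ k x = x := if_neg fun h' => h (h' j hj)

theorem levelMap_apply_of_ne {ℓ j : L} (k : ℤ) (x : L →₀ ℤ) (h : j ≠ ℓ) :
    levelMap ℓ k x j = x j := by
  classical
  unfold levelMap
  split_ifs
  · simp [h.symm]
  · rfl

theorem levelMap_levelMap (ℓ : L) (k m : ℤ) (x : L →₀ ℤ) :
    levelMap ℓ k (levelMap ℓ m x) = levelMap ℓ (m + k) x := by
  by_cases h : ∀ j, ℓ < j → x j = 0
  · rw [levelMap_of_zero m h, levelMap_of_zero (m + k) h, levelMap_of_zero, Finsupp.single_add,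
      add_assoc]
    intro j hj
    rw [← levelMap_of_zero m h, levelMap_apply_of_ne m x hj.ne', h j hj]
  · push Not at h
    obtain ⟨j, hj, h⟩ := h
    rw [levelMap_of_ne m hj h, levelMap_of_ne k hj h, levelMap_of_ne _ hj h]

theorem levelMap_zero (ℓ : L) (x : L →₀ ℤ) : levelMap ℓ 0 x = x := by
  classical
  unfold levelMap
  split_ifs <;> simp

/-- The unit translation at level `ℓ`. The group generated by the `levelPerm ℓ` with `ℓ` in a
finite set of size `n` is the `n`-fold iterated wreath product of infinite cyclic groups. -/
noncomputable def levelPerm (ℓ : L) : Equiv.Perm (L →₀ ℤ) where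
  toFun := levelMap ℓ 1
  invFun := levelMap ℓ (-1)
  left_inv x := by rw [levelMap_levelMap, add_neg_cancel, levelMap_zero]
  right_inv x := by rw [levelMap_levelMap, neg_add_cancel, levelMap_zero]

theorem levelPerm_apply (ℓ : L) (x : L →₀ ℤ) : levelPerm ℓ x = levelMap ℓ 1 x := rfl

theorem levelPerm_inv_apply (ℓ : L) (x : L →₀ ℤ) : (levelPerm ℓ)⁻¹ x = levelMap ℓ (-1) x := rfl

theorem levelPerm_zpow_apply (ℓ : L) (k : ℤ) (x : L →₀ ℤ) :
    (levelPerm ℓ ^ k) x = levelMap ℓ k x := by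
  induction k using Int.induction_on with
  | zero => simp [levelMap_zero]
  | succ k ih =>
    rw [add_comm, zpow_one_add, Equiv.Perm.mul_apply, ih, levelPerm_apply, levelMap_levelMap,
      add_comm]
  | pred k ih =>
    rw [sub_eq_add_neg, add_comm, zpow_add, zpow_neg_one, Equiv.Perm.mul_apply, ih,
      levelPerm_inv_apply, levelMap_levelMap, add_comm]

/-- Maps which change every coordinate by an amount which depends only on the coordinates above
it. -/
def IsTriangular (f : (L →₀ ℤ) → L →₀ ℤ) : Prop :=
  ∀ x y ℓ, (∀ j, ℓ < j → x j = y j) → f x ℓ - x ℓ = f y ℓ - y ℓ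

theorem IsTriangular.apply_eq {f : (L →₀ ℤ) → L →₀ ℤ} (hf : IsTriangular f) {x y : L →₀ ℤ} {ℓ : L}
    (h : ∀ j, ℓ ≤ j → x j = y j) : f x ℓ = f y ℓ := by
  have h1 := hf x y ℓ fun j hj => h j hj.le
  have h2 := h ℓ le_rfl
  omega

theorem IsTriangular.comp {f g : (L →₀ ℤ) → L →₀ ℤ} (hf : IsTriangular f) (hg : IsTriangular g) :
    IsTriangular (f ∘ g) := by
  intro x y ℓ h
  have h1 := hf (g x) (g y) ℓ fun j hj => hg.apply_eq fun i hi => h i (hj.trans_le hi)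
  have h2 := hg x y ℓ h
  simp only [Function.comp]
  omega

theorem isTriangular_levelMap (ℓ : L) (k : ℤ) : IsTriangular (levelMap ℓ k) := by
  intro x y i h
  rcases eq_or_ne i ℓ with rfl | hi
  · by_cases h' : ∀ j, i < j → x j = 0
    · rw [levelMap_of_zero k h', levelMap_of_zero k fun j hj => (h j hj).symm.trans (h' j hj)]
      simp
    · push Not at h'
      obtain ⟨j, hj, h'⟩ := h'
      rw [levelMap_of_ne k hj h', levelMap_of_ne k hj (h j hj ▸ h'), sub_self, sub_self]
  · rw [levelMap_apply_of_ne _ _ hi, levelMap_apply_of_ne _ _ hi, sub_self, sub_self]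

variable (L) in
/-- The group of permutations which, together with their inverses, are triangular. -/
def triangularGroup : Subgroup (Equiv.Perm (L →₀ ℤ)) where
  carrier := {τ | IsTriangular τ ∧ IsTriangular (τ⁻¹ : Equiv.Perm (L →₀ ℤ))}
  mul_mem' := by
    rintro θ τ ⟨h1, h2⟩ ⟨h3, h4⟩
    refine ⟨h1.comp h3, ?_⟩
    rw [mul_inv_rev]
    exact h4.comp h2
  one_mem' := ⟨fun x y ℓ _ => by simp, fun x y ℓ _ => by simp⟩
  inv_mem' := by
    rintro τ ⟨h1, h2⟩
    exact ⟨h2, by rwa [inv_inv]⟩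

theorem levelPerm_mem_triangularGroup (ℓ : L) : levelPerm ℓ ∈ triangularGroup L :=
  ⟨isTriangular_levelMap ℓ 1, isTriangular_levelMap ℓ (-1)⟩

theorem conj_mem_fixingGroup {U : Set L} (hU : IsUpperSet U) {τ y : Equiv.Perm (L →₀ ℤ)}
    (hτ : τ ∈ triangularGroup L) (hy : y ∈ fixingGroup U) : τ * y * τ⁻¹ ∈ fixingGroup U := by
  intro x j hj
  rw [Equiv.Perm.mul_apply, Equiv.Perm.mul_apply,
    hτ.1.apply_eq fun i hi => hy (τ⁻¹ x) i (hU hi hj), perm_apply_inv_self]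

/-- The group generated by the unit translations at the levels in `S`. -/
noncomputable def levelGroup (S : Set L) : Subgroup (Equiv.Perm (L →₀ ℤ)) :=
  Subgroup.closure (levelPerm '' S)

theorem levelPerm_mem_levelGroup {S : Set L} {ℓ : L} (h : ℓ ∈ S) : levelPerm ℓ ∈ levelGroup S :=
  Subgroup.subset_closure ⟨ℓ, h, rfl⟩

theorem levelGroup_mono {S T : Set L} (h : S ⊆ T) : levelGroup S ≤ levelGroup T :=
  Subgroup.closure_mono (Set.image_mono h)

theorem levelGroup_le_triangularGroup (S : Set L) : levelGroup S ≤ triangularGroup L := by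
  refine (Subgroup.closure_le _).2 ?_
  rintro _ ⟨ℓ, -, rfl⟩
  exact levelPerm_mem_triangularGroup ℓ

theorem levelGroup_le_fixingGroup (S : Set L) : levelGroup S ≤ fixingGroup Sᶜ := by
  refine (Subgroup.closure_le _).2 ?_
  rintro _ ⟨ℓ, hℓ, rfl⟩ x j hj
  exact levelMap_apply_of_ne 1 x fun h => hj (h ▸ hℓ)

theorem exists_finset_mem_levelGroup {τ : Equiv.Perm (L →₀ ℤ)} (h : τ ∈ levelGroup Set.univ) :
    ∃ S : Finset L, τ ∈ levelGroup (S : Set L) := by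
  classical
  induction h using Subgroup.closure_induction with
  | mem x hx =>
    obtain ⟨ℓ, -, rfl⟩ := hx
    exact ⟨{ℓ}, levelPerm_mem_levelGroup (by simp)⟩
  | one => exact ⟨∅, one_mem _⟩
  | mul x y _ _ hx hy =>
    obtain ⟨S, hS⟩ := hx
    obtain ⟨T, hT⟩ := hy
    exact ⟨S ∪ T, mul_mem (levelGroup_mono (by simp) hS) (levelGroup_mono (by simp) hT)⟩
  | inv x _ hx =>
    obtain ⟨S, hS⟩ := hx
    exact ⟨S, inv_mem hS⟩

theorem levelGroup_fg (S : Finset L) : Group.FG (levelGroup (S : Set L)) := by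
  classical
  rw [Group.fg_iff_subgroup_fg]
  exact ⟨S.image levelPerm, by rw [Finset.coe_image]; rfl⟩

/-- Triangular groups which change only `n` coordinates lie in `EG_n`: the change of the highest of
these coordinates is a homomorphism to an abelian group, whose kernel changes only the remaining
coordinates. -/
theorem inEG_of_le_fixingGroup (S : Finset L) : ∀ H : Subgroup (Equiv.Perm (L →₀ ℤ)),
    H ≤ triangularGroup L → H ≤ fixingGroup (S : Set L)ᶜ → InEG (S.card : Ordinal.{u}) H := by
  induction S using Finset.induction_on_max with
  | empty =>
    intro H _ hH
    have : Subsingleton H := ⟨fun x y => Subtype.ext <| by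
      have h : ∀ z ∈ H, z = 1 := fun z hz =>
        eq_one_of_mem_fixingGroup_univ (by simpa using hH hz)
      rw [h _ x.2, h _ y.2]⟩
    exact inEG_of_subsingleton _ _
  | insert N s hN ih =>
    intro H hT hH
    rw [Finset.card_insert_of_notMem fun h => (hN N h).false, Nat.cast_add_one]
    have key : ∀ τ ∈ H, ∀ x, ∀ j, N < j → τ x j = x j := by
      intro τ hτ x j hj
      refine hH hτ x j ?_
      simp only [Finset.coe_insert, Set.mem_compl_iff, Set.mem_insert_iff, Finset.mem_coe, not_or]
      exact ⟨hj.ne', fun h => (hN j h).not_gt hj⟩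
    let φ : H →* Multiplicative ((L →₀ ℤ) → ℤ) :=
      { toFun := fun τ => Multiplicative.ofAdd fun x => (τ : Equiv.Perm (L →₀ ℤ)) x N - x N
        map_one' := by
          rw [← ofAdd_zero]
          congr 1
          funext x
          simp
        map_mul' := by
          intro θ τ
          rw [← ofAdd_add]
          congr 1
          funext x
          have := (hT θ.2).1 ((τ : Equiv.Perm (L →₀ ℤ)) x) x N (key τ τ.2 x)
          simp only [Subgroup.coe_mul, Equiv.Perm.mul_apply, Pi.add_apply]
          omega }
    refine inEG_succ_of_hom φ ?_
    refine (ih (H ⊓ fixingGroup (s : Set L)ᶜ) (inf_le_left.trans hT) inf_le_right).of_injective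
      (MonoidHom.codRestrict (H.subtype.comp φ.ker.subtype) _ ?_) ?_
    · rintro ⟨⟨τ, hτ⟩, hk⟩
      refine ⟨hτ, fun x j hj => ?_⟩
      rcases eq_or_ne j N with rfl | hjN
      · have := congrFun (congrArg Multiplicative.toAdd ((MonoidHom.mem_ker).1 hk)) x
        exact sub_eq_zero.1 this
      · refine hH hτ x j ?_
        simp only [Finset.coe_insert, Set.mem_compl_iff, Set.mem_insert_iff, Finset.mem_coe, not_or]
        exact ⟨hjN, hj⟩
    · intro x y hxy
      have h := congrArg Subtype.val hxy
      exact Subtype.ext (Subtype.ext h)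

theorem inEG_of_le_levelGroup (S : Finset L) {H : Subgroup (Equiv.Perm (L →₀ ℤ))}
    (hH : H ≤ levelGroup (S : Set L)) : InEG (S.card : Ordinal.{u}) H :=
  inEG_of_le_fixingGroup S H (hH.trans (levelGroup_le_triangularGroup _))
    (hH.trans (levelGroup_le_fixingGroup _))

theorem inEG_levelGroup_univ : InEG (ω + 1 : Ordinal.{u}) (levelGroup (Set.univ : Set L)) := by
  classical
  refine inEG_succ.2 (Or.inr ⟨Set.range fun S : Finset L =>
    (levelGroup (S : Set L)).subgroupOf (levelGroup Set.univ), ⟨_, ∅, rfl⟩, ?_, ?_, ?_⟩)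
  · rintro _ ⟨S, rfl⟩ _ ⟨T, rfl⟩
    exact ⟨_, ⟨S ∪ T, rfl⟩, Subgroup.comap_mono (levelGroup_mono (by simp)),
      Subgroup.comap_mono (levelGroup_mono (by simp))⟩
  · rintro _ ⟨S, rfl⟩
    refine InEG.mono (Ordinal.natCast_lt_omega0 S.card).le ?_
    exact (inEG_of_le_levelGroup S le_rfl).congr
      (Subgroup.subgroupOfEquivOfLe (levelGroup_mono (Set.subset_univ _))).symm
  · rintro ⟨τ, hτ⟩
    obtain ⟨S, hS⟩ := exists_finset_mem_levelGroup hτ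
    exact ⟨_, ⟨S, rfl⟩, hS⟩

theorem exists_finset_of_fg {H : Subgroup (Equiv.Perm (L →₀ ℤ))} (hH : H.FG)
    (hle : H ≤ levelGroup Set.univ) : ∃ S : Finset L, H ≤ levelGroup (S : Set L) := by
  classical
  obtain ⟨T, rfl⟩ := hH
  have hT : ∀ t ∈ T, t ∈ levelGroup Set.univ := fun t ht => hle (Subgroup.subset_closure ht)
  clear hle
  induction T using Finset.induction_on with
  | empty => exact ⟨∅, by simp⟩
  | insert a s _ ih =>
    obtain ⟨S, hS⟩ := ih fun t ht => hT t (Finset.mem_insert_of_mem ht)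
    obtain ⟨S', hS'⟩ := exists_finset_mem_levelGroup (hT a (Finset.mem_insert_self a s))
    refine ⟨S ∪ S', (Subgroup.closure_le _).2 ?_⟩
    rw [Finset.coe_insert, Set.insert_subset_iff]
    exact ⟨levelGroup_mono (by simp) hS', fun t ht => levelGroup_mono (by simp)
      (hS (Subgroup.subset_closure ht))⟩

/-! ### The shift, and levels of elements -/

/-- The shift of coordinates along an order automorphism of the index set. -/
noncomputable def shiftHom : (L ≃o L) →* Equiv.Perm (L →₀ ℤ) where
  toFun θ := (Finsupp.domCongr θ.toEquiv).toEquiv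
  map_one' := by ext x j; rfl
  map_mul' θ τ := by ext x j; rfl

theorem shiftHom_apply (θ : L ≃o L) (x : L →₀ ℤ) (j : L) : shiftHom θ x j = x (θ.symm j) := rfl

theorem shiftHom_add (θ : L ≃o L) (x y : L →₀ ℤ) :
    shiftHom θ (x + y) = shiftHom θ x + shiftHom θ y := by
  ext j; rfl

theorem shiftHom_single (θ : L ≃o L) (ℓ : L) (k : ℤ) :
    shiftHom θ (Finsupp.single ℓ k) = Finsupp.single (θ ℓ) k := by
  classical
  ext j
  rw [shiftHom_apply, Finsupp.single_apply, Finsupp.single_apply]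
  exact if_congr (θ.eq_symm_apply) rfl rfl

theorem shiftHom_mul_levelPerm (θ : L ≃o L) (ℓ : L) :
    shiftHom θ * levelPerm ℓ = levelPerm (θ ℓ) * shiftHom θ := by
  refine Equiv.ext fun x => ?_
  rw [Equiv.Perm.mul_apply, Equiv.Perm.mul_apply, levelPerm_apply, levelPerm_apply]
  by_cases h : ∀ j, ℓ < j → x j = 0
  · rw [levelMap_of_zero _ h, levelMap_of_zero, shiftHom_add, shiftHom_single]
    intro j hj
    exact h _ (θ.lt_symm_apply.2 hj)
  · push Not at h
    obtain ⟨j, hj, h⟩ := h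
    rw [levelMap_of_ne _ hj h, levelMap_of_ne (j := θ j) _ (θ.strictMono hj)]
    rwa [shiftHom_apply, θ.symm_apply_apply]

theorem shiftHom_conj_levelPerm (θ : L ≃o L) (ℓ : L) :
    shiftHom θ * levelPerm ℓ * (shiftHom θ)⁻¹ = levelPerm (θ ℓ) := by
  rw [shiftHom_mul_levelPerm, mul_inv_cancel_right]

theorem shiftHom_conj_mem (θ : L ≃o L) {w : Equiv.Perm (L →₀ ℤ)} (hw : w ∈ levelGroup Set.univ) :
    shiftHom θ * w * (shiftHom θ)⁻¹ ∈ levelGroup Set.univ := by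
  have : levelGroup Set.univ ≤ (levelGroup Set.univ).comap
      (MulAut.conj (shiftHom θ)).toMonoidHom := by
    refine (Subgroup.closure_le _).2 ?_
    rintro _ ⟨ℓ, -, rfl⟩
    rw [SetLike.mem_coe, Subgroup.mem_comap]
    change shiftHom θ * levelPerm ℓ * (shiftHom θ)⁻¹ ∈ _
    rw [shiftHom_conj_levelPerm]
    exact levelPerm_mem_levelGroup trivial
  exact this hw

theorem shiftHom_conj_mem_fixingGroup (θ : L ≃o L) {y : Equiv.Perm (L →₀ ℤ)} {U V : Set L}
    (hUV : ∀ j ∈ V, θ.symm j ∈ U) (hy : y ∈ fixingGroup U) :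
    shiftHom θ * y * (shiftHom θ)⁻¹ ∈ fixingGroup V := by
  intro x j hj
  rw [Equiv.Perm.mul_apply, Equiv.Perm.mul_apply, shiftHom_apply, hy _ _ (hUV j hj),
    ← shiftHom_apply, perm_apply_inv_self]

/-- The group generated by the shift along `θ` and by all unit translations. -/
noncomputable def shiftGroup (θ : L ≃o L) : Subgroup (Equiv.Perm (L →₀ ℤ)) :=
  Subgroup.closure (insert (shiftHom θ) (Set.range levelPerm))

theorem shiftHom_mem_shiftGroup (θ : L ≃o L) : shiftHom θ ∈ shiftGroup θ :=
  Subgroup.subset_closure (Set.mem_insert _ _)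

theorem levelPerm_mem_shiftGroup (θ : L ≃o L) (ℓ : L) : levelPerm ℓ ∈ shiftGroup θ :=
  Subgroup.subset_closure (Set.mem_insert_of_mem _ ⟨ℓ, rfl⟩)

theorem levelGroup_le_shiftGroup (θ : L ≃o L) (S : Set L) : levelGroup S ≤ shiftGroup θ := by
  refine (Subgroup.closure_le _).2 ?_
  rintro _ ⟨ℓ, -, rfl⟩
  exact levelPerm_mem_shiftGroup θ ℓ

theorem exists_eq_mul_shiftHom_zpow {θ : L ≃o L} {x : Equiv.Perm (L →₀ ℤ)}
    (hx : x ∈ shiftGroup θ) :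
    ∃ w ∈ levelGroup Set.univ, ∃ m : ℤ, x = w * shiftHom (θ ^ m) := by
  obtain ⟨w, hw, m, rfl⟩ :=
    exists_eq_mul_zpow_of_mem_closure _ _ _ (shiftHom_conj_levelPerm θ) hx
  exact ⟨w, by rwa [levelGroup, Set.image_univ], m, by rw [map_zpow]⟩

theorem levelGroup_conj_mem {θ : L ≃o L} {x w : Equiv.Perm (L →₀ ℤ)} (hx : x ∈ shiftGroup θ)
    (hw : w ∈ levelGroup Set.univ) : x * w * x⁻¹ ∈ levelGroup Set.univ := by
  obtain ⟨v, hv, m, rfl⟩ := exists_eq_mul_shiftHom_zpow hx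
  have := mul_mem (mul_mem hv (shiftHom_conj_mem (θ ^ m) hw)) (inv_mem hv)
  simpa only [mul_inv_rev, mul_assoc] using this

theorem commutator_mem_levelGroup {θ : L ≃o L} {x y : Equiv.Perm (L →₀ ℤ)}
    (hx : x ∈ shiftGroup θ) (hy : y ∈ shiftGroup θ) :
    x * y * x⁻¹ * y⁻¹ ∈ levelGroup Set.univ := by
  obtain ⟨v, hv, m, rfl⟩ := exists_eq_mul_shiftHom_zpow hx
  obtain ⟨w, hw, n, rfl⟩ := exists_eq_mul_shiftHom_zpow hy
  have hc : shiftHom (θ ^ m) * shiftHom (θ ^ n) = shiftHom (θ ^ n) * shiftHom (θ ^ m) := by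
    rw [← map_mul, ← map_mul, ← zpow_add, ← zpow_add, add_comm]
  have := mul_mem (mul_mem (mul_mem hv (shiftHom_conj_mem (θ ^ m) hw))
    (shiftHom_conj_mem (θ ^ n) (inv_mem hv))) (inv_mem hw)
  convert! this using 1
  generalize shiftHom (θ ^ m) = s at *
  generalize shiftHom (θ ^ n) = t at *
  have hc' : s * t * s⁻¹ = t := by rw [hc, mul_inv_cancel_right]
  calc v * s * (w * t) * (v * s)⁻¹ * (w * t)⁻¹
      = v * (s * w * s⁻¹) * (s * t * s⁻¹) * v⁻¹ * t⁻¹ * w⁻¹ := by group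
    _ = _ := by rw [hc']; group

/-- The level of a nontrivial element: the highest coordinate which it changes. -/
theorem exists_level {y : Equiv.Perm (L →₀ ℤ)} (hy : y ∈ levelGroup Set.univ) (h1 : y ≠ 1) :
    ∃ ℓ, y ∈ fixingGroup (Set.Ioi ℓ) ∧ y ∉ fixingGroup (Set.Ici ℓ) := by
  classical
  obtain ⟨S, hS⟩ := exists_finset_mem_levelGroup hy
  have hS' := levelGroup_le_fixingGroup _ hS
  have hne : (S.filter fun j => ∃ x, y x j ≠ x j).Nonempty := by
    by_contra hne
    rw [Finset.not_nonempty_iff_eq_empty, Finset.filter_eq_empty_iff] at hne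
    refine h1 (eq_one_of_mem_fixingGroup_univ fun x j _ => ?_)
    by_cases hj : j ∈ S
    · by_contra h
      exact hne hj ⟨x, h⟩
    · exact hS' x j hj
  obtain ⟨ℓ, hℓ, hmax⟩ := Finset.exists_max_image _ id hne
  refine ⟨ℓ, fun x j hj => ?_, fun h => ?_⟩
  · by_contra hxj
    have hjS : j ∈ S := by
      by_contra hjS
      exact hxj (hS' x j hjS)
    exact (hmax j (Finset.mem_filter.2 ⟨hjS, x, hxj⟩)).not_gt hj
  · obtain ⟨x, hx⟩ := (Finset.mem_filter.1 hℓ).2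
    exact hx (h x ℓ le_rfl)

theorem lt_zpow_apply {θ : L ≃o L} (hθ : ∀ ℓ, ℓ < θ ℓ) {m : ℤ} (hm : 0 < m) (ℓ : L) :
    ℓ < (θ ^ m) ℓ := by
  obtain ⟨n, rfl⟩ := Int.eq_ofNat_of_zero_le hm.le
  have hn : 0 < n := by omega
  clear hm
  rw [zpow_natCast]
  induction n, hn using Nat.le_induction with
  | base => simpa using hθ ℓ
  | succ n _ ih =>
    rw [pow_succ']
    exact ih.trans (hθ _)

/-- If `θ` moves every index up, then no element outside the group generated by the translations
commutes with a nontrivial element `y` of that group, since it would change the level of `y`. -/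
theorem mem_levelGroup_of_commute {θ : L ≃o L} (hθ : ∀ ℓ, ℓ < θ ℓ) {x y : Equiv.Perm (L →₀ ℤ)}
    (hx : x ∈ shiftGroup θ) (hy : y ∈ levelGroup Set.univ) (h1 : y ≠ 1) (hxy : x * y = y * x) :
    x ∈ levelGroup Set.univ := by
  obtain ⟨ℓ, hℓ, hℓ'⟩ := exists_level hy h1
  have key : ∀ w ∈ levelGroup (Set.univ : Set L), ∀ m : ℤ, 0 < m →
      w * shiftHom (θ ^ m) * y = y * (w * shiftHom (θ ^ m)) → False := by
    intro w hw m hm h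
    have h2 : shiftHom (θ ^ m) * y * (shiftHom (θ ^ m))⁻¹ ∈ fixingGroup (Set.Ioi ℓ) := by
      have := conj_mem_fixingGroup (isUpperSet_Ioi ℓ)
        (inv_mem (levelGroup_le_triangularGroup _ hw)) hℓ
      convert! this using 1
      rw [inv_inv, mul_assoc _ y w, eq_inv_mul_iff_mul_eq, ← mul_assoc, ← mul_assoc, h]
      group
    have h3 := shiftHom_conj_mem_fixingGroup (θ ^ (-m)) (V := Set.Ici ℓ) (fun j hj => ?_) h2
    · refine hℓ' ?_
      convert! h3 using 1
      rw [zpow_neg, map_inv]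
      group
    · rw [zpow_neg]
      exact lt_of_le_of_lt hj (lt_zpow_apply hθ hm j)
  obtain ⟨w, hw, m, rfl⟩ := exists_eq_mul_shiftHom_zpow hx
  rcases lt_trichotomy m 0 with hm | rfl | hm
  -- If the shift part of `x` moves indices down, then that of `x⁻¹` moves them up.
  · refine (key (shiftHom (θ ^ (-m)) * w⁻¹ * (shiftHom (θ ^ (-m)))⁻¹)
      (shiftHom_conj_mem _ (inv_mem hw)) (-m) (by omega) ?_).elim
    have e : shiftHom (θ ^ (-m)) * w⁻¹ * (shiftHom (θ ^ (-m)))⁻¹ * shiftHom (θ ^ (-m)) =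
        (w * shiftHom (θ ^ m))⁻¹ := by
      rw [zpow_neg, map_inv]
      group
    rw [e, inv_mul_eq_iff_eq_mul, ← mul_assoc, hxy, mul_inv_cancel_right]
  · simpa using hw
  · exact (key w hw m hm hxy).elim

end LevelTranslations

/-! ### Sections of groups of translations and the lower bound for the EA-class -/

section Relations

universe u

variable {L : Type u} [LinearOrder L]

theorem levelPerm_apply_of_ne {ℓ j : L} {x : L →₀ ℤ} (hj : ℓ < j) (h : x j ≠ 0) :
    levelPerm ℓ x = x := levelMap_of_ne 1 hj h

theorem levelPerm_mem_fixingGroup {ℓ : L} {U : Set L} (h : ℓ ∉ U) :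
    levelPerm ℓ ∈ fixingGroup U :=
  fun x _ hj => levelMap_apply_of_ne 1 x fun e => h (e ▸ hj)

theorem apply_eq_self_of_mem_levelGroup {S : Set L} {j : L} (hS : ∀ s ∈ S, s < j) {x : L →₀ ℤ}
    (hx : x j ≠ 0) {τ : Equiv.Perm (L →₀ ℤ)} (hτ : τ ∈ levelGroup S) : τ x = x := by
  have : levelGroup S ≤ MulAction.stabilizer (Equiv.Perm (L →₀ ℤ)) x := by
    refine (Subgroup.closure_le _).2 ?_
    rintro _ ⟨ℓ, hℓ, rfl⟩
    exact levelPerm_apply_of_ne (hS ℓ hℓ) hx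
  exact this hτ

theorem levelPerm_mul_ne {i j : L} (h : i < j) :
    levelPerm i * levelPerm j ≠ levelPerm j * levelPerm i := by
  intro e
  have e1 := congrFun (congrArg DFunLike.coe e) 0
  rw [Equiv.Perm.mul_apply, Equiv.Perm.mul_apply, levelPerm_apply j, levelMap_of_zero 1 (by simp),
    levelPerm_apply_of_ne h (by simp), levelPerm_apply i, levelMap_of_zero 1 (by simp),
    levelPerm_apply, levelMap_of_zero] at e1
  · have := DFunLike.congr_fun e1 i
    simp [h.ne] at this
  · intro k hk
    simp [(h.trans hk).ne]

/-- A translation and the conjugate of another one by a translation of higher level commute, since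
they act on different blocks. -/
theorem levelPerm_mul_conj {i j ℓ : L} (hi : i < ℓ) (hj : j < ℓ) :
    levelPerm i * (levelPerm ℓ * levelPerm j * (levelPerm ℓ)⁻¹) =
      levelPerm ℓ * levelPerm j * (levelPerm ℓ)⁻¹ * levelPerm i := by
  have h1 : levelPerm ℓ * levelPerm j * (levelPerm ℓ)⁻¹ ∈ fixingGroup (Set.Ici ℓ) :=
    conj_mem_fixingGroup (isUpperSet_Ici ℓ) (levelPerm_mem_triangularGroup ℓ)
      (levelPerm_mem_fixingGroup (not_le.2 hj))
  have h2 : ∀ z : L →₀ ℤ, z ℓ = 0 → (levelPerm ℓ * levelPerm j * (levelPerm ℓ)⁻¹) z = z := by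
    intro z hz
    have : levelPerm j ((levelPerm ℓ)⁻¹ z) = (levelPerm ℓ)⁻¹ z := by
      rw [levelPerm_inv_apply]
      by_cases h : ∀ k, ℓ < k → z k = 0
      · refine levelPerm_apply_of_ne hj ?_
        rw [levelMap_of_zero _ h]
        simp [hz]
      · push Not at h
        obtain ⟨k, hk, h⟩ := h
        rw [levelMap_of_ne _ hk h]
        exact levelPerm_apply_of_ne (hj.trans hk) h
    rw [Equiv.Perm.mul_apply, Equiv.Perm.mul_apply, this, perm_apply_inv_self]
  generalize levelPerm ℓ * levelPerm j * (levelPerm ℓ)⁻¹ = c at h1 h2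
  refine Equiv.ext fun x => ?_
  rw [Equiv.Perm.mul_apply, Equiv.Perm.mul_apply]
  by_cases hx : x ℓ = 0
  · rw [h2 x hx, h2]
    rwa [levelPerm_mem_fixingGroup (U := Set.Ici ℓ) (not_le.2 hi) x ℓ le_rfl]
  · rw [levelPerm_apply_of_ne hi hx, levelPerm_apply_of_ne hi]
    rwa [h1 x ℓ le_rfl]

theorem exists_levelGroup_apply_zero {S : Set L} (y : L →₀ ℤ) (hy : ∀ j, y j ≠ 0 → j ∈ S) :
    ∃ τ ∈ levelGroup S, τ 0 = y := by
  induction y using Finsupp.induction_on_max with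
  | zero => exact ⟨1, one_mem _, rfl⟩
  | single_add a b f hf hb ih =>
    have hfa : f a = 0 := by
      by_contra h
      exact (hf a (Finsupp.mem_support_iff.2 h)).false
    obtain ⟨τ, hτ, h⟩ := ih fun j hj => hy j <| by
      rcases eq_or_ne j a with rfl | hja
      · exact absurd hfa hj
      · simpa [hja] using hj
    refine ⟨levelPerm a ^ b * τ, mul_mem (zpow_mem (levelPerm_mem_levelGroup (hy a ?_)) b) hτ, ?_⟩
    · simpa [hfa] using hb
    · rw [Equiv.Perm.mul_apply, h, levelPerm_zpow_apply, levelMap_of_zero, add_comm]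
      intro j hj
      by_contra h'
      exact (hf j (Finsupp.mem_support_iff.2 h')).not_gt hj

/-- If `N` meets the group of the upper levels `T` nontrivially, then the group of the lower levels
`S` is a section of `N`: a nontrivial `w ∈ N` of the upper levels may be conjugated so that it moves
the block of all sequences vanishing in the upper levels off itself, and then the commutator of any
`u` of the lower levels with `w` lies in `N` and acts on this block in the same way as `u`. -/
theorem inEG_levelGroup_of_normal {S T V : Set L} {c : L} (hSV : S ⊆ V) (hTV : T ⊆ V)
    (hS : ∀ s ∈ S, s < c) (hT : ∀ j, j ∈ T ↔ c ≤ j ∧ j ∈ V)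
    (hV : ∀ j, c ≤ j → j ∉ V → ∀ v ∈ V, v < j)
    (N : Subgroup (levelGroup V)) [N.Normal] {α : Ordinal.{u}} (hN : InEG α N)
    {w : levelGroup V} (hwN : w ∈ N) (hwT : (w : Equiv.Perm (L →₀ ℤ)) ∈ levelGroup T)
    (hw : w ≠ 1) : InEG α (levelGroup S) := by
  classical
  have hTfix : ∀ τ ∈ levelGroup T, ∀ (x : L →₀ ℤ) (j : L), j < c → τ x j = x j :=
    fun τ hτ x j hj => levelGroup_le_fixingGroup T hτ x j fun h => ((hT j).1 h).1.not_gt hj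
  have hSfix : ∀ τ ∈ levelGroup S, ∀ (x : L →₀ ℤ) (j : L), c ≤ j → τ x j = x j :=
    fun τ hτ x j hj => levelGroup_le_fixingGroup S hτ x j fun h => (hS j h).not_ge hj
  -- A conjugate of `w` in `N` which moves the zero sequence, hence the block it represents.
  obtain ⟨v, hvN, hvT, hv⟩ : ∃ v : levelGroup V, v ∈ N ∧
      (v : Equiv.Perm (L →₀ ℤ)) ∈ levelGroup T ∧ (v : Equiv.Perm (L →₀ ℤ)) 0 ≠ 0 := by
    obtain ⟨x, hx⟩ : ∃ x, (w : Equiv.Perm (L →₀ ℤ)) x ≠ x := by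
      by_contra! h
      exact hw (Subtype.ext (Equiv.ext h))
    have hxV : ∀ j, c ≤ j → x j ≠ 0 → j ∈ V := by
      intro j hj hxj
      by_contra hjV
      exact hx (apply_eq_self_of_mem_levelGroup (hV j hj hjV) hxj w.2)
    obtain ⟨y, hyT, hy⟩ := exists_levelGroup_apply_zero (S := T) (x.filter (c ≤ ·)) (by
      intro j hj
      by_cases hcj : c ≤ j
      · rw [Finsupp.filter_apply_pos _ _ hcj] at hj
        exact (hT j).2 ⟨hcj, hxV j hcj hj⟩
      · exact absurd (Finsupp.filter_apply_neg _ _ hcj) hj)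
    let y' : levelGroup V := ⟨y, levelGroup_mono hTV hyT⟩
    refine ⟨y'⁻¹ * w * y'⁻¹⁻¹, Subgroup.Normal.conj_mem inferInstance w hwN _,
      mul_mem (mul_mem (inv_mem hyT) hwT) (inv_mem (inv_mem hyT)), fun h => hx ?_⟩
    have h' : (w : Equiv.Perm (L →₀ ℤ)) (y 0) = y 0 := by
      have : y⁻¹ ((w : Equiv.Perm (L →₀ ℤ)) (y 0)) = 0 := by
        rw [inv_inv] at h
        exact h
      rw [← perm_apply_inv_self y ((w : Equiv.Perm (L →₀ ℤ)) (y 0)), this]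
    rw [hy] at h'
    ext j
    rcases lt_or_ge j c with hj | hj
    · exact hTfix _ hwT x j hj
    · have := (levelGroup_le_triangularGroup _ w.2).1.apply_eq (x := x) (y := x.filter (c ≤ ·))
        (ℓ := j) fun i hi => (Finsupp.filter_apply_pos _ _ (hj.trans hi)).symm
      rw [this, h', Finsupp.filter_apply_pos _ _ hj]
  have hmove : ∀ z : L →₀ ℤ, (∀ j, c ≤ j → z j = 0) →
      ∃ j, c ≤ j ∧ (v⁻¹ : Equiv.Perm (L →₀ ℤ)) z j ≠ 0 := by
    intro z hz
    obtain ⟨j, hj⟩ : ∃ j, (v⁻¹ : Equiv.Perm (L →₀ ℤ)) 0 j ≠ 0 := by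
      by_contra! h
      refine hv ?_
      have : (v⁻¹ : Equiv.Perm (L →₀ ℤ)) 0 = 0 := Finsupp.ext h
      conv_lhs => rw [← this]
      rw [perm_apply_inv_self]
    have hcj : c ≤ j := by
      by_contra hcj
      exact hj (hTfix _ (inv_mem hvT) 0 j (not_le.1 hcj))
    refine ⟨j, hcj, ?_⟩
    rwa [(levelGroup_le_triangularGroup _ v.2).2.apply_eq (y := 0) fun i hi => hz i (hcj.trans hi)]
  -- `n ∈ N` corresponds to `u` if both act in the same way on the block.
  let R : Subgroup (N × levelGroup S) :=
    { carrier := {p | ∀ z : L →₀ ℤ, (∀ j, c ≤ j → z j = 0) →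
        (p.1 : Equiv.Perm (L →₀ ℤ)) z = (p.2 : Equiv.Perm (L →₀ ℤ)) z}
      mul_mem' := by
        rintro ⟨n, u⟩ ⟨n', u'⟩ h h' z hz
        change (n : Equiv.Perm (L →₀ ℤ)) ((n' : Equiv.Perm (L →₀ ℤ)) z) =
          (u : Equiv.Perm (L →₀ ℤ)) ((u' : Equiv.Perm (L →₀ ℤ)) z)
        rw [h' z hz]
        exact h _ fun j hj => (hSfix _ u'.2 z j hj).trans (hz j hj)
      one_mem' := fun z _ => rfl
      inv_mem' := by
        rintro ⟨n, u⟩ h z hz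
        change (n⁻¹ : Equiv.Perm (L →₀ ℤ)) z = (u⁻¹ : Equiv.Perm (L →₀ ℤ)) z
        have := h ((u⁻¹ : Equiv.Perm (L →₀ ℤ)) z)
          fun j hj => (hSfix _ (inv_mem u.2) z j hj).trans (hz j hj)
        rw [Equiv.Perm.inv_eq_iff_eq]
        rw [perm_apply_inv_self] at this
        exact this.symm }
  have hout : ∀ u ∈ levelGroup S, ∀ (z : L →₀ ℤ) (j : L), c ≤ j → z j ≠ 0 → u z = z :=
    fun u hu z j hj hz => apply_eq_self_of_mem_levelGroup
      (fun s hs => (hS s hs).trans_le hj) hz hu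
  refine hN.of_correspondence R (fun u hu => Subtype.ext (Equiv.ext fun z => ?_)) fun u => ?_
  · by_cases hz : ∀ j, c ≤ j → z j = 0
    · exact (hu z hz).symm
    · push Not at hz
      obtain ⟨j, hj, hz⟩ := hz
      exact hout u u.2 z j hj hz
  · let u' : levelGroup V := ⟨u, levelGroup_mono hSV u.2⟩
    refine ⟨⟨u' * v * u'⁻¹ * v⁻¹, mul_mem (Subgroup.Normal.conj_mem inferInstance v hvN u')
      (inv_mem hvN)⟩, fun z hz => ?_⟩
    obtain ⟨j, hj, hz'⟩ := hmove z hz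
    change (u : Equiv.Perm (L →₀ ℤ)) ((v : Equiv.Perm (L →₀ ℤ))
      ((u⁻¹ : Equiv.Perm (L →₀ ℤ)) ((v⁻¹ : Equiv.Perm (L →₀ ℤ)) z))) = _
    rw [hout _ (inv_mem u.2) _ j hj hz', perm_apply_inv_self]

end Relations

/-- The iterated wreath product of `2 ^ (n + 1)` infinite cyclic groups is not in `EG_n`. Here its
levels form an interval in a convex copy of the integers. If the group is an extension with kernel
`N`, then either `N` meets the group of the upper half of the levels nontrivially and has the group
of the lower half as a section, or the group of the upper half embeds into the quotient by `N`. -/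
theorem not_inEG_levelGroup_Ico {L : Type} [LinearOrder L] (e : ℤ ↪o L)
    (he : ∀ i j ℓ, e i ≤ ℓ → ℓ ≤ e j → ∃ k, e k = ℓ) (n : ℕ) : ∀ i : ℤ,
    ¬ InEG (n : Ordinal.{0}) (levelGroup (e '' Set.Ico i (i + 2 ^ (n + 1)))) := by
  induction n with
  | zero =>
    intro i h
    rw [Nat.cast_zero, inEG_zero] at h
    have h0 : levelPerm (e i) ∈ levelGroup (e '' Set.Ico i (i + 2 ^ (0 + 1))) :=
      levelPerm_mem_levelGroup (by simp)
    have h1 : levelPerm (e (i + 1)) ∈ levelGroup (e '' Set.Ico i (i + 2 ^ (0 + 1))) :=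
      levelPerm_mem_levelGroup (by simp)
    rcases h with h | h
    · exact levelPerm_mul_ne (e.strictMono (lt_add_one i))
        (congrArg Subtype.val (h ⟨_, h0⟩ ⟨_, h1⟩))
    · refine Infinite.not_finite (α := ℤ) (Finite.of_injective
        (fun k : ℤ => (⟨_, h0⟩ : levelGroup (e '' Set.Ico i (i + 2 ^ (0 + 1)))) ^ k)
        fun k m hkm => ?_)
      have h' := DFunLike.congr_fun
        (congrFun (congrArg DFunLike.coe (congrArg Subtype.val hkm)) 0) (e i)
      change (levelPerm (e i) ^ k) 0 (e i) = (levelPerm (e i) ^ m) 0 (e i) at h'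
      rw [levelPerm_zpow_apply, levelPerm_zpow_apply, levelMap_of_zero _ (by simp),
        levelMap_of_zero _ (by simp)] at h'
      simpa using h'
  | succ n ih =>
    intro i h
    have hp : (0 : ℤ) < 2 ^ (n + 1) := by positivity
    have hp' : (2 : ℤ) ^ (n + 1 + 1) = 2 ^ (n + 1) + 2 ^ (n + 1) := by ring
    rw [hp'] at h
    generalize hq : (2 : ℤ) ^ (n + 1) = q at hp h ih
    have hlo : e '' Set.Ico i (i + q) ⊆ e '' Set.Ico i (i + (q + q)) :=
      Set.image_mono fun j hj => ⟨hj.1, by have := hj.2; omega⟩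
    have hhi : e '' Set.Ico (i + q) (i + q + q) ⊆ e '' Set.Ico i (i + (q + q)) :=
      Set.image_mono fun j hj => ⟨by have := hj.1; omega, by have := hj.2; omega⟩
    have hfg : Group.FG (levelGroup (e '' Set.Ico i (i + (q + q)))) := by
      classical
      rw [← Finset.coe_Ico, ← Finset.coe_image]
      exact levelGroup_fg _
    rw [Nat.cast_add_one] at h
    rcases h.extensionOf_of_fg hfg with h | ⟨N, hN, h1, h2⟩
    · exact ih i (h.of_injective (Subgroup.inclusion (levelGroup_mono hlo))
        (Subgroup.inclusion_injective _))
    · by_cases hw : ∃ w : levelGroup (e '' Set.Ico i (i + (q + q))), w ∈ N ∧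
        (w : Equiv.Perm (L →₀ ℤ)) ∈ levelGroup (e '' Set.Ico (i + q) (i + q + q)) ∧ w ≠ 1
      · obtain ⟨w, hwN, hwT, hw⟩ := hw
        refine ih i (inEG_levelGroup_of_normal (c := e (i + q)) hlo hhi ?_
          (fun j => ⟨?_, ?_⟩) ?_ N h1 hwN hwT hw)
        · rintro _ ⟨s, hs, rfl⟩
          exact e.strictMono hs.2
        · rintro ⟨k, hk, rfl⟩
          exact ⟨e.monotone hk.1, hhi ⟨k, hk, rfl⟩⟩
        · rintro ⟨hj, k, hk, rfl⟩
          exact ⟨k, ⟨e.le_iff_le.1 hj, by have := hk.2; omega⟩, rfl⟩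
        · rintro j hj hj' _ ⟨v, hv, rfl⟩
          by_contra hjv
          obtain ⟨k, rfl⟩ := he _ _ j hj (not_lt.1 hjv)
          have h3 := e.le_iff_le.1 hj
          have h4 := e.le_iff_le.1 (not_lt.1 hjv)
          exact hj' ⟨k, ⟨by omega, by have := hv.2; omega⟩, rfl⟩
      · push Not at hw
        refine ih (i + q) (h2.of_injective
          ((QuotientGroup.mk' N).comp (Subgroup.inclusion (levelGroup_mono hhi))) ?_)
        rw [injective_iff_map_eq_one]
        intro w hwN
        have := hw (Subgroup.inclusion (levelGroup_mono hhi) w)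
          ((QuotientGroup.eq_one_iff _).1 hwN) w.2
        have h' := congrArg Subtype.val this
        exact Subtype.ext h'

/-! ### Groups generated by the shift and the translations -/

section ShiftGroup

/-- It is enough to keep one member of the family from each orbit of the conjugation. -/
theorem closure_insert_image_eq {L Γ : Type*} [LE L] [Group Γ] (θ : L ≃o L) (a : Γ)
    (b : L → Γ) (hab : ∀ ℓ, a * b ℓ * a⁻¹ = b (θ ℓ)) (E : Set L)
    (hE : ∀ ℓ, ∃ e ∈ E, ∃ m : ℤ, (θ ^ m) e = ℓ) :
    Subgroup.closure (insert a (b '' E)) = Subgroup.closure (insert a (Set.range b)) := by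
  refine le_antisymm (Subgroup.closure_mono (Set.insert_subset_insert (Set.image_subset_range b E)))
    ((Subgroup.closure_le _).2 (Set.insert_subset_iff.2
      ⟨Subgroup.subset_closure (Set.mem_insert _ _), ?_⟩))
  rintro _ ⟨ℓ, rfl⟩
  obtain ⟨e, he, m, rfl⟩ := hE ℓ
  rw [← zpow_conj_eq θ a b hab]
  have h1 : a ∈ Subgroup.closure (insert a (b '' E)) :=
    Subgroup.subset_closure (Set.mem_insert _ _)
  exact mul_mem (mul_mem (zpow_mem h1 m) (Subgroup.subset_closure (Set.mem_insert_of_mem _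
    ⟨e, he, rfl⟩))) (inv_mem (zpow_mem h1 m))

theorem shiftGroup_fg {L : Type*} [LinearOrder L] (θ : L ≃o L) (E : Set L) (hE' : E.Finite)
    (hE : ∀ ℓ, ∃ e ∈ E, ∃ m : ℤ, (θ ^ m) e = ℓ) : (shiftGroup θ).FG := by
  rw [shiftGroup, ← closure_insert_image_eq θ _ _ (shiftHom_conj_levelPerm θ) E hE]
  exact (Subgroup.fg_iff _).2 ⟨_, rfl, (hE'.image _).insert _⟩

/-- If a normal subgroup of `G` is in `EG_α` and contains all commutators, then the product of `G`
with an abelian group is in `EG_{α+1}`. -/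
theorem inEG_succ_prod.{u} {α : Ordinal.{u}} {G A : Type u} [Group G] [CommGroup A]
    (N : Subgroup G) [N.Normal] (hc : ∀ x y : G, x * y * x⁻¹ * y⁻¹ ∈ N) (hN : InEG α N) :
    InEG (α + 1) (G × A) := by
  refine inEG_succ.2 (Or.inl ⟨N.prod ⊥, inferInstance, ?_, InEG.mono zero_le (inEG_zero.2
    (Or.inl fun x y => ?_))⟩)
  · refine hN.of_injective (MonoidHom.codRestrict
      ((MonoidHom.fst G A).comp (N.prod (⊥ : Subgroup A)).subtype) N fun x => x.2.1) ?_
    rw [injective_iff_map_eq_one]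
    rintro ⟨⟨g, a⟩, hg, ha⟩ h
    obtain rfl : a = 1 := ha
    obtain rfl : g = 1 := congrArg Subtype.val h
    rfl
  · induction x using QuotientGroup.induction_on with
    | H x =>
      induction y using QuotientGroup.induction_on with
      | H y =>
        rw [← QuotientGroup.mk_mul, ← QuotientGroup.mk_mul, QuotientGroup.eq]
        refine ⟨?_, ?_⟩
        · have := hc y.1⁻¹ x.1⁻¹
          rw [inv_inv, inv_inv] at this
          simpa [mul_assoc] using this
        · change (x.2 * y.2)⁻¹ * (y.2 * x.2) = 1
          rw [mul_comm y.2, inv_mul_cancel]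

theorem inEG_shiftGroup_prod {L : Type} [LinearOrder L] (θ : L ≃o L) :
    InEG (ω + 1 + 1 : Ordinal.{0}) (shiftGroup θ × Multiplicative ℤ) := by
  let N := (levelGroup (Set.univ : Set L)).subgroupOf (shiftGroup θ)
  have : N.Normal := ⟨fun n hn g => levelGroup_conj_mem g.2 hn⟩
  exact inEG_succ_prod N (fun x y => commutator_mem_levelGroup x.2 y.2)
    (inEG_levelGroup_univ.congr (Subgroup.subgroupOfEquivOfLe (levelGroup_le_shiftGroup θ _)).symm)

theorem inEG_shiftGroup {L : Type} [LinearOrder L] (θ : L ≃o L) :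
    InEG (ω + 1 + 1 : Ordinal.{0}) (shiftGroup θ) :=
  (inEG_shiftGroup_prod θ).of_injective (MonoidHom.inl _ _) fun _ _ h => (Prod.ext_iff.1 h).1

theorem not_inEG_shiftGroup {L : Type} [LinearOrder L] (e : ℤ ↪o L)
    (he : ∀ i j ℓ, e i ≤ ℓ → ℓ ≤ e j → ∃ k, e k = ℓ) (θ : L ≃o L) (n : ℕ) :
    ¬ InEG (n : Ordinal.{0}) (shiftGroup θ) := fun h =>
  not_inEG_levelGroup_Ico e he n 0 (h.of_injective
    (Subgroup.inclusion (levelGroup_le_shiftGroup θ _)) (Subgroup.inclusion_injective _))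

end ShiftGroup

/-! ### The two model groups and their non-embeddability -/

/-- The translation by one of the integers. -/
def succIso : ℤ ≃o ℤ := OrderIso.addRight 1

theorem succIso_apply (n : ℤ) : succIso n = n + 1 := rfl

theorem succIso_zpow_apply (m n : ℤ) : (succIso ^ m) n = n + m := by
  induction m using Int.induction_on generalizing n with
  | zero => simp
  | succ m ih =>
    rw [zpow_add_one, RelIso.mul_apply, ih, succIso_apply]
    ring
  | pred m ih =>
    have h : (succIso⁻¹ : ℤ ≃o ℤ) n = n - 1 := rfl
    rw [zpow_sub_one, RelIso.mul_apply, h, ih]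
    ring

theorem lt_succIso (n : ℤ) : n < succIso n := lt_add_one n

/-- The index set of the levels of the second group: two copies of the integers, the first one
below the second one. -/
abbrev TwoInt : Type := ℤ ⊕ₗ ℤ

/-- The translation by one of both copies of the integers. -/
def succIsoTwo : TwoInt ≃o TwoInt := OrderIso.sumLexCongr succIso succIso

theorem succIsoTwo_inr (n : ℤ) : succIsoTwo (Sum.inrₗ n) = Sum.inrₗ (n + 1) := rfl

theorem TwoInt.cases (ℓ : TwoInt) : (∃ n, ℓ = Sum.inlₗ n) ∨ ∃ n, ℓ = Sum.inrₗ n := by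
  induction ℓ using Lex.rec with
  | h ℓ =>
    rcases ℓ with n | n
    · exact Or.inl ⟨n, rfl⟩
    · exact Or.inr ⟨n, rfl⟩

theorem lt_succIsoTwo (ℓ : TwoInt) : ℓ < succIsoTwo ℓ := by
  rcases TwoInt.cases ℓ with ⟨n, rfl⟩ | ⟨n, rfl⟩
  · exact Sum.Lex.inl_lt_inl_iff.2 (lt_add_one n)
  · exact Sum.Lex.inr_lt_inr_iff.2 (lt_add_one n)

theorem succIsoTwo_zpow (m : ℤ) :
    succIsoTwo ^ m = OrderIso.sumLexCongr (succIso ^ m) (succIso ^ m) := by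
  have h : ∀ ℓ : TwoInt, (succIsoTwo ^ m) ℓ =
      OrderIso.sumLexCongr (succIso ^ m) (succIso ^ m) ℓ := by
    induction m using Int.induction_on with
    | zero =>
      intro ℓ
      rcases TwoInt.cases ℓ with ⟨n, rfl⟩ | ⟨n, rfl⟩ <;> rfl
    | succ m ih =>
      intro ℓ
      rw [zpow_add_one, zpow_add_one, RelIso.mul_apply, ih]
      rcases TwoInt.cases ℓ with ⟨n, rfl⟩ | ⟨n, rfl⟩ <;> rfl
    | pred m ih =>
      intro ℓ
      rw [zpow_sub_one, zpow_sub_one, RelIso.mul_apply, ih]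
      rcases TwoInt.cases ℓ with ⟨n, rfl⟩ | ⟨n, rfl⟩ <;> rfl
  exact RelIso.ext h

theorem succIsoTwo_zpow_inl (m n : ℤ) :
    (succIsoTwo ^ m) (Sum.inlₗ n) = Sum.inlₗ (n + m) := by
  rw [succIsoTwo_zpow, ← succIso_zpow_apply]
  rfl

theorem succIsoTwo_zpow_inr (m n : ℤ) :
    (succIsoTwo ^ m) (Sum.inrₗ n) = Sum.inrₗ (n + m) := by
  rw [succIsoTwo_zpow, ← succIso_zpow_apply]
  rfl

theorem exists_succIso_zpow (ℓ : ℤ) : ∃ e ∈ ({0} : Set ℤ), ∃ m : ℤ, (succIso ^ m) e = ℓ :=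
  ⟨0, rfl, ℓ, by rw [succIso_zpow_apply, zero_add]⟩

theorem exists_succIsoTwo_zpow (ℓ : TwoInt) :
    ∃ e ∈ ({Sum.inrₗ 0, Sum.inlₗ 0} : Set TwoInt), ∃ m : ℤ, (succIsoTwo ^ m) e = ℓ := by
  rcases TwoInt.cases ℓ with ⟨n, rfl⟩ | ⟨n, rfl⟩
  · exact ⟨Sum.inlₗ 0, Or.inr rfl, n, by rw [succIsoTwo_zpow_inl, zero_add]⟩
  · exact ⟨Sum.inrₗ 0, Or.inl rfl, n, by rw [succIsoTwo_zpow_inr, zero_add]⟩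

theorem not_inEG_shiftGroup_succIso (n : ℕ) : ¬ InEG (n : Ordinal.{0}) (shiftGroup succIso) :=
  not_inEG_shiftGroup (RelEmbedding.refl _) (fun _ _ ℓ _ _ => ⟨ℓ, rfl⟩) _ n

theorem not_inEG_shiftGroup_succIsoTwo (n : ℕ) :
    ¬ InEG (n : Ordinal.{0}) (shiftGroup succIsoTwo) := by
  refine not_inEG_shiftGroup (OrderEmbedding.ofStrictMono Sum.inlₗ Sum.Lex.inl_strictMono) ?_ _ n
  intro i j ℓ _ h
  rcases TwoInt.cases ℓ with ⟨n, rfl⟩ | ⟨n, rfl⟩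
  · exact ⟨n, rfl⟩
  · exact absurd h Sum.Lex.not_inr_le_inl

theorem shiftGroup_succIso_fg : (shiftGroup succIso).FG :=
  shiftGroup_fg _ _ (Set.finite_singleton 0) exists_succIso_zpow

theorem shiftGroup_succIsoTwo_fg : (shiftGroup succIsoTwo).FG :=
  shiftGroup_fg _ _ (Set.toFinite _) exists_succIsoTwo_zpow

theorem hasEAClass_shiftGroup_succIso_prod :
    HasEAClass (shiftGroup succIso × Multiplicative ℤ) (ω + 2) := by
  have h1 : Group.FG (shiftGroup succIso) := (Group.fg_iff_subgroup_fg _).2 shiftGroup_succIso_fg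
  exact hasEAClass_omega_add_two inferInstance (inEG_shiftGroup_prod _) fun n h =>
    not_inEG_shiftGroup_succIso n (h.of_injective (MonoidHom.inl _ _)
      fun _ _ h => (Prod.ext_iff.1 h).1)

theorem hasEAClass_shiftGroup_succIsoTwo : HasEAClass (shiftGroup succIsoTwo) (ω + 2) :=
  hasEAClass_omega_add_two ((Group.fg_iff_subgroup_fg _).2 shiftGroup_succIsoTwo_fg)
    (inEG_shiftGroup _) not_inEG_shiftGroup_succIsoTwo

/-- The images of the finitely many generators involve only finitely many levels. -/
theorem exists_inEG_range {G L : Type} [Group G] [LinearOrder L] (hG : Group.FG G)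
    (p : G →* Equiv.Perm (L →₀ ℤ)) (hp : ∀ x, p x ∈ levelGroup Set.univ) :
    ∃ n : ℕ, InEG (n : Ordinal.{0}) p.range := by
  have h1 : p.range.FG := by
    have := hG
    exact (Group.fg_iff_subgroup_fg _).1 (Group.fg_range p)
  obtain ⟨S, hS⟩ := exists_finset_of_fg h1 (by rintro _ ⟨x, rfl⟩; exact hp x)
  exact ⟨_, inEG_of_le_levelGroup S hS⟩

theorem mul_conj_commutator_ne_one {G : Type*} [Group G] {x y : G} (h : x * y ≠ y * x) :
    x * y * x⁻¹ * y⁻¹ ≠ 1 := by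
  rwa [Ne, mul_inv_eq_one, mul_inv_eq_iff_eq_mul]

/-- The image of the central factor would commute with the image of a nontrivial commutator, so it
would lie in the group generated by the translations; as the image of `shiftGroup succIso` is not
contained in this group, this contradicts `mem_levelGroup_of_commute`. -/
theorem not_embeds_shiftGroup_prod {L : Type} [LinearOrder L] (θ : L ≃o L) (hθ : ∀ ℓ, ℓ < θ ℓ) :
    ¬ Embeds (shiftGroup succIso × Multiplicative ℤ) (shiftGroup θ) := by
  rintro ⟨φ, hφ⟩
  let p : shiftGroup succIso × Multiplicative ℤ →* Equiv.Perm (L →₀ ℤ) :=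
    (shiftGroup θ).subtype.comp φ
  have hp : Function.Injective p := Subtype.val_injective.comp hφ
  have hpm : ∀ x, p x ∈ shiftGroup θ := fun x => (φ x).2
  let b (i : ℤ) : shiftGroup succIso := ⟨levelPerm i, levelPerm_mem_shiftGroup _ i⟩
  let c : shiftGroup succIso × Multiplicative ℤ := (1, Multiplicative.ofAdd 1)
  have hc : ∀ x : shiftGroup succIso, (x, 1) * c = c * (x, 1) := fun x => by
    simp [c]
  have hb : b 0 * b 1 ≠ b 1 * b 0 := fun h =>
    levelPerm_mul_ne zero_lt_one (congrArg Subtype.val h)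
  let y := b 0 * b 1 * (b 0)⁻¹ * (b 1)⁻¹
  have hy : p (y, 1) ∈ levelGroup Set.univ := by
    have e : ((y, 1) : shiftGroup succIso × Multiplicative ℤ) =
        (b 0, 1) * (b 1, 1) * (b 0, 1)⁻¹ * (b 1, 1)⁻¹ := by simp [y]
    rw [e, map_mul, map_mul, map_mul, map_inv, map_inv]
    exact commutator_mem_levelGroup (hpm _) (hpm _)
  have hy1 : p (y, 1) ≠ 1 := by
    rw [Ne, map_eq_one_iff p hp]
    exact fun h => mul_conj_commutator_ne_one hb (congrArg Prod.fst h)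
  have hpc : p c ∈ levelGroup Set.univ :=
    mem_levelGroup_of_commute hθ (hpm c) hy hy1 (by rw [← map_mul, ← map_mul, hc])
  have hpc1 : p c ≠ 1 := by
    rw [Ne, map_eq_one_iff p hp]
    intro h
    have h' : (1 : ℤ) = 0 := congrArg (fun z => Multiplicative.toAdd z.2) h
    omega
  obtain ⟨n, hn⟩ := exists_inEG_range ((Group.fg_iff_subgroup_fg _).2 shiftGroup_succIso_fg)
    (p.comp (MonoidHom.inl _ _)) fun x =>
      mem_levelGroup_of_commute hθ (hpm _) hpc hpc1 (by
        rw [MonoidHom.comp_apply, MonoidHom.inl_apply, ← map_mul, ← map_mul, hc])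
  refine not_inEG_shiftGroup_succIso n (hn.of_injective (MonoidHom.rangeRestrict _) ?_)
  rw [MonoidHom.rangeRestrict_injective_iff]
  exact hp.comp fun _ _ h => (Prod.ext_iff.1 h).1

/-- Conjugation by an element with a nontrivial shift part, or by its inverse, lowers levels. -/
theorem conj_mem_fixingGroup_of_notMem {x : Equiv.Perm (ℤ →₀ ℤ)} (hx : x ∈ shiftGroup succIso)
    (hx' : x ∉ levelGroup Set.univ) :
    (∀ (ℓ : ℤ), ∀ y ∈ fixingGroup (Set.Ioi ℓ), x * y * x⁻¹ ∈ fixingGroup (Set.Ioi (ℓ - 1))) ∨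
    ∀ (ℓ : ℤ), ∀ y ∈ fixingGroup (Set.Ioi ℓ), x⁻¹ * y * x ∈ fixingGroup (Set.Ioi (ℓ - 1)) := by
  obtain ⟨w, hw, m, rfl⟩ := exists_eq_mul_shiftHom_zpow hx
  have hwT := levelGroup_le_triangularGroup _ hw
  have hs : ∀ k : ℤ, (succIso ^ k).symm = succIso ^ (-k) := fun k => (zpow_neg _ _).symm
  rcases lt_trichotomy m 0 with hm | rfl | hm
  · left
    intro ℓ y hy
    have h1 : shiftHom (succIso ^ m) * y * (shiftHom (succIso ^ m))⁻¹ ∈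
        fixingGroup (Set.Ioi (ℓ - 1)) := by
      refine shiftHom_conj_mem_fixingGroup _ (fun j hj => ?_) hy
      rw [hs, succIso_zpow_apply]
      simp only [Set.mem_Ioi] at hj ⊢
      omega
    have h2 := conj_mem_fixingGroup (isUpperSet_Ioi _) hwT h1
    simpa only [mul_inv_rev, mul_assoc] using h2
  · exact absurd (by simpa using hw) hx'
  · right
    intro ℓ y hy
    have h2 := conj_mem_fixingGroup (isUpperSet_Ioi _) (inv_mem hwT) hy
    have h1 := shiftHom_conj_mem_fixingGroup (succIso ^ (-m)) (V := Set.Ioi (ℓ - 1))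
      (fun j hj => ?_) h2
    · rw [zpow_neg, map_inv, inv_inv, inv_inv] at h1
      simpa only [mul_inv_rev, mul_assoc] using h1
    · rw [hs, succIso_zpow_apply]
      simp only [Set.mem_Ioi] at hj ⊢
      omega

/-- Modulo the permutations fixing the coordinates in `U`, conjugation by `v` is trivial, so if `a`
commutes with the conjugate of `b` by `v`, then it commutes with `b`. -/
theorem commutator_mem_fixingGroup {L : Type*} [LinearOrder L] {U : Set L} (hU : IsUpperSet U)
    {a b v : Equiv.Perm (L →₀ ℤ)} (ha : a ∈ triangularGroup L) (hb : b ∈ triangularGroup L)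
    (hv : v ∈ fixingGroup U) (h : a * (v * b * v⁻¹) = v * b * v⁻¹ * a) :
    a * b * a⁻¹ * b⁻¹ ∈ fixingGroup U := by
  have hd : v * b * v⁻¹ * b⁻¹ ∈ fixingGroup U := by
    have := mul_mem hv (conj_mem_fixingGroup hU hb (inv_mem hv))
    simpa only [mul_assoc] using this
  have := mul_mem (conj_mem_fixingGroup hU ha (inv_mem hd)) hd
  convert! this using 1
  calc a * b * a⁻¹ * b⁻¹
      = a * (v * b * v⁻¹ * b⁻¹)⁻¹ * a⁻¹ * (a * (v * b * v⁻¹)) * a⁻¹ * b⁻¹ := by group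
    _ = _ := by rw [h]; group

/-- Under an embedding the translations of both kinds would be mapped, up to central elements, to
elements of levels in `ℤ`. Conjugating by the image of the shift, the levels of the images of the
upper translations become arbitrarily low. As these conjugates separate the supports of the lower
translations, the commutators of the images of the latter would have arbitrarily low levels. -/
theorem not_embeds_shiftGroup_succIsoTwo :
    ¬ Embeds (shiftGroup succIsoTwo) (shiftGroup succIso × Multiplicative ℤ) := by
  rintro ⟨ψ, hψ⟩
  let p : shiftGroup succIsoTwo →* Equiv.Perm (ℤ →₀ ℤ) :=
    (shiftGroup succIso).subtype.comp ((MonoidHom.fst _ _).comp ψ)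
  have hpm : ∀ x, p x ∈ shiftGroup succIso := fun x => (ψ x).1.2
  have hp : ∀ x y, x * y ≠ y * x → p (x * y * x⁻¹ * y⁻¹) ≠ 1 := by
    intro x y hxy h
    refine mul_conj_commutator_ne_one hxy (hψ ?_)
    rw [map_one]
    refine Prod.ext (Subtype.ext h) ?_
    simp
  -- An element which commutes with some nontrivial commutator has no shift part.
  have hmem : ∀ x y, x * y ≠ y * x → x * (y * x * y⁻¹) = y * x * y⁻¹ * x →
      p x ∈ levelGroup Set.univ := by
    intro x y hxy hc
    refine mem_levelGroup_of_commute (y := p (y * x * y⁻¹ * x⁻¹)) lt_succIso (hpm x) ?_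
      (hp y x hxy.symm) ?_
    · rw [map_mul, map_mul, map_mul, map_inv, map_inv]
      exact commutator_mem_levelGroup (hpm _) (hpm _)
    · rw [← map_mul, ← map_mul, ← mul_assoc, hc, mul_inv_cancel_right, inv_mul_cancel_right]
  let b (ℓ : TwoInt) : shiftGroup succIsoTwo := ⟨levelPerm ℓ, levelPerm_mem_shiftGroup _ ℓ⟩
  let f : shiftGroup succIsoTwo := ⟨shiftHom succIsoTwo, shiftHom_mem_shiftGroup _⟩
  have hne : ∀ i j, i < j → b i * b j ≠ b j * b i := fun i j hij h =>
    levelPerm_mul_ne hij (congrArg Subtype.val h)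
  have hcomm : ∀ i j ℓ, i < ℓ → j < ℓ →
      b i * (b ℓ * b j * (b ℓ)⁻¹) = b ℓ * b j * (b ℓ)⁻¹ * b i :=
    fun i j ℓ hi hj => Subtype.ext (levelPerm_mul_conj hi hj)
  have hf : ∀ ℓ, f * b ℓ * f⁻¹ = b (succIsoTwo ℓ) :=
    fun ℓ => Subtype.ext (shiftHom_conj_levelPerm _ ℓ)
  have hbW : ∀ ℓ, p (b ℓ) ∈ levelGroup Set.univ := fun ℓ =>
    hmem _ (b (succIsoTwo ℓ)) (hne _ _ (lt_succIsoTwo ℓ))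
      (hcomm _ _ _ (lt_succIsoTwo ℓ) (lt_succIsoTwo ℓ))
  -- Otherwise the image of `p` would be in some `EG_n`, and the group itself, as an extension of a
  -- subgroup of this image by an abelian group, in `EG_{n+1}`.
  have hfW : p f ∉ levelGroup Set.univ := by
    intro hfW
    have hall : ∀ x, p x ∈ levelGroup Set.univ := by
      rintro ⟨x, hx⟩
      induction hx using Subgroup.closure_induction with
      | mem x hx =>
        rcases hx with rfl | ⟨ℓ, rfl⟩
        · exact hfW
        · exact hbW ℓ
      | one => exact (map_one p).symm ▸ one_mem _
      | mul x y hx hy h1 h2 => exact (map_mul p ⟨x, hx⟩ ⟨y, hy⟩) ▸ mul_mem h1 h2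
      | inv x hx h1 => exact (map_inv p ⟨x, hx⟩) ▸ inv_mem h1
    obtain ⟨n, hn⟩ := exists_inEG_range
      ((Group.fg_iff_subgroup_fg _).2 shiftGroup_succIsoTwo_fg) p hall
    refine not_inEG_shiftGroup_succIsoTwo (n + 1) ?_
    rw [Nat.cast_add_one]
    refine inEG_succ_of_hom ((MonoidHom.snd _ _).comp ψ)
      (hn.of_injective (p.rangeRestrict.comp (Subgroup.subtype _)) ?_)
    rw [injective_iff_map_eq_one]
    rintro ⟨x, hx⟩ h
    refine Subtype.ext (hψ (Eq.trans ?_ (map_one ψ).symm))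
    have h' := congrArg Subtype.val h
    exact Prod.ext (Subtype.ext h') hx
  -- Conjugation by powers of `p f` lowers the level of the image of an upper translation.
  have hlow : ∃ ℓ₀ : ℤ, ∀ k : ℕ, ∃ n : ℤ, p (b (Sum.inrₗ n)) ∈ fixingGroup (Set.Ioi (ℓ₀ - k)) := by
    obtain ⟨ℓ₀, h0⟩ : ∃ ℓ₀ : ℤ, p (b (Sum.inrₗ 0)) ∈ fixingGroup (Set.Ioi ℓ₀) := by
      have h1 : p (b (Sum.inrₗ 0)) ≠ 1 := by
        intro h
        refine hp (b (Sum.inrₗ 0)) (b (Sum.inrₗ 1)) (hne _ _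
          (Sum.Lex.inr_lt_inr_iff.2 zero_lt_one)) ?_
        rw [map_mul, map_mul, map_mul, map_inv, map_inv, h]
        group
      obtain ⟨ℓ₀, h0, -⟩ := exists_level (hbW (Sum.inrₗ 0)) h1
      exact ⟨ℓ₀, h0⟩
    refine ⟨ℓ₀, fun k => ?_⟩
    induction k with
    | zero => exact ⟨0, by simpa using h0⟩
    | succ k ih =>
      obtain ⟨n, hn⟩ := ih
      have e : ℓ₀ - ((k + 1 : ℕ) : ℤ) = ℓ₀ - k - 1 := by push_cast; ring
      rw [e]
      rcases conj_mem_fixingGroup_of_notMem (hpm f) hfW with h | h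
      · refine ⟨n + 1, ?_⟩
        have := h _ _ hn
        rwa [← map_inv, ← map_mul, ← map_mul, hf, succIsoTwo_inr] at this
      · refine ⟨n - 1, ?_⟩
        have := h _ _ hn
        have e' : f⁻¹ * b (Sum.inrₗ n) * f = b (Sum.inrₗ (n - 1)) := by
          have := hf (Sum.inrₗ (n - 1))
          rw [succIsoTwo_inr, sub_add_cancel] at this
          rw [← this]
          group
        rwa [← map_inv, ← map_mul, ← map_mul, e'] at this
  obtain ⟨ℓ₀, hlow⟩ := hlow
  refine hp (b (Sum.inlₗ 0)) (b (Sum.inlₗ 1))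
    (hne _ _ (Sum.Lex.inl_lt_inl_iff.2 zero_lt_one)) (eq_one_of_mem_fixingGroup_univ ?_)
  intro x j _
  obtain ⟨n, hn⟩ := hlow (ℓ₀ - j + 1).toNat
  have hj : j ∈ Set.Ioi (ℓ₀ - ((ℓ₀ - j + 1).toNat : ℤ)) := by
    have := Int.self_le_toNat (ℓ₀ - j + 1)
    simp only [Set.mem_Ioi]
    omega
  have := commutator_mem_fixingGroup (isUpperSet_Ioi _)
    (levelGroup_le_triangularGroup _ (hbW (Sum.inlₗ 0)))
    (levelGroup_le_triangularGroup _ (hbW (Sum.inlₗ 1))) hn (by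
      rw [← map_inv, ← map_mul, ← map_mul, ← map_mul, ← map_mul,
        hcomm _ _ _ (Sum.Lex.inl_lt_inr _ _) (Sum.Lex.inl_lt_inr _ _)])
  rw [← map_inv, ← map_inv, ← map_mul, ← map_mul, ← map_mul] at this
  exact this x j hj

/-! ### Towers of group elements acting on a set -/

section Towers

variable {L Γ Y : Type*} [LinearOrder L] [Group Γ]

/-- The product of the powers `b ℓ ^ x ℓ`, with `ℓ` decreasing from left to right. -/
noncomputable def descProd (b : L → Γ) (x : L →₀ ℤ) : Γ :=
  ((x.support.sort (· ≥ ·)).map fun ℓ => b ℓ ^ x ℓ).prod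

theorem descProd_zero (b : L → Γ) : descProd b 0 = 1 := by
  simp [descProd]

theorem descProd_single_add (b : L → Γ) {a : L} {f : L →₀ ℤ} (hf : ∀ c, f c ≠ 0 → c < a) (k : ℤ) :
    descProd b (Finsupp.single a k + f) = b a ^ k * descProd b f := by
  have hfa : f a = 0 := by
    by_contra h
    exact (hf a h).false
  rcases eq_or_ne k 0 with rfl | hk
  · simp
  have hs : (Finsupp.single a k + f).support = insert a f.support := by
    ext j
    rcases eq_or_ne j a with rfl | hj
    · simp [hfa, hk]
    · simp [hj]
  have ha : a ∉ f.support := by simpa using hfa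
  rw [descProd, hs,
    Finset.sort_insert (h₁ := fun c hc => (hf c (Finsupp.mem_support_iff.1 hc)).le) (h₂ := ha),
    List.map_cons, List.prod_cons]
  congr 1
  · simp [hfa]
  · rw [descProd]
    congr 1
    refine List.map_congr_left fun c hc => ?_
    have : c ≠ a := by
      rintro rfl
      exact ha ((Finset.mem_sort _).1 hc)
    simp [this]

theorem descProd_eq_mul_erase (b : L → Γ) {ℓ : L} {x : L →₀ ℤ} (hx : ∀ j, ℓ < j → x j = 0) :
    descProd b x = b ℓ ^ x ℓ * descProd b (x.erase ℓ) := by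
  conv_lhs => rw [← Finsupp.single_add_erase ℓ x]
  refine descProd_single_add b (fun c hc => ?_) _
  rcases lt_trichotomy c ℓ with h | rfl | h
  · exact h
  · simp at hc
  · rw [Finsupp.erase_ne h.ne', hx c h] at hc
    exact absurd rfl hc

theorem conj_descProd {θ : L ≃o L} {a : Γ} {b : L → Γ} (hab : ∀ ℓ, a * b ℓ * a⁻¹ = b (θ ℓ))
    (x : L →₀ ℤ) : a * descProd b x * a⁻¹ = descProd b (shiftHom θ x) := by
  induction x using Finsupp.induction_on_max with
  | zero =>
    have : shiftHom θ (0 : L →₀ ℤ) = 0 := rfl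
    rw [this, descProd_zero]
    simp
  | single_add ℓ k f hf _ ih =>
    rw [shiftHom_add, shiftHom_single,
      descProd_single_add b fun c hc => hf c (Finsupp.mem_support_iff.2 hc),
      descProd_single_add b, ← ih, ← hab, conj_zpow]
    · group
    · intro c hc
      exact θ.symm_apply_lt.1 (hf _ (Finsupp.mem_support_iff.2 hc))

variable [MulAction Γ Y]

/-- The element `b` moves only points of `J`, and `D` is a fundamental domain for the action of the
powers of `b` on `J`, on which these powers act freely. -/
structure HasFundamentalDomain (b : Γ) (J D : Set Y) : Prop where
  smul_eq_self : ∀ {y}, y ∉ J → b • y = y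
  subset : D ⊆ J
  eq_zero : ∀ {y} {k : ℤ}, y ∈ D → b ^ k • y ∈ D → k = 0
  exists_zpow : ∀ {y}, y ∈ J → ∃ k : ℤ, b ^ k • y ∈ D

theorem HasFundamentalDomain.conj {b : Γ} {J D : Set Y} (h : HasFundamentalDomain b J D) (c : Γ) :
    HasFundamentalDomain (c * b * c⁻¹) {y | c⁻¹ • y ∈ J} {y | c⁻¹ • y ∈ D} where
  smul_eq_self {y} hy := by
    rw [mul_smul, mul_smul, h.smul_eq_self hy, smul_inv_smul]
  subset _ hy := h.subset hy
  eq_zero {y k} hy hk := by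
    rw [conj_zpow, Set.mem_ofPred_eq, smul_smul, ← mul_assoc, ← mul_assoc, inv_mul_cancel, one_mul,
      mul_smul] at hk
    exact h.eq_zero hy hk
  exists_zpow {y} hy := by
    obtain ⟨k, hk⟩ := h.exists_zpow hy
    refine ⟨k, ?_⟩
    rwa [conj_zpow, Set.mem_ofPred_eq, smul_smul, ← mul_assoc, ← mul_assoc, inv_mul_cancel, one_mul,
      mul_smul]

/-- A family of elements of a group acting on a set is a tower if each `b ℓ` has a fundamental
domain `D ℓ` in `J ℓ`, and if `D ℓ` contains all the sets `J m` of lower index. -/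
structure IsTower (b : L → Γ) (J D : L → Set Y) : Prop where
  domain : ∀ ℓ, HasFundamentalDomain (b ℓ) (J ℓ) (D ℓ)
  nested : ∀ {m ℓ}, m < ℓ → J m ⊆ D ℓ

variable {b : L → Γ} {J D : L → Set Y}

theorem IsTower.zpow_smul_mem (h : IsTower b J D) {ℓ : L} {y : Y} (hy : y ∈ J ℓ) (k : ℤ) :
    b ℓ ^ k • y ∈ J ℓ := by
  by_contra hk
  have h1 : b ℓ ∈ MulAction.stabilizer Γ (b ℓ ^ k • y) := (h.domain _).smul_eq_self hk
  have h2 : b ℓ ^ (-k) • b ℓ ^ k • y = b ℓ ^ k • y := zpow_mem h1 (-k)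
  rw [smul_smul, ← zpow_add, neg_add_cancel, zpow_zero, one_smul] at h2
  exact hk (h2 ▸ hy)

theorem IsTower.descProd_smul_mem (h : IsTower b J D) {T : Set L} {q : Y}
    (hq : ∀ ℓ ∈ T, q ∈ D ℓ) {x : L →₀ ℤ} (hx : ∀ j, x j ≠ 0 → j ∈ T) {N : L} (hN : N ∈ T)
    (hxN : ∀ j, x j ≠ 0 → j < N) : descProd b x • q ∈ D N := by
  induction x using Finsupp.induction_on_max generalizing N with
  | zero =>
    rw [descProd_zero, one_smul]
    exact hq N hN
  | single_add a k f hf hk ih =>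
    have hf' : ∀ c, f c ≠ 0 → c < a := fun c hc => hf c (Finsupp.mem_support_iff.2 hc)
    have hfa : f a = 0 := by
      by_contra h'
      exact (hf' a h').false
    have ha : (Finsupp.single a k + f) a ≠ 0 := by simpa [hfa] using hk
    rw [descProd_single_add b hf', mul_smul]
    refine h.nested (hxN a ha)
      (h.zpow_smul_mem ((h.domain a).subset (ih (fun j hj => ?_) (hx a ha) hf')) k)
    refine hx j ?_
    rw [Finsupp.add_apply, Finsupp.single_eq_of_ne (hf' j hj).ne, zero_add]
    exact hj

theorem exists_top {x : L →₀ ℤ} {N : L} (hN : x N ≠ 0) :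
    ∃ M, N ≤ M ∧ x M ≠ 0 ∧ ∀ j, M < j → x j = 0 := by
  obtain ⟨M, hM, hmax⟩ := Finset.exists_max_image x.support id ⟨N, Finsupp.mem_support_iff.2 hN⟩
  refine ⟨M, hmax N (Finsupp.mem_support_iff.2 hN), Finsupp.mem_support_iff.1 hM, fun j hj => ?_⟩
  by_contra h
  exact (hmax j (Finsupp.mem_support_iff.2 h)).not_gt hj

/-- The point `descProd b x • q` is moved out of the fundamental domain of the highest level of
`x`. -/
theorem IsTower.descProd_smul_notMem (h : IsTower b J D) {T : Set L} {q : Y}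
    (hq : ∀ ℓ ∈ T, q ∈ D ℓ) {x : L →₀ ℤ} (hx : ∀ j, x j ≠ 0 → j ∈ T) {N ℓ : L} (hN : x N ≠ 0)
    (hℓ : ∀ M, N ≤ M → J ℓ ⊆ D M) : descProd b x • q ∉ J ℓ := by
  obtain ⟨M, hNM, hM, hmax⟩ := exists_top hN
  intro hmem
  have hlt : ∀ j, x.erase M j ≠ 0 → j < M := by
    intro j hj
    rcases lt_trichotomy j M with h' | rfl | h'
    · exact h'
    · simp at hj
    · rw [Finsupp.erase_ne h'.ne', hmax j h'] at hj
      exact absurd rfl hj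
  have hr : descProd b (x.erase M) • q ∈ D M := by
    refine h.descProd_smul_mem hq (fun j hj => hx j ?_) (hx M hM) hlt
    rwa [Finsupp.erase_ne (hlt j hj).ne] at hj
  rw [descProd_eq_mul_erase b hmax, mul_smul] at hmem
  exact hM ((h.domain _).eq_zero hr (hℓ M hNM hmem))

/-- The points `descProd b x • q` are permuted by the tower in the same way as the sequences `x` are
permuted by the model. If `q` lies in `D ℓ` only for `ℓ` in an upper part `T` of the set `S` of
indices under consideration, then only the coordinates in `T` are used. -/
theorem IsTower.smul_descProd_smul (h : IsTower b J D) {S T : Set L} {q : Y} [DecidablePred (· ∈ T)]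
    (hTS : ∀ t ∈ T, ∀ s ∈ S, t < s → s ∈ T)
    (hq : ∀ ℓ ∈ T, q ∈ D ℓ) (hq' : ∀ ℓ ∈ S, ℓ ∉ T → q ∉ J ℓ) {x : L →₀ ℤ}
    (hx : ∀ j, x j ≠ 0 → j ∈ S) {ℓ : L} (hℓ : ℓ ∈ S) :
    b ℓ • descProd b (x.filter (· ∈ T)) • q =
      descProd b ((levelPerm ℓ x).filter (· ∈ T)) • q := by
  have hxT : ∀ j, x.filter (· ∈ T) j ≠ 0 → j ∈ T := by
    intro j hj
    by_contra hjT
    exact hj (Finsupp.filter_apply_neg _ _ hjT)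
  by_cases hℓT : ℓ ∈ T
  · by_cases h0 : ∀ j, ℓ < j → x j = 0
    · have h0' : ∀ j, ℓ < j → x.filter (· ∈ T) j = 0 := by
        intro j hj
        by_contra hj'
        exact hj' (by rw [Finsupp.filter_apply_pos _ _ (hxT j hj'), h0 j hj])
      rw [levelPerm_apply, levelMap_of_zero 1 h0, Finsupp.filter_add,
        Finsupp.filter_single_of_pos _ hℓT, descProd_eq_mul_erase b h0',
        descProd_eq_mul_erase b (ℓ := ℓ) (x := x.filter (· ∈ T) + Finsupp.single ℓ 1)]
      · rw [smul_smul, ← mul_assoc, ← zpow_one_add, Finsupp.erase_add, Finsupp.erase_single,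
          add_zero, Finsupp.add_apply, Finsupp.single_eq_same, add_comm 1]
      · intro j hj
        rw [Finsupp.add_apply, h0' j hj, Finsupp.single_eq_of_ne hj.ne', add_zero]
    · push Not at h0
      obtain ⟨j, hj, hxj⟩ := h0
      have hjT : j ∈ T := hTS ℓ hℓT j (hx j hxj) hj
      rw [levelPerm_apply_of_ne hj hxj]
      refine (h.domain _).smul_eq_self (h.descProd_smul_notMem hq hxT (N := j) ?_ fun M hM =>
        h.nested (hj.trans_le hM))
      rwa [Finsupp.filter_apply_pos _ _ hjT]
  · have e : (levelPerm ℓ x).filter (· ∈ T) = x.filter (· ∈ T) := by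
      ext j
      by_cases hj : j ∈ T
      · rw [Finsupp.filter_apply_pos _ _ hj, Finsupp.filter_apply_pos _ _ hj]
        exact levelMap_apply_of_ne 1 x fun e => hℓT (e ▸ hj)
      · rw [Finsupp.filter_apply_neg _ _ hj, Finsupp.filter_apply_neg _ _ hj]
    rw [e]
    refine (h.domain _).smul_eq_self ?_
    by_cases h0 : x.filter (· ∈ T) = 0
    · rw [h0, descProd_zero, one_smul]
      exact hq' ℓ hℓ hℓT
    · obtain ⟨j, hj⟩ := Finsupp.ne_iff.1 h0
      refine h.descProd_smul_notMem hq hxT hj fun M hM => h.nested ?_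
      by_contra hlt
      rcases (not_lt.1 hlt).eq_or_lt with rfl | hlt
      · exact hℓT (hTS j (hxT j hj) _ hℓ (lt_of_le_of_ne hM (by rintro rfl; exact hℓT (hxT _ hj))))
      · exact hℓT (hTS j (hxT j hj) ℓ hℓ (hM.trans_lt hlt))

/-- Every point is of the form `descProd b x • q`, relative to a finite set of indices. -/
theorem IsTower.exists_descProd_smul (h : IsTower b J D) (S : Finset L) : ∀ q₀ : Y,
    ∃ (T : Finset L) (x : L →₀ ℤ) (q : Y), T ⊆ S ∧ (∀ t ∈ T, ∀ s ∈ S, t < s → s ∈ T) ∧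
      (∀ ℓ ∈ T, q ∈ D ℓ) ∧ (∀ ℓ ∈ S, ℓ ∉ T → q ∉ J ℓ) ∧ (∀ j, x j ≠ 0 → j ∈ T) ∧
      q₀ = descProd b x • q := by
  induction S using Finset.induction_on_max with
  | empty => exact fun q₀ => ⟨∅, 0, q₀, by simp [descProd_zero]⟩
  | insert N s hN ih =>
    intro q₀
    by_cases hq₀ : q₀ ∈ J N
    · obtain ⟨k, hk⟩ := (h.domain _).exists_zpow hq₀
      obtain ⟨T, x, q, h1, h2, h3, h4, h5, h6⟩ := ih (b N ^ k • q₀)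
      refine ⟨insert N T, Finsupp.single N (-k) + x, q, Finset.insert_subset_insert _ h1, ?_, ?_,
        ?_, ?_, ?_⟩
      · intro t ht s' hs' hlt
        rcases Finset.mem_insert.1 hs' with rfl | hs₂
        · exact Finset.mem_insert_self _ _
        · rcases Finset.mem_insert.1 ht with rfl | ht
          · exact absurd (hN s' hs₂) hlt.not_gt
          · exact Finset.mem_insert_of_mem (h2 t ht s' hs₂ hlt)
      · intro ℓ hℓ
        rcases Finset.mem_insert.1 hℓ with rfl | hℓ
        · rcases T.eq_empty_or_nonempty with rfl | ⟨t, ht⟩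
          · have : x = 0 := Finsupp.ext fun j => by
              by_contra hj
              simpa using h5 j hj
            rw [this, descProd_zero, one_smul] at h6
            rwa [← h6]
          · exact h.nested (hN t (h1 ht)) ((h.domain t).subset (h3 t ht))
        · exact h3 ℓ hℓ
      · intro ℓ hℓ hℓ'
        rw [Finset.mem_insert, not_or] at hℓ'
        exact h4 ℓ ((Finset.mem_insert.1 hℓ).resolve_left hℓ'.1) hℓ'.2
      · intro j hj
        rcases eq_or_ne j N with rfl | hjN
        · exact Finset.mem_insert_self _ _
        · rw [Finsupp.add_apply, Finsupp.single_eq_of_ne hjN, zero_add] at hj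
          exact Finset.mem_insert_of_mem (h5 j hj)
      · rw [descProd_single_add b (fun c hc => hN c (h1 (h5 c hc))), mul_smul, ← h6, smul_smul,
          ← zpow_add, neg_add_cancel, zpow_zero, one_smul]
    · refine ⟨∅, 0, q₀, by simp, by simp, by simp, fun ℓ hℓ _ hmem => ?_, by simp,
        by simp [descProd_zero]⟩
      rcases Finset.mem_insert.1 hℓ with rfl | hℓ
      · exact hq₀ hmem
      · exact hq₀ ((h.domain N).subset (h.nested (hN ℓ hℓ) hmem))

/-- The subgroup of `Γ × Perm (L →₀ ℤ)` generated by the pairs of corresponding elements of a family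
in `Γ` and of the model. -/
noncomputable def levelCorrespondence (b : L → Γ) (S : Set L) :
    Subgroup (Γ × Equiv.Perm (L →₀ ℤ)) :=
  Subgroup.closure ((fun ℓ => (b ℓ, levelPerm ℓ)) '' S)

theorem snd_mem_of_mem_levelCorrespondence {S : Set L} {p : Γ × Equiv.Perm (L →₀ ℤ)}
    (hp : p ∈ levelCorrespondence b S) : p.2 ∈ levelGroup S := by
  have : levelCorrespondence b S ≤ (levelGroup S).comap (MonoidHom.snd _ _) := by
    refine (Subgroup.closure_le _).2 ?_
    rintro _ ⟨ℓ, hℓ, rfl⟩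
    exact levelPerm_mem_levelGroup hℓ
  exact this hp

theorem exists_finset_mem_levelCorrespondence {p : Γ × Equiv.Perm (L →₀ ℤ)}
    (hp : p ∈ levelCorrespondence b Set.univ) :
    ∃ S : Finset L, p ∈ levelCorrespondence b (S : Set L) := by
  classical
  have hmono : ∀ {S T : Set L}, S ⊆ T → levelCorrespondence b S ≤ levelCorrespondence b T :=
    fun h => Subgroup.closure_mono (Set.image_mono h)
  induction hp using Subgroup.closure_induction with
  | mem x hx =>
    obtain ⟨ℓ, -, rfl⟩ := hx
    exact ⟨{ℓ}, Subgroup.subset_closure ⟨ℓ, by simp, rfl⟩⟩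
  | one => exact ⟨∅, one_mem _⟩
  | mul x y _ _ hx hy =>
    obtain ⟨S, hS⟩ := hx
    obtain ⟨T, hT⟩ := hy
    exact ⟨S ∪ T, mul_mem (hmono (by simp) hS) (hmono (by simp) hT)⟩
  | inv x _ hx =>
    obtain ⟨S, hS⟩ := hx
    exact ⟨S, inv_mem hS⟩

theorem IsTower.levelCorrespondence_smul (h : IsTower b J D) {S T : Set L} {q : Y}
    [DecidablePred (· ∈ T)] (hTS : ∀ t ∈ T, ∀ s ∈ S, t < s → s ∈ T)
    (hq : ∀ ℓ ∈ T, q ∈ D ℓ) (hq' : ∀ ℓ ∈ S, ℓ ∉ T → q ∉ J ℓ) {p : Γ × Equiv.Perm (L →₀ ℤ)}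
    (hp : p ∈ levelCorrespondence b S) : ∀ x : L →₀ ℤ, (∀ j, x j ≠ 0 → j ∈ S) →
    p.1 • descProd b (x.filter (· ∈ T)) • q = descProd b ((p.2 x).filter (· ∈ T)) • q := by
  have hsupp : ∀ τ ∈ levelGroup S, ∀ x : L →₀ ℤ, (∀ j, x j ≠ 0 → j ∈ S) →
      ∀ j, τ x j ≠ 0 → j ∈ S := by
    intro τ hτ x hx j hj
    by_contra hjS
    rw [levelGroup_le_fixingGroup S hτ x j hjS] at hj
    exact hjS (hx j hj)
  induction hp using Subgroup.closure_induction with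
  | mem p hp =>
    obtain ⟨ℓ, hℓ, rfl⟩ := hp
    exact fun x hx => h.smul_descProd_smul hTS hq hq' hx hℓ
  | one =>
    intro x _
    rw [Prod.fst_one, Prod.snd_one, one_smul, Equiv.Perm.one_apply]
  | mul p p' hp hp' h1 h2 =>
    intro x hx
    rw [Prod.fst_mul, Prod.snd_mul, mul_smul, h2 x hx, Equiv.Perm.mul_apply]
    exact h1 _ (hsupp _ (snd_mem_of_mem_levelCorrespondence hp') x hx)
  | inv p hp h1 =>
    intro x hx
    rw [Prod.fst_inv, Prod.snd_inv, inv_smul_eq_iff,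
      h1 _ (hsupp _ (inv_mem (snd_mem_of_mem_levelCorrespondence hp)) x hx), perm_apply_inv_self]

/-- An element corresponding to the identity of the model fixes every point, as every point is
reached by `IsTower.exists_descProd_smul`. -/
theorem IsTower.eq_one_of_mem_levelCorrespondence [FaithfulSMul Γ Y] (h : IsTower b J D) {g : Γ}
    (hg : (g, 1) ∈ levelCorrespondence b Set.univ) : g = 1 := by
  classical
  obtain ⟨S, hS⟩ := exists_finset_mem_levelCorrespondence hg
  refine FaithfulSMul.eq_of_smul_eq_smul fun q₀ : Y => ?_
  obtain ⟨T, x, q, h1, h2, h3, h4, h5, rfl⟩ := h.exists_descProd_smul S q₀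
  have := h.levelCorrespondence_smul (T := (T : Set L)) h2 h3 h4 hS x fun j hj => h1 (h5 j hj)
  have e : x.filter (· ∈ (T : Set L)) = x := Finsupp.filter_eq_self_iff _ _ |>.2 h5
  rwa [Equiv.Perm.one_apply, e, ← one_smul Γ (descProd b x • q), smul_smul, mul_one] at this

/-- The correspondence between the group generated by a tower and an element `a` permuting it by
conjugation, and the model. -/
noncomputable def shiftCorrespondence (θ : L ≃o L) (a : Γ) (b : L → Γ) :
    Subgroup (Γ × Equiv.Perm (L →₀ ℤ)) :=
  Subgroup.closure (insert (a, shiftHom θ) (Set.range fun ℓ => (b ℓ, levelPerm ℓ)))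

theorem IsTower.shiftCorrespondence_smul (h : IsTower b J D) {θ : L ≃o L} {a : Γ}
    (hab : ∀ ℓ, a * b ℓ * a⁻¹ = b (θ ℓ)) {q : Y} (hq : ∀ ℓ, q ∈ D ℓ) (haq : a • q = q)
    {p : Γ × Equiv.Perm (L →₀ ℤ)} (hp : p ∈ shiftCorrespondence θ a b) :
    ∀ x : L →₀ ℤ, p.1 • descProd b x • q = descProd b (p.2 x) • q := by
  classical
  induction hp using Subgroup.closure_induction with
  | mem p hp =>
    intro x
    rcases hp with rfl | ⟨ℓ, rfl⟩
    · change a • descProd b x • q = descProd b (shiftHom θ x) • q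
      rw [← conj_descProd hab, mul_smul, mul_smul, inv_smul_eq_iff.2 haq.symm]
    · have e : ∀ x : L →₀ ℤ, x.filter (· ∈ (Set.univ : Set L)) = x :=
        fun x => (Finsupp.filter_eq_self_iff _ _).2 fun _ _ => trivial
      have := h.smul_descProd_smul (S := Set.univ) (T := Set.univ) (q := q) (x := x) (ℓ := ℓ)
        (fun _ _ _ _ _ => trivial) (fun ℓ _ => hq ℓ) (fun _ _ h => absurd trivial h)
        (fun _ _ => trivial) trivial
      rwa [e, e] at this
  | one =>
    intro x
    rw [Prod.fst_one, Prod.snd_one, one_smul, Equiv.Perm.one_apply]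
  | mul p p' hp hp' h1 h2 =>
    intro x
    rw [Prod.fst_mul, Prod.snd_mul, mul_smul, h2 x, Equiv.Perm.mul_apply]
    exact h1 _
  | inv p hp h1 =>
    intro x
    rw [Prod.fst_inv, Prod.snd_inv, inv_smul_eq_iff, h1, perm_apply_inv_self]

/-- By transitivity of the model on sequences, it is enough to consider the sequence zero. -/
theorem IsTower.eq_one_of_one_mem_shiftCorrespondence (h : IsTower b J D) {θ : L ≃o L} {a : Γ}
    (hab : ∀ ℓ, a * b ℓ * a⁻¹ = b (θ ℓ)) {q : Y} (hq : ∀ ℓ, q ∈ D ℓ) (haq : a • q = q)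
    {τ : Equiv.Perm (L →₀ ℤ)} (hτ : (1, τ) ∈ shiftCorrespondence θ a b) : τ = 1 := by
  refine Equiv.ext fun y => ?_
  obtain ⟨υ, hυ, rfl⟩ := exists_levelGroup_apply_zero (S := Set.univ) y fun _ _ => trivial
  obtain ⟨g, hg⟩ : ∃ g, (g, υ) ∈ shiftCorrespondence θ a b := by
    have : levelGroup Set.univ ≤ (shiftCorrespondence θ a b).map (MonoidHom.snd _ _) := by
      refine (Subgroup.closure_le _).2 ?_
      rintro _ ⟨ℓ, -, rfl⟩
      exact ⟨_, Subgroup.subset_closure (Set.mem_insert_of_mem _ ⟨ℓ, rfl⟩), rfl⟩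
    obtain ⟨⟨g, _⟩, hg, rfl⟩ := this hυ
    exact ⟨g, hg⟩
  have hmem : (1, υ⁻¹ * τ * υ) ∈ shiftCorrespondence θ a b := by
    have := mul_mem (mul_mem (inv_mem hg) hτ) hg
    simpa using this
  have h1 := h.shiftCorrespondence_smul hab hq haq hmem 0
  rw [one_smul, descProd_zero, one_smul] at h1
  have h0 : (υ⁻¹ * τ * υ) 0 = 0 := by
    by_contra h0
    obtain ⟨N, hN⟩ := Finsupp.ne_iff.1 h0
    obtain ⟨M, -, hM, hmax⟩ := exists_top hN
    have hlt : ∀ j, ((υ⁻¹ * τ * υ) 0).erase M j ≠ 0 → j < M := by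
      intro j hj
      rcases lt_trichotomy j M with h' | rfl | h'
      · exact h'
      · simp at hj
      · rw [Finsupp.erase_ne h'.ne', hmax j h'] at hj
        exact absurd rfl hj
    have hr := h.descProd_smul_mem (T := Set.univ) (q := q) (fun ℓ _ => hq ℓ)
      (x := ((υ⁻¹ * τ * υ) 0).erase M) (fun _ _ => trivial) (N := M) trivial hlt
    rw [descProd_eq_mul_erase b hmax, mul_smul] at h1
    exact hM ((h.domain _).eq_zero hr (h1 ▸ hq M))
  have h2 : υ⁻¹ (τ (υ 0)) = 0 := h0
  rw [Equiv.Perm.inv_eq_iff_eq] at h2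
  exact h2

theorem eq_zero_of_shiftHom_zpow_mem [Infinite L] {θ : L ≃o L} (hθ : ∀ ℓ, ℓ < θ ℓ) {m : ℤ}
    (hm : shiftHom (θ ^ m) ∈ levelGroup (Set.univ : Set L)) : m = 0 := by
  obtain ⟨S, hS⟩ := exists_finset_mem_levelGroup hm
  obtain ⟨ℓ, hℓ⟩ := Infinite.exists_notMem_finset S
  have h1 := levelGroup_le_fixingGroup _ hS (Finsupp.single ℓ 1) ℓ hℓ
  rw [shiftHom_single, Finsupp.single_eq_same] at h1
  have h2 : (θ ^ m) ℓ = ℓ := by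
    by_contra h
    rw [Finsupp.single_eq_of_ne (Ne.symm h)] at h1
    exact zero_ne_one h1
  rcases lt_trichotomy m 0 with h | h | h
  · have h3 := lt_zpow_apply hθ (neg_pos.2 h) ((θ ^ m) ℓ)
    rw [← RelIso.mul_apply, ← zpow_add, neg_add_cancel, h2] at h3
    exact absurd h3 (lt_irrefl _)
  · exact h
  · exact absurd (lt_zpow_apply hθ h ℓ) (by rw [h2]; exact lt_irrefl _)

/-- The shift part of the model determines the exponent of `a`, which reduces the assertion to the
correspondence without `a`. -/
theorem IsTower.eq_one_of_mem_one_shiftCorrespondence [Infinite L] [FaithfulSMul Γ Y]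
    (h : IsTower b J D) {θ : L ≃o L} (hθ : ∀ ℓ, ℓ < θ ℓ) {a : Γ}
    (hab : ∀ ℓ, a * b ℓ * a⁻¹ = b (θ ℓ)) {g : Γ}
    (hg : (g, 1) ∈ shiftCorrespondence θ a b) : g = 1 := by
  obtain ⟨⟨w, τ⟩, hw, m, e⟩ := exists_eq_mul_zpow_of_mem_closure θ (a, shiftHom θ)
    (fun ℓ => (b ℓ, levelPerm ℓ))
    (fun ℓ => Prod.ext (hab ℓ) (shiftHom_conj_levelPerm θ ℓ)) hg
  rw [← Set.image_univ] at hw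
  change (w, τ) ∈ levelCorrespondence b Set.univ at hw
  have e1 : g = w * a ^ m := congrArg Prod.fst e
  have e2 : 1 = τ * shiftHom θ ^ m := congrArg Prod.snd e
  have hm : m = 0 := by
    refine eq_zero_of_shiftHom_zpow_mem hθ ?_
    rw [map_zpow, ← inv_eq_of_mul_eq_one_right e2.symm]
    exact inv_mem (snd_mem_of_mem_levelCorrespondence hw)
  subst hm
  rw [zpow_zero, mul_one] at e1 e2
  rw [e1]
  rw [← e2] at hw
  exact h.eq_one_of_mem_levelCorrespondence hw

/-- A correspondence between two groups which is injective in both directions is an isomorphism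
between its projections. -/
theorem nonempty_mulEquiv_of_correspondence {G H : Type*} [Group G] [Group H]
    (R : Subgroup (G × H)) (h1 : ∀ g, (g, 1) ∈ R → g = 1) (h2 : ∀ h, (1, h) ∈ R → h = 1) :
    Nonempty (R.map (MonoidHom.fst G H) ≃* R.map (MonoidHom.snd G H)) := by
  have i1 : Function.Injective ((MonoidHom.fst G H).comp R.subtype) := by
    rw [injective_iff_map_eq_one]
    rintro ⟨⟨g, h⟩, hR⟩ (rfl : g = 1)
    obtain rfl := h2 h hR
    rfl
  have i2 : Function.Injective ((MonoidHom.snd G H).comp R.subtype) := by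
    rw [injective_iff_map_eq_one]
    rintro ⟨⟨g, h⟩, hR⟩ (rfl : h = 1)
    obtain rfl := h1 g hR
    rfl
  have e1 : ((MonoidHom.fst G H).comp R.subtype).range = R.map (MonoidHom.fst G H) := by
    rw [MonoidHom.range_comp, Subgroup.range_subtype]
  have e2 : ((MonoidHom.snd G H).comp R.subtype).range = R.map (MonoidHom.snd G H) := by
    rw [MonoidHom.range_comp, Subgroup.range_subtype]
  rw [← e1, ← e2]
  exact ⟨(MonoidHom.ofInjective i1).symm.trans (MonoidHom.ofInjective i2)⟩

/-- A tower together with an element permuting it by conjugation generates a group isomorphic to the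
model, provided that there is a common point of all the fundamental domains fixed by this
element. -/
theorem IsTower.nonempty_mulEquiv [Infinite L] [FaithfulSMul Γ Y] (h : IsTower b J D) {θ : L ≃o L}
    (hθ : ∀ ℓ, ℓ < θ ℓ) {a : Γ} (hab : ∀ ℓ, a * b ℓ * a⁻¹ = b (θ ℓ)) {q : Y} (hq : ∀ ℓ, q ∈ D ℓ)
    (haq : a • q = q) :
    Nonempty (Subgroup.closure (insert a (Set.range b)) ≃* shiftGroup θ) := by
  have e := nonempty_mulEquiv_of_correspondence (shiftCorrespondence θ a b)
    (fun g hg => h.eq_one_of_mem_one_shiftCorrespondence hθ hab hg)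
    fun τ hτ => h.eq_one_of_one_mem_shiftCorrespondence hab hq haq hτ
  rw [shiftCorrespondence, MonoidHom.map_closure, MonoidHom.map_closure, Set.image_insert_eq,
    Set.image_insert_eq, ← Set.range_comp, ← Set.range_comp] at e
  exact e

end Towers

/-! ### Bumps of homeomorphisms of the interval -/

section Bumps

/-- The homeomorphism `f` has a positive bump with support `(u, v)` and marker `s`. -/
structure IsPosBump (f : HomeoI) (u s v : I) : Prop where
  left_lt : u < s
  lt_right : s < v
  map_left : f u = u
  map_right : f v = v
  lt_map : ∀ x ∈ Set.Ioo u v, x < f x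

theorem homeo_apply_inv_self (f : HomeoI) (x : I) : f (f⁻¹ x) = x := RelIso.apply_inv_self f x

theorem homeo_inv_apply_self (f : HomeoI) (x : I) : f⁻¹ (f x) = x := RelIso.inv_apply_self f x

variable {f : HomeoI} {u s v : I}

theorem homeo_inv_apply_eq_self {x : I} (h : f x = x) : f⁻¹ x = x := by
  conv_lhs => rw [← h]
  exact homeo_inv_apply_self f x

theorem IsPosBump.mem (h : IsPosBump f u s v) : s ∈ Set.Ioo u v := ⟨h.left_lt, h.lt_right⟩

theorem IsPosBump.lt_map_marker (h : IsPosBump f u s v) : s < f s := h.lt_map s h.mem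

theorem IsPosBump.map_marker_lt (h : IsPosBump f u s v) : f s < v := by
  have := f.strictMono h.lt_right
  rwa [h.map_right] at this

theorem IsPosBump.map_mem (h : IsPosBump f u s v) {x : I} (hx : x ∈ Set.Ioo u v) :
    f x ∈ Set.Ioo u v :=
  ⟨hx.1.trans (h.lt_map x hx), h.map_right ▸ f.strictMono hx.2⟩

theorem IsPosBump.inv_map_mem (h : IsPosBump f u s v) {x : I} (hx : x ∈ Set.Ioo u v) :
    f⁻¹ x ∈ Set.Ioo u v := by
  have h1 := (f⁻¹ : HomeoI).strictMono hx.1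
  have h2 := (f⁻¹ : HomeoI).strictMono hx.2
  rw [homeo_inv_apply_eq_self h.map_left] at h1
  rw [homeo_inv_apply_eq_self h.map_right] at h2
  exact ⟨h1, h2⟩

theorem IsPosBump.zpow_mem (h : IsPosBump f u s v) {x : I} (hx : x ∈ Set.Ioo u v) (k : ℤ) :
    (f ^ k) x ∈ Set.Ioo u v := by
  induction k using Int.induction_on with
  | zero => simpa using hx
  | succ k ih =>
    rw [add_comm, zpow_one_add, RelIso.mul_apply]
    exact h.map_mem ih
  | pred k ih =>
    rw [sub_eq_add_neg, add_comm, zpow_add, zpow_neg_one, RelIso.mul_apply]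
    exact h.inv_map_mem ih

theorem IsPosBump.le_pow (h : IsPosBump f u s v) {x : I} (hx : x ∈ Set.Ioo u v) (n : ℕ) :
    x ≤ (f ^ n) x := by
  induction n with
  | zero => exact le_rfl
  | succ n ih =>
    rw [pow_succ', RelIso.mul_apply]
    have := h.zpow_mem hx n
    rw [zpow_natCast] at this
    exact ih.trans (h.lt_map _ this).le

theorem IsPosBump.exists_lt_pow (h : IsPosBump f u s v) {x y : I} (hx : x ∈ Set.Ioo u v)
    (hy : y < v) : ∃ n : ℕ, y < (f ^ n) x := by
  by_contra! hle
  have hmem : ∀ n : ℕ, (f ^ n) x ∈ Set.Ioo u v := fun n => by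
    have := h.zpow_mem hx n
    rwa [zpow_natCast] at this
  have hmono : Monotone fun n : ℕ => (f ^ n) x := by
    refine monotone_nat_of_le_succ fun n => ?_
    rw [pow_succ', RelIso.mul_apply]
    exact (h.lt_map _ (hmem n)).le
  have hlim := tendsto_atTop_ciSup hmono ⟨1, fun _ _ => unitInterval.le_one _⟩
  have hit : (fun n : ℕ => (f ^ n) x) = fun n => f^[n] x := by
    funext n
    induction n with
    | zero => rfl
    | succ n ih => rw [pow_succ', RelIso.mul_apply, ih, Function.iterate_succ_apply']
  have hfix : f (⨆ n : ℕ, (f ^ n) x) = ⨆ n : ℕ, (f ^ n) x :=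
    isFixedPt_of_tendsto_iterate (hlim.congr (congrFun hit)) f.continuous.continuousAt
  have h1 : x ≤ ⨆ n : ℕ, (f ^ n) x := le_iSup (fun n : ℕ => (f ^ n) x) 0
  have h2 : ⨆ n : ℕ, (f ^ n) x ≤ y := iSup_le hle
  exact (h.lt_map _ ⟨hx.1.trans_le h1, h2.trans_lt hy⟩).ne hfix.symm

theorem IsPosBump.pow (h : IsPosBump f u s v) {n : ℕ} (hn : n ≠ 0) : IsPosBump (f ^ n) u s v := by
  obtain ⟨n, rfl⟩ := Nat.exists_eq_succ_of_ne_zero hn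
  have key : ∀ n : ℕ, ∀ x, f x = x → (f ^ n) x = x := by
    intro n x hx
    induction n with
    | zero => rfl
    | succ n ih => rw [pow_succ', RelIso.mul_apply, ih, hx]
  refine ⟨h.left_lt, h.lt_right, key _ _ h.map_left, key _ _ h.map_right, fun x hx => ?_⟩
  rw [Nat.succ_eq_add_one, pow_succ, RelIso.mul_apply]
  exact (h.lt_map x hx).trans_le (h.le_pow (h.map_mem hx) n)

theorem IsPosBump.hasFundamentalDomain (h : IsPosBump f u s v)
    (hf : ∀ x, x ∉ Set.Ioo u v → f x = x) :
    HasFundamentalDomain f (Set.Ioo u v) (Set.Ico s (f s)) where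
  smul_eq_self hy := hf _ hy
  subset y hy := ⟨h.left_lt.trans_le hy.1, hy.2.trans h.map_marker_lt⟩
  eq_zero {y k} hy hk := by
    have key : ∀ z ∈ Set.Ico s (f s), ∀ n : ℕ, (f ^ (n + 1)) z ∉ Set.Ico s (f s) := by
      intro z hz n hn
      have h1 : f s ≤ f z := f.monotone hz.1
      have h2 := h.le_pow (h.map_mem ⟨h.left_lt.trans_le hz.1, hz.2.trans h.map_marker_lt⟩) n
      rw [← RelIso.mul_apply, ← pow_succ] at h2
      exact absurd hn.2 (not_lt.2 (h1.trans h2))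
    rw [RelIso.smul_def] at hk
    rcases lt_trichotomy k 0 with h0 | h0 | h0
    · obtain ⟨n, hn⟩ : ∃ n : ℕ, -k = (n + 1 : ℕ) := ⟨(-k - 1).toNat, by omega⟩
      refine absurd ?_ (key _ hk n)
      rwa [← zpow_natCast, ← hn, ← RelIso.mul_apply, ← zpow_add, neg_add_cancel]
    · exact h0
    · obtain ⟨n, rfl⟩ : ∃ n : ℕ, k = (n + 1 : ℕ) := ⟨(k - 1).toNat, by omega⟩
      rw [zpow_natCast] at hk
      exact absurd hk (key _ hy n)
  exists_zpow {y} hy := by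
    have hstep : ∀ m k : ℤ, m ≤ k → (f ^ m) y ≤ (f ^ k) y := by
      intro m k hmk
      obtain ⟨n, rfl⟩ := Int.le.dest hmk
      rw [add_comm m, zpow_add, RelIso.mul_apply, zpow_natCast]
      exact h.le_pow (h.zpow_mem hy m) n
    obtain ⟨k, hk, hmin⟩ := Int.exists_least_of_bdd (P := fun k : ℤ => s ≤ (f ^ k) y) (by
      obtain ⟨n, hn⟩ := h.exists_lt_pow h.mem hy.2
      refine ⟨-n, fun z hz => ?_⟩
      by_contra! hlt
      have h1 : s ≤ (f ^ (-n : ℤ)) y := hz.trans (hstep _ _ hlt.le)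
      have h2 := (f ^ n : HomeoI).monotone h1
      rw [← zpow_natCast, ← RelIso.mul_apply, ← zpow_add, add_neg_cancel, zpow_natCast] at h2
      exact absurd hn (not_lt.2 h2)) (by
      obtain ⟨n, hn⟩ := h.exists_lt_pow hy h.lt_right
      exact ⟨n, by rw [zpow_natCast]; exact hn.le⟩)
    refine ⟨k, hk, ?_⟩
    have h1 : (f ^ (k - 1)) y < s := by
      by_contra! hle
      have := hmin _ hle
      omega
    have h2 := f.strictMono h1
    rwa [← RelIso.mul_apply, ← zpow_one_add, add_sub_cancel] at h2

/-! ### The two groups as groups generated by towers -/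

variable {a b : HomeoI} {u₁ s₁ v₁ u₂ s₂ v₂ : I}

/-- If the left foot `(u, s)` of `b` lies between the feet of a negative bump of `a` with marker
`s₁`, and the right foot `[b s, v)` of `b` between the feet of a positive bump of `a` with marker
`s₂`, then `a⁻¹` moves the support of `b` into the fundamental domain `[s, b s)` of `b`. -/
theorem inv_apply_mem_Ico (o₁ : s₁ ≤ u) (o₂ : s ≤ a⁻¹ s₁) (o₃ : s₂ ≤ b s)
    (o₄ : v ≤ a s₂) {z : I} (hz : z ∈ Set.Ioo u v) : a⁻¹ z ∈ Set.Ico s (b s) := by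
  refine ⟨o₂.trans ((a⁻¹ : HomeoI).monotone (o₁.trans hz.1.le)), ?_⟩
  have := (a⁻¹ : HomeoI).strictMono (hz.2.trans_le o₄)
  rw [homeo_inv_apply_self] at this
  exact this.trans_le o₃

theorem IsPosBump.zpow_inv_apply_mem_Ico (hb : IsPosBump b u s v)
    (h : ∀ z ∈ Set.Ioo u v, a⁻¹ z ∈ Set.Ico s (b s)) {m ℓ : ℤ} (hlt : m < ℓ) {y : I}
    (hy : (a ^ m)⁻¹ y ∈ Set.Ioo u v) : (a ^ ℓ)⁻¹ y ∈ Set.Ico s (b s) := by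
  induction ℓ, Int.add_one_le_of_lt hlt using Int.leInduction with
  | base =>
    rw [zpow_add_one, mul_inv_rev, RelIso.mul_apply]
    exact h _ hy
  | succ ℓ _ ih =>
    rw [zpow_add_one, mul_inv_rev, RelIso.mul_apply]
    have := ih (by omega)
    exact h _ ⟨hb.left_lt.trans_le this.1, this.2.trans hb.map_marker_lt⟩

/-- The conjugates of `b` by the powers of `a` form a tower, and the right end of the negative bump
of `a` is a common point of the fundamental domains fixed by `a`. -/
theorem nonempty_mulEquiv_shiftGroup_succIso (hb : IsPosBump b u s v)
    (hfix : ∀ x, x ∉ Set.Ioo u v → b x = x) (h₁ : IsPosBump a⁻¹ u₁ s₁ v₁)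
    (h₂ : IsPosBump a u₂ s₂ v₂) (o₁ : s₁ ≤ u) (o₂ : s ≤ a⁻¹ s₁) (o₃ : s₂ ≤ b s)
    (o₄ : v ≤ a s₂) (o₅ : v₁ ≤ u₂) :
    Nonempty (Subgroup.closure {a, b} ≃* shiftGroup succIso) := by
  have hq : a v₁ = v₁ := homeo_inv_apply_eq_self (f := a⁻¹) h₁.map_right
  have hqm : ∀ n : ℤ, (a ^ n)⁻¹ v₁ = v₁ := fun n => by
    have h1 : a ∈ MulAction.stabilizer HomeoI v₁ := hq
    exact inv_mem (zpow_mem h1 n)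
  have htower : IsTower (fun n : ℤ => a ^ n * b * (a ^ n)⁻¹)
      (fun n => {y | (a ^ n)⁻¹ • y ∈ Set.Ioo u v})
      (fun n => {y | (a ^ n)⁻¹ • y ∈ Set.Ico s (b s)}) :=
    { domain := fun n => (hb.hasFundamentalDomain hfix).conj (a ^ n)
      nested := fun hlt y hy => hb.zpow_inv_apply_mem_Ico
        (fun z hz => inv_apply_mem_Ico o₁ o₂ o₃ o₄ hz) hlt hy }
  have hconj : ∀ n : ℤ, a * (a ^ n * b * (a ^ n)⁻¹) * a⁻¹ =
      a ^ (succIso n) * b * (a ^ (succIso n))⁻¹ := fun n => by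
    rw [succIso_apply, add_comm, zpow_one_add]
    group
  have e := htower.nonempty_mulEquiv lt_succIso hconj (q := v₁) (fun n => ?_) hq
  · rw [← closure_insert_image_eq succIso a _ hconj {0} exists_succIso_zpow,
      Set.image_singleton, zpow_zero, one_mul, inv_one, mul_one] at e
    exact e
  · change (a ^ n)⁻¹ v₁ ∈ Set.Ico s (b s)
    rw [hqm]
    exact ⟨o₂.trans h₁.map_marker_lt.le, (o₅.trans_lt h₂.left_lt).trans_le o₃⟩

/-- The conjugates of `h` by the powers of `f`, followed by the conjugates of `g`, form a tower: the
supports of all conjugates of `h` lie between the two outer bumps of `f`, hence in the fundamental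
domain of every conjugate of `g`. The bumps `1`, …, `4` are those of `f` from left to right. -/
theorem nonempty_mulEquiv_shiftGroup_succIsoTwo {f g h : HomeoI}
    {u₁ s₁ v₁ u₂ s₂ v₂ u₃ s₃ v₃ u₄ s₄ v₄ ug sg vg uh sh vh : I}
    (h₁ : IsPosBump f⁻¹ u₁ s₁ v₁) (h₂ : IsPosBump f⁻¹ u₂ s₂ v₂) (h₃ : IsPosBump f u₃ s₃ v₃)
    (h₄ : IsPosBump f u₄ s₄ v₄) (hg : IsPosBump g ug sg vg) (hh : IsPosBump h uh sh vh)
    (hgfix : ∀ x, x ∉ Set.Ioo ug vg → g x = x) (hhfix : ∀ x, x ∉ Set.Ioo uh vh → h x = x)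
    (o₁ : s₁ ≤ ug) (o₂ : sg ≤ f⁻¹ s₁) (o₃ : s₄ ≤ g sg) (o₄ : vg ≤ f s₄)
    (p₁ : s₂ ≤ uh) (p₂ : sh ≤ f⁻¹ s₂) (p₃ : s₃ ≤ h sh) (p₄ : vh ≤ f s₃)
    (q₁ : v₁ ≤ u₂) (q₂ : v₂ ≤ u₃) (q₃ : v₃ ≤ u₄) :
    Nonempty (Subgroup.closure {f, g, h} ≃* shiftGroup succIsoTwo) := by
  have hq : f v₂ = v₂ := homeo_inv_apply_eq_self (f := f⁻¹) h₂.map_right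
  have hfixz : ∀ (n : ℤ) (x : I), f x = x → (f ^ n)⁻¹ x = x := fun n x hx => by
    have h1 : f ∈ MulAction.stabilizer HomeoI x := hx
    exact inv_mem (zpow_mem h1 n)
  have hu₂ : f u₂ = u₂ := homeo_inv_apply_eq_self (f := f⁻¹) h₂.map_left
  -- The whole interval between the middle bumps of `f` lies in the fundamental domain of `g`.
  have hmid : ∀ z ∈ Set.Ioo u₂ v₃, z ∈ Set.Ico sg (g sg) := fun z hz =>
    ⟨(o₂.trans h₁.map_marker_lt.le).trans (q₁.trans hz.1.le),
      (hz.2.trans_le q₃).trans (h₄.left_lt.trans_le o₃)⟩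
  have hmidz : ∀ (n : ℤ) (z : I), z ∈ Set.Ioo u₂ v₃ → (f ^ n)⁻¹ z ∈ Set.Ioo u₂ v₃ := by
    intro n z hz
    have e1 := ((f ^ n)⁻¹ : HomeoI).strictMono hz.1
    have e2 := ((f ^ n)⁻¹ : HomeoI).strictMono hz.2
    rw [hfixz n u₂ hu₂] at e1
    rw [hfixz n v₃ h₃.map_right] at e2
    exact ⟨e1, e2⟩
  let c : TwoInt → HomeoI := fun ℓ => Sum.elim (fun n => f ^ n) (fun n => f ^ n) (ofLex ℓ)
  let b : TwoInt → HomeoI := fun ℓ => Sum.elim (fun _ => h) (fun _ => g) (ofLex ℓ)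
  let J : TwoInt → Set I :=
    fun ℓ => Sum.elim (fun _ => Set.Ioo uh vh) (fun _ => Set.Ioo ug vg) (ofLex ℓ)
  let D : TwoInt → Set I :=
    fun ℓ => Sum.elim (fun _ => Set.Ico sh (h sh)) (fun _ => Set.Ico sg (g sg)) (ofLex ℓ)
  have htower : IsTower (fun ℓ => c ℓ * b ℓ * (c ℓ)⁻¹) (fun ℓ => {y | (c ℓ)⁻¹ • y ∈ J ℓ})
      (fun ℓ => {y | (c ℓ)⁻¹ • y ∈ D ℓ}) :=
    { domain := fun ℓ => by
        rcases TwoInt.cases ℓ with ⟨n, rfl⟩ | ⟨n, rfl⟩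
        · exact (hh.hasFundamentalDomain hhfix).conj (f ^ n)
        · exact (hg.hasFundamentalDomain hgfix).conj (f ^ n)
      nested := fun {m ℓ} hlt y hy => by
        rcases TwoInt.cases ℓ with ⟨n, rfl⟩ | ⟨n, rfl⟩ <;>
          rcases TwoInt.cases m with ⟨m, rfl⟩ | ⟨m, rfl⟩
        · exact hh.zpow_inv_apply_mem_Ico
            (fun z hz => inv_apply_mem_Ico p₁ p₂ p₃ p₄ hz)
            (Sum.Lex.inl_lt_inl_iff.1 hlt) hy
        · exact absurd hlt Sum.Lex.not_inr_lt_inl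
        · change (f ^ m)⁻¹ y ∈ Set.Ioo uh vh at hy
          have h1 : (f ^ m)⁻¹ y ∈ Set.Ioo u₂ v₃ :=
            ⟨(h₂.left_lt.trans_le p₁).trans hy.1, (hy.2.trans_le p₄).trans h₃.map_marker_lt⟩
          have h2 := hmidz (n - m) _ h1
          rw [← RelIso.mul_apply, ← mul_inv_rev, ← zpow_add, add_sub_cancel] at h2
          exact hmid _ h2
        · exact hg.zpow_inv_apply_mem_Ico
            (fun z hz => inv_apply_mem_Ico o₁ o₂ o₃ o₄ hz)
            (Sum.Lex.inr_lt_inr_iff.1 hlt) hy }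
  have hconj : ∀ ℓ, f * (c ℓ * b ℓ * (c ℓ)⁻¹) * f⁻¹ =
      c (succIsoTwo ℓ) * b (succIsoTwo ℓ) * (c (succIsoTwo ℓ))⁻¹ := by
    have key : ∀ (n : ℤ) (x : HomeoI), f * (f ^ n * x * (f ^ n)⁻¹) * f⁻¹ =
        f ^ (n + 1) * x * (f ^ (n + 1))⁻¹ := fun n x => by
      rw [add_comm, zpow_one_add]
      group
    intro ℓ
    rcases TwoInt.cases ℓ with ⟨n, rfl⟩ | ⟨n, rfl⟩
    · exact key n h
    · exact key n g
  have : Infinite TwoInt := inferInstanceAs (Infinite (ℤ ⊕ ℤ))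
  have e := htower.nonempty_mulEquiv lt_succIsoTwo hconj (q := v₂) (fun ℓ => ?_) hq
  · rw [← closure_insert_image_eq succIsoTwo f _ hconj _ exists_succIsoTwo_zpow,
      Set.image_insert_eq, Set.image_singleton] at e
    have e1 : c (Sum.inrₗ 0) * b (Sum.inrₗ 0) * (c (Sum.inrₗ 0))⁻¹ = g := by
      change f ^ (0 : ℤ) * g * (f ^ (0 : ℤ))⁻¹ = g
      simp
    have e2 : c (Sum.inlₗ 0) * b (Sum.inlₗ 0) * (c (Sum.inlₗ 0))⁻¹ = h := by
      change f ^ (0 : ℤ) * h * (f ^ (0 : ℤ))⁻¹ = h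
      simp
    rwa [e1, e2] at e
  · rcases TwoInt.cases ℓ with ⟨n, rfl⟩ | ⟨n, rfl⟩
    · change (f ^ n)⁻¹ v₂ ∈ Set.Ico sh (h sh)
      rw [hfixz n v₂ hq]
      exact ⟨p₂.trans h₂.map_marker_lt.le, (q₂.trans_lt h₃.left_lt).trans_le p₃⟩
    · change (f ^ n)⁻¹ v₂ ∈ Set.Ico sg (g sg)
      rw [hfixz n v₂ hq]
      exact hmid _ ⟨h₂.left_lt.trans h₂.lt_right, q₂.trans_lt (h₃.left_lt.trans h₃.lt_right)⟩

end Bumps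

/-! ### Dynamical diagrams and the positions of bumps -/

section Diagrams

theorem Orbital.pos_or_neg {f : HomeoI} (o : Orbital f) :
    (∀ x ∈ Set.Ioo o.left o.right, x < f x) ∨ ∀ x ∈ Set.Ioo o.left o.right, f x < x := by
  by_contra! h
  obtain ⟨⟨x, hx, hfx⟩, ⟨y, hy, hfy⟩⟩ := h
  obtain ⟨z, hz, hfz⟩ := isPreconnected_Ioo.intermediate_value₂ hx hy
    f.continuous.continuousOn continuousOn_id hfx hfy
  exact o.map_ne z hz hfz

theorem Orbital.eq_of_mem {f : HomeoI} {o o' : Orbital f} {x : I}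
    (h : x ∈ Set.Ioo o.left o.right) (h' : x ∈ Set.Ioo o'.left o'.right) : o = o' := by
  have key : ∀ {o o' : Orbital f}, x ∈ Set.Ioo o.left o.right → x ∈ Set.Ioo o'.left o'.right →
      o'.left ≤ o.left ∧ o.right ≤ o'.right := by
    intro o o' h h'
    constructor
    · by_contra! hlt
      exact o.map_ne _ ⟨hlt, h'.1.trans h.2⟩ o'.map_left
    · by_contra! hlt
      exact o.map_ne _ ⟨h.1.trans h'.2, hlt⟩ o'.map_right
  exact Orbital.ext (le_antisymm (key h' h).1 (key h h').1)
    (le_antisymm (key h h').2 (key h' h).2)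

theorem exists_orbital {f : HomeoI} {x : I} (hx : f x ≠ x) :
    ∃ o : Orbital f, x ∈ Set.Ioo o.left o.right := by
  have hc : IsClosed {y : I | f y = y} := isClosed_eq f.continuous continuous_id
  obtain ⟨u, ⟨hu, hux⟩, hu'⟩ := (hc.inter isClosed_Iic).isCompact.exists_isGreatest
    (s := {y : I | f y = y} ∩ Set.Iic x) ⟨0, f.map_bot, unitInterval.nonneg x⟩
  obtain ⟨v, ⟨hv, hxv⟩, hv'⟩ := (hc.inter isClosed_Ici).isCompact.exists_isLeast
    (s := {y : I | f y = y} ∩ Set.Ici x) ⟨1, f.map_top, unitInterval.le_one x⟩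
  have hux' : u < x := lt_of_le_of_ne hux fun e => hx (e ▸ hu)
  have hxv' : x < v := lt_of_le_of_ne hxv fun e => hx (e ▸ hv)
  refine ⟨⟨u, v, hux'.trans hxv', hu, hv, fun y hy hfy => ?_⟩, hux', hxv'⟩
  rcases le_total y x with h | h
  · exact (hu' ⟨hfy, h⟩).not_gt hy.1
  · exact (hv' ⟨hfy, h⟩).not_gt hy.2

theorem le_of_forall_Ioo_lt {a b c d : I} (hab : a < b) (hcd : c < d)
    (h : ∀ x ∈ Set.Ioo a b, ∀ y ∈ Set.Ioo c d, x < y) : b ≤ c := by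
  by_contra! hlt
  obtain ⟨y, hy1, hy2⟩ := exists_between (lt_min hlt hcd)
  obtain ⟨x, hx1, hx2⟩ := exists_between (max_lt hab (hy2.trans_le (min_le_left _ _)))
  exact lt_asymm (h x ⟨(le_max_left _ _).trans_lt hx1, hx2⟩ y
    ⟨hy1, hy2.trans_le (min_le_right _ _)⟩) ((le_max_right _ _).trans_lt hx1)

variable {Λ : Type} {S : Λ → HomeoI}

theorem Bump.isPosBump (m : Marking S) {b : Bump S} (hb : b.IsPositive) :
    IsPosBump (S b.1) b.2.left (m b) b.2.right :=
  ⟨(m b).2.1, (m b).2.2, b.2.map_left, b.2.map_right, hb⟩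

theorem Bump.isPosBump_inv (m : Marking S) {b : Bump S} (hb : ¬ b.IsPositive) :
    IsPosBump (S b.1)⁻¹ b.2.left (m b) b.2.right := by
  refine ⟨(m b).2.1, (m b).2.2, homeo_inv_apply_eq_self b.2.map_left,
    homeo_inv_apply_eq_self b.2.map_right, fun x hx => ?_⟩
  have h := (b.2.pos_or_neg.resolve_left hb) x hx
  have h' := (S b.1)⁻¹.strictMono h
  rwa [homeo_inv_apply_self] at h'

theorem Marking.endMarker_of_pos (m : Marking S) {b : Bump S} (hb : b.IsPositive) :
    m.endMarker b = S b.1 (m b) := if_pos hb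

theorem Marking.endMarker_of_not_pos (m : Marking S) {b : Bump S} (hb : ¬ b.IsPositive) :
    m.endMarker b = (S b.1)⁻¹ (m b) := if_neg hb

theorem Marking.lt_endMarker (m : Marking S) (b : Bump S) :
    (m b : I) < m.endMarker b ∧ m.endMarker b < b.2.right := by
  by_cases hb : b.IsPositive
  · rw [m.endMarker_of_pos hb]
    exact ⟨(Bump.isPosBump m hb).lt_map_marker, (Bump.isPosBump m hb).map_marker_lt⟩
  · rw [m.endMarker_of_not_pos hb]
    exact ⟨(Bump.isPosBump_inv m hb).lt_map_marker, (Bump.isPosBump_inv m hb).map_marker_lt⟩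

theorem Marking.diagram_lt_feet (m : Marking S) (b : Bump S) :
    m.diagram.lt (b, false) (b, true) := by
  intro x hx y hy
  exact (hx.2.trans (m.lt_endMarker b).1).trans_le hy.1

/-- The positions of supports, markers and feet which can be read off from the dynamical diagram.
The bump `i` has support `(u i, v i)`, feet `(u i, s i)` and `[t i, v i)`, and label `label i`; its
left foot is the smaller one of the vertices `source i` and `target i`. -/
theorem IsFastWithDiagram.exists_bumps {n k : ℕ} {source target : Fin k → Fin n}
    {label : Fin k → Λ}
    (h : IsFastWithDiagram S ⟨Fin n, Fin k, (· < ·), source, target, label⟩) :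
    ∃ u s t v : Fin k → I,
      (∀ i, source i < target i →
        IsPosBump (S (label i)) (u i) (s i) (v i) ∧ t i = S (label i) (s i)) ∧
      (∀ i, target i < source i →
        IsPosBump (S (label i))⁻¹ (u i) (s i) (v i) ∧ t i = (S (label i))⁻¹ (s i)) ∧
      (∀ i j, min (source i) (target i) < min (source j) (target j) → s i ≤ u j) ∧
      (∀ i j, min (source i) (target i) < max (source j) (target j) → s i ≤ t j) ∧
      (∀ i j, max (source i) (target i) < min (source j) (target j) → v i ≤ u j) ∧
      (∀ i j, max (source i) (target i) < max (source j) (target j) → v i ≤ t j) ∧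
      ∀ l x, (∀ i, label i = l → x ∉ Set.Ioo (u i) (v i)) → S l x = x := by
  obtain ⟨m, -, ν, ε, hlt, hsrc, htgt, hlab⟩ := h
  change Bump S × Bool ≃ Fin n at ν
  change Bump S ≃ Fin k at ε
  let B : Fin k → Bump S := ε.symm
  have hB : ∀ i, ε (B i) = i := ε.apply_symm_apply
  have hl : ∀ i, label i = (B i).1 := fun i => by
    have := hlab (B i)
    change label (ε (B i)) = (B i).1 at this
    rwa [hB] at this
  have hlt' : ∀ p q : Bump S × Bool, ν p < ν q →
      ∀ x ∈ m.foot p.1 p.2, ∀ y ∈ m.foot q.1 q.2, x < y := fun p q => (hlt p q).2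
  have hfeet : ∀ b, ν (b, false) < ν (b, true) := fun b => (hlt _ _).1 (m.diagram_lt_feet b)
  have hpos : ∀ i, (B i).IsPositive → source i = ν (B i, false) ∧ target i = ν (B i, true) := by
    intro i hi
    have h1 := hsrc (B i)
    have h2 := htgt (B i)
    change source (ε (B i)) = ν (m.diagram.source (B i)) at h1
    change target (ε (B i)) = ν (m.diagram.target (B i)) at h2
    rw [hB] at h1 h2
    have e1 : m.diagram.source (B i) = (B i, false) := if_pos hi
    have e2 : m.diagram.target (B i) = (B i, true) := if_pos hi
    rw [h1, h2, e1, e2]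
    exact ⟨rfl, rfl⟩
  have hneg : ∀ i, ¬ (B i).IsPositive → source i = ν (B i, true) ∧ target i = ν (B i, false) := by
    intro i hi
    have h1 := hsrc (B i)
    have h2 := htgt (B i)
    change source (ε (B i)) = ν (m.diagram.source (B i)) at h1
    change target (ε (B i)) = ν (m.diagram.target (B i)) at h2
    rw [hB] at h1 h2
    have e1 : m.diagram.source (B i) = (B i, true) := if_neg hi
    have e2 : m.diagram.target (B i) = (B i, false) := if_neg hi
    rw [h1, h2, e1, e2]
    exact ⟨rfl, rfl⟩
  have hmin : ∀ i, min (source i) (target i) = ν (B i, false) := by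
    intro i
    by_cases hi : (B i).IsPositive
    · rw [(hpos i hi).1, (hpos i hi).2, min_eq_left (hfeet _).le]
    · rw [(hneg i hi).1, (hneg i hi).2, min_eq_right (hfeet _).le]
  have hmax : ∀ i, max (source i) (target i) = ν (B i, true) := by
    intro i
    by_cases hi : (B i).IsPositive
    · rw [(hpos i hi).1, (hpos i hi).2, max_eq_right (hfeet _).le]
    · rw [(hneg i hi).1, (hneg i hi).2, max_eq_left (hfeet _).le]
  have hsub : ∀ b, Set.Ioo (m.endMarker b) b.2.right ⊆ m.foot b true :=
    fun b => Set.Ioo_subset_Ico_self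
  refine ⟨fun i => (B i).2.left, fun i => m (B i), fun i => m.endMarker (B i),
    fun i => (B i).2.right, fun i hi => ?_, fun i hi => ?_, fun i j hij => ?_, fun i j hij => ?_,
    fun i j hij => ?_, fun i j hij => ?_, fun l x hx => ?_⟩
  · have hp : (B i).IsPositive := by
      by_contra hp
      rw [(hneg i hp).1, (hneg i hp).2] at hi
      exact lt_asymm hi (hfeet _)
    rw [hl]
    exact ⟨Bump.isPosBump m hp, m.endMarker_of_pos hp⟩
  · have hp : ¬ (B i).IsPositive := by
      intro hp
      rw [(hpos i hp).1, (hpos i hp).2] at hi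
      exact lt_asymm hi (hfeet _)
    rw [hl]
    exact ⟨Bump.isPosBump_inv m hp, m.endMarker_of_not_pos hp⟩
  · rw [hmin, hmin] at hij
    exact le_of_forall_Ioo_lt (m (B i)).2.1 (m (B j)).2.1 (hlt' _ _ hij)
  · rw [hmin, hmax] at hij
    exact le_of_forall_Ioo_lt (m (B i)).2.1 (m.lt_endMarker (B j)).2
      fun x hx y hy => hlt' _ _ hij x hx y (hsub _ hy)
  · rw [hmax, hmin] at hij
    exact le_of_forall_Ioo_lt (m.lt_endMarker (B i)).2 (m (B j)).2.1
      fun x hx y hy => hlt' _ _ hij x (hsub _ hx) y hy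
  · rw [hmax, hmax] at hij
    exact le_of_forall_Ioo_lt (m.lt_endMarker (B i)).2 (m.lt_endMarker (B j)).2
      fun x hx y hy => hlt' _ _ hij x (hsub _ hx) y (hsub _ hy)
  · by_contra hne
    obtain ⟨o, ho⟩ := exists_orbital hne
    have e : B (ε ⟨l, o⟩) = ⟨l, o⟩ := ε.symm_apply_apply _
    refine hx (ε ⟨l, o⟩) (by rw [hl, e]) ?_
    change x ∈ Set.Ioo (B (ε ⟨l, o⟩)).2.left (B (ε ⟨l, o⟩)).2.right
    rw [e]
    exact ho

/-- Conversely, a family of homeomorphisms whose bumps have feet in prescribed disjoint intervals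
`[c p, c (p + 1))` is fast, with the dynamical diagram given by the order of these intervals. -/
theorem isFastWithDiagram_of_bumps {n k : ℕ} {source target : Fin k → Fin n} {label : Fin k → Λ}
    (hbij : Function.Bijective fun p : Fin k × Bool =>
      if p.2 then max (source p.1) (target p.1) else min (source p.1) (target p.1))
    (u s v : Fin k → I) (c : Fin (n + 1) → I) (hc : Monotone c)
    (hpos : ∀ i, source i < target i → IsPosBump (S (label i)) (u i) (s i) (v i) ∧
      c (target i).castSucc ≤ S (label i) (s i))
    (hneg : ∀ i, target i < source i → IsPosBump (S (label i))⁻¹ (u i) (s i) (v i) ∧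
      c (source i).castSucc ≤ (S (label i))⁻¹ (s i))
    (hu : ∀ i, c (min (source i) (target i)).castSucc ≤ u i)
    (hs : ∀ i, s i ≤ c (min (source i) (target i)).succ)
    (hv : ∀ i, v i ≤ c (max (source i) (target i)).succ)
    (hcover : ∀ l x, (∀ i, label i = l → x ∉ Set.Ioo (u i) (v i)) → S l x = x) :
    IsFastWithDiagram S ⟨Fin n, Fin k, (· < ·), source, target, label⟩ := by
  have hne : ∀ i, source i ≠ target i := by
    intro i h
    have := hbij.1 (a₁ := (i, false)) (a₂ := (i, true)) (by simp [h])
    simp at this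
  have hlr : ∀ i, u i < s i ∧ s i < v i := by
    intro i
    rcases lt_or_gt_of_ne (hne i) with h | h
    · exact ⟨(hpos i h).1.left_lt, (hpos i h).1.lt_right⟩
    · exact ⟨(hneg i h).1.left_lt, (hneg i h).1.lt_right⟩
  let e₀ : Fin k → Bump S := fun i => ⟨label i,
    { left := u i
      right := v i
      left_lt_right := (hlr i).1.trans (hlr i).2
      map_left := by
        rcases lt_or_gt_of_ne (hne i) with h | h
        · exact (hpos i h).1.map_left
        · exact homeo_inv_apply_eq_self (f := (S (label i))⁻¹) (hneg i h).1.map_left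
      map_right := by
        rcases lt_or_gt_of_ne (hne i) with h | h
        · exact (hpos i h).1.map_right
        · exact homeo_inv_apply_eq_self (f := (S (label i))⁻¹) (hneg i h).1.map_right
      map_ne := by
        intro x hx hfx
        rcases lt_or_gt_of_ne (hne i) with h | h
        · exact ((hpos i h).1.lt_map x hx).ne' hfx
        · exact ((hneg i h).1.lt_map x hx).ne' (homeo_inv_apply_eq_self hfx) }⟩
  have hcle : ∀ p q : Fin n, p < q → c p.succ ≤ c q.castSucc := fun p q hpq =>
    hc (Fin.succ_le_castSucc_iff.2 hpq)
  have hinj : Function.Injective e₀ := by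
    intro i j hij
    by_contra hne'
    have hu' : u i = u j := congrArg (fun b : Bump S => b.2.left) hij
    have hm : min (source i) (target i) ≠ min (source j) (target j) := fun h =>
      hne' (congrArg Prod.fst (hbij.1 (a₁ := (i, false)) (a₂ := (j, false)) (by simpa using h)))
    rcases lt_or_gt_of_ne hm with h | h
    · exact absurd (((hlr i).1.trans_le (hs i)).trans_le ((hcle _ _ h).trans (hu j))) hu'.not_lt
    · exact absurd (((hlr j).1.trans_le (hs j)).trans_le ((hcle _ _ h).trans (hu i))) hu'.not_gt
  have hsurj : Function.Surjective e₀ := by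
    rintro ⟨l, o⟩
    obtain ⟨x, hx⟩ := exists_between o.left_lt_right
    by_contra! h
    refine o.map_ne x hx (hcover l x fun i hi hxi => ?_)
    subst hi
    exact h i (congrArg (Sigma.mk (label i)) (Orbital.eq_of_mem hxi hx))
  let e : Fin k ≃ Bump S := Equiv.ofBijective e₀ ⟨hinj, hsurj⟩
  let m : Marking S := fun b => ⟨s (e.symm b), by
    have h : (e (e.symm b)).2.left < s (e.symm b) ∧ s (e.symm b) < (e (e.symm b)).2.right :=
      hlr (e.symm b)
    rwa [e.apply_symm_apply] at h⟩
  have hm : ∀ i, (m (e i) : I) = s i := fun i => congrArg s (e.symm_apply_apply i)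
  have hp : ∀ i, source i < target i → (e i).IsPositive := fun i h => (hpos i h).1.lt_map
  have hn : ∀ i, target i < source i → ¬ (e i).IsPositive := by
    intro i h hpos'
    have h1 := (hneg i h).1.lt_map _ (hneg i h).1.mem
    have h2 : (S (label i))⁻¹ (s i) < S (label i) ((S (label i))⁻¹ (s i)) :=
      hpos' _ ((hneg i h).1.map_mem (hneg i h).1.mem)
    rw [homeo_apply_inv_self] at h2
    exact lt_asymm h1 h2
  let ν : Bump S × Bool ≃ Fin n := (e.symm.prodCongr (Equiv.refl Bool)).trans
    (Equiv.ofBijective _ hbij)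
  have hν : ∀ i j, ν (e i, j) = if j then max (source i) (target i) else
      min (source i) (target i) := by
    intro i j
    change (if j then max (source (e.symm (e i))) (target (e.symm (e i))) else
      min (source (e.symm (e i))) (target (e.symm (e i)))) = _
    rw [e.symm_apply_apply]
  have hfoot : ∀ p : Bump S × Bool,
      m.foot p.1 p.2 ⊆ Set.Ico (c (ν p).castSucc) (c (ν p).succ) := by
    rintro ⟨b, j⟩ x hx
    obtain ⟨i, rfl⟩ := e.surjective b
    rw [hν]
    cases j with
    | false =>
      change x ∈ Set.Ioo (u i) (m (e i)) at hx
      rw [hm] at hx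
      exact ⟨(hu i).trans hx.1.le, hx.2.trans_le (hs i)⟩
    | true =>
      change x ∈ Set.Ico (m.endMarker (e i)) (v i) at hx
      refine ⟨le_trans ?_ hx.1, hx.2.trans_le (hv i)⟩
      rcases lt_or_gt_of_ne (hne i) with h | h
      · rw [m.endMarker_of_pos (hp i h), hm, if_pos rfl, max_eq_right h.le]
        exact (hpos i h).2
      · rw [m.endMarker_of_not_pos (hn i h), hm, if_pos rfl, max_eq_left h.le]
        exact (hneg i h).2
  have hltfoot : ∀ p q : Bump S × Bool, ν p < ν q → m.diagram.lt p q := fun p q hpq x hx y hy =>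
    ((hfoot p hx).2.trans_le (hcle _ _ hpq)).trans_le (hfoot q hy).1
  have hnonempty : ∀ p : Bump S × Bool, (m.foot p.1 p.2).Nonempty := by
    rintro ⟨b, j⟩
    cases j with
    | false => exact Set.nonempty_Ioo.2 (m b).2.1
    | true => exact Set.nonempty_Ico.2 (m.lt_endMarker b).2
  refine ⟨m, ⟨Finite.of_equiv _ e, ?_⟩, ν, e.symm, ?_, ?_, ?_, ?_⟩
  · intro b b' hbb' i j
    rw [Set.disjoint_left]
    intro x hx hx'
    have hneq : ν (b, i) ≠ ν (b', j) := fun h => hbb' (congrArg Prod.fst (ν.injective h))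
    rcases lt_or_gt_of_ne hneq with h | h
    · exact lt_irrefl _ (hltfoot _ _ h x hx x hx')
    · exact lt_irrefl _ (hltfoot _ _ h x hx' x hx)
  · intro p q
    refine ⟨fun h => ?_, hltfoot p q⟩
    change ν p < ν q
    obtain ⟨x, hx⟩ := hnonempty p
    obtain ⟨y, hy⟩ := hnonempty q
    by_contra hle
    rcases (not_lt.1 hle).eq_or_lt with h' | h'
    · obtain rfl := ν.injective h'
      exact lt_irrefl _ (h x hx x hx)
    · exact lt_asymm (h x hx y hy) (hltfoot _ _ h' y hy x hx)
  · intro b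
    obtain ⟨i, rfl⟩ := e.surjective b
    change source (e.symm (e i)) = ν (m.diagram.source (e i))
    rw [e.symm_apply_apply]
    rcases lt_or_gt_of_ne (hne i) with h | h
    · have e1 : m.diagram.source (e i) = (e i, false) := if_pos (hp i h)
      rw [e1, hν, if_neg (by simp), min_eq_left h.le]
    · have e1 : m.diagram.source (e i) = (e i, true) := if_neg (hn i h)
      rw [e1, hν, if_pos rfl, max_eq_left h.le]
  · intro b
    obtain ⟨i, rfl⟩ := e.surjective b
    change target (e.symm (e i)) = ν (m.diagram.target (e i))
    rw [e.symm_apply_apply]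
    rcases lt_or_gt_of_ne (hne i) with h | h
    · have e1 : m.diagram.target (e i) = (e i, true) := if_pos (hp i h)
      rw [e1, hν, if_pos rfl, max_eq_right h.le]
    · have e1 : m.diagram.target (e i) = (e i, false) := if_neg (hn i h)
      rw [e1, hν, if_neg (by simp), min_eq_right h.le]
  · intro b
    obtain ⟨i, rfl⟩ := e.surjective b
    change label (e.symm (e i)) = (e i).1
    rw [e.symm_apply_apply]
    rfl

end Diagrams

/-! ### Elements of Thompson's group with a single bump -/

section Stretch

/-- A piecewise linear map with slopes `2`, `1` and `1 / 2` between `p` and `q`, and the identity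
elsewhere. -/
noncomputable def stretchFun (p q x : ℝ) : ℝ :=
  max x (min (2 * x - p) (min (x + (q - p) / 4) ((x + q) / 2)))

/-- The inverse of `stretchFun p q`. -/
noncomputable def shrinkFun (p q y : ℝ) : ℝ :=
  min y (max ((y + p) / 2) (max (y - (q - p) / 4) (2 * y - q)))

theorem stretchFun_le_iff {p q x y : ℝ} : stretchFun p q x ≤ y ↔ x ≤ shrinkFun p q y := by
  have h1 : 2 * x - p ≤ y ↔ x ≤ (y + p) / 2 := by constructor <;> intro h <;> linarith
  have h2 : x + (q - p) / 4 ≤ y ↔ x ≤ y - (q - p) / 4 := by constructor <;> intro h <;> linarith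
  have h3 : (x + q) / 2 ≤ y ↔ x ≤ 2 * y - q := by constructor <;> intro h <;> linarith
  rw [stretchFun, shrinkFun, max_le_iff, min_le_iff, min_le_iff, le_min_iff, le_max_iff, le_max_iff,
    h1, h2, h3]

theorem le_stretchFun_iff {p q x y : ℝ} : y ≤ stretchFun p q x ↔ shrinkFun p q y ≤ x := by
  have h1 : y ≤ 2 * x - p ↔ (y + p) / 2 ≤ x := by constructor <;> intro h <;> linarith
  have h2 : y ≤ x + (q - p) / 4 ↔ y - (q - p) / 4 ≤ x := by constructor <;> intro h <;> linarith
  have h3 : y ≤ (x + q) / 2 ↔ 2 * y - q ≤ x := by constructor <;> intro h <;> linarith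
  rw [stretchFun, shrinkFun, le_max_iff, le_min_iff, le_min_iff, min_le_iff, max_le_iff, max_le_iff,
    h1, h2, h3]

theorem shrinkFun_stretchFun (p q x : ℝ) : shrinkFun p q (stretchFun p q x) = x :=
  le_antisymm (le_stretchFun_iff.1 le_rfl) (stretchFun_le_iff.1 le_rfl)

theorem stretchFun_shrinkFun (p q y : ℝ) : stretchFun p q (shrinkFun p q y) = y :=
  le_antisymm (stretchFun_le_iff.2 le_rfl) (le_stretchFun_iff.2 le_rfl)

/-- The homeomorphism of the unit interval given by `stretchFun p q`. -/
noncomputable def stretch (p q : I) : HomeoI where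
  toFun x := ⟨stretchFun p q x, x.2.1.trans (le_max_left _ _), max_le x.2.2
    ((min_le_right _ _).trans ((min_le_right _ _).trans (by linarith [x.2.2, q.2.2])))⟩
  invFun y := ⟨shrinkFun p q y, le_min y.2.1
    (le_max_of_le_left (by linarith [y.2.1, p.2.1])), (min_le_left _ _).trans y.2.2⟩
  left_inv x := Subtype.ext (shrinkFun_stretchFun p q x)
  right_inv y := Subtype.ext (stretchFun_shrinkFun p q y)
  map_rel_iff' {x y} := by
    change stretchFun p q x ≤ stretchFun p q y ↔ (x : ℝ) ≤ y
    rw [stretchFun_le_iff, shrinkFun_stretchFun]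

theorem coe_stretch (p q x : I) : (stretch p q x : ℝ) = stretchFun p q x := rfl

theorem stretchFun_of_le_left {p q x : ℝ} (h : x ≤ p) : stretchFun p q x = x :=
  max_eq_left ((min_le_left _ _).trans (by linarith))

theorem stretchFun_of_right_le {p q x : ℝ} (h : q ≤ x) : stretchFun p q x = x :=
  max_eq_left ((min_le_right _ _).trans ((min_le_right _ _).trans (by linarith)))

theorem stretchFun_eq_two_mul {p q x : ℝ} (h : p ≤ x) (h' : x ≤ (3 * p + q) / 4) :
    stretchFun p q x = 2 * x - p := by
  rw [stretchFun, min_eq_left (le_min (by linarith) (by linarith)), max_eq_right (by linarith)]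

theorem stretchFun_eq_add {p q x : ℝ} (h : (3 * p + q) / 4 ≤ x) (h' : x ≤ (p + q) / 2) :
    stretchFun p q x = x + (q - p) / 4 := by
  rw [stretchFun, min_eq_left (a := x + (q - p) / 4) (by linarith), min_eq_right (by linarith),
    max_eq_right (by linarith)]

theorem stretchFun_eq_half {p q x : ℝ} (h : (p + q) / 2 ≤ x) (h' : x ≤ q) :
    stretchFun p q x = (x + q) / 2 := by
  rw [stretchFun, min_eq_right (b := (x + q) / 2) (by linarith), min_eq_right (by linarith),
    max_eq_right (by linarith)]

theorem stretch_apply_eq_self {p q x : I} (h : x ∉ Set.Ioo p q) : stretch p q x = x := by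
  refine Subtype.ext ?_
  rw [coe_stretch]
  rcases le_or_gt x p with h' | h'
  · exact stretchFun_of_le_left h'
  · exact stretchFun_of_right_le (not_lt.1 fun h'' => h ⟨h', h''⟩)

theorem isPosBump_stretch {p s q : I} (hs : s ∈ Set.Ioo p q) : IsPosBump (stretch p q) p s q where
  left_lt := hs.1
  lt_right := hs.2
  map_left := stretch_apply_eq_self fun h => h.1.false
  map_right := stretch_apply_eq_self fun h => h.2.false
  lt_map x hx := by
    have h1 : (p : ℝ) < x := hx.1
    have h2 : (x : ℝ) < q := hx.2
    refine Subtype.coe_lt_coe.1 ?_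
    rw [coe_stretch]
    exact lt_max_of_lt_right (lt_min (by linarith) (lt_min (by linarith) (by linarith)))

theorem stretch_mem_thompsonF {p q : I} (hpq : p ≤ q) (hp : IsDyadic p) (hq : IsDyadic q) :
    stretch p q ∈ thompsonF := by
  classical
  have hpq' : (p : ℝ) ≤ q := hpq
  have hm₁ : IsDyadic ((3 * p + q) / 4 : ℝ) := by
    have h2 := ((((hp.zpow_mul 1).add hp).add hq).zpow_mul (-2))
    convert! h2 using 1
    norm_num
    ring
  have hm₂ : IsDyadic ((p + q) / 2 : ℝ) := by
    have h2 := ((hp.add hq).zpow_mul (-1))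
    convert! h2 using 1
    norm_num
    ring
  let m₁ : I := ⟨(3 * p + q) / 4, by linarith [p.2.1, q.2.1], by linarith [p.2.2, q.2.2]⟩
  let m₂ : I := ⟨(p + q) / 2, by linarith [p.2.1, q.2.1], by linarith [p.2.2, q.2.2]⟩
  refine ⟨{p, m₁, m₂, q}, ?_, fun u v huv hD => ?_⟩
  · intro d hd
    simp only [Finset.mem_insert, Finset.mem_singleton] at hd
    rcases hd with rfl | rfl | rfl | rfl
    exacts [hp, hm₁, hm₂, hq]
  · have key : ∀ d ∈ ({p, m₁, m₂, q} : Finset I), (v : ℝ) ≤ d ∨ (d : ℝ) ≤ u := by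
      intro d hd
      by_contra! h
      exact hD d hd ⟨h.2, h.1⟩
    have hsub : ∀ x ∈ Set.Icc u v, (u : ℝ) ≤ x ∧ (x : ℝ) ≤ v := fun x hx => ⟨hx.1, hx.2⟩
    simp only [coe_stretch]
    rcases key p (by simp) with h1 | h1
    · refine ⟨0, fun x hx y hy => ?_⟩
      rw [stretchFun_of_le_left ((hsub x hx).2.trans h1),
        stretchFun_of_le_left ((hsub y hy).2.trans h1), zpow_zero, one_mul]
    rcases key m₁ (by simp) with h2 | h2
    · refine ⟨1, fun x hx y hy => ?_⟩
      rw [stretchFun_eq_two_mul (h1.trans (hsub x hx).1) ((hsub x hx).2.trans h2),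
        stretchFun_eq_two_mul (h1.trans (hsub y hy).1) ((hsub y hy).2.trans h2), zpow_one]
      ring
    rcases key m₂ (by simp) with h3 | h3
    · refine ⟨0, fun x hx y hy => ?_⟩
      rw [stretchFun_eq_add (h2.trans (hsub x hx).1) ((hsub x hx).2.trans h3),
        stretchFun_eq_add (h2.trans (hsub y hy).1) ((hsub y hy).2.trans h3), zpow_zero]
      ring
    rcases key q (by simp) with h4 | h4
    · refine ⟨-1, fun x hx y hy => ?_⟩
      rw [stretchFun_eq_half (h3.trans (hsub x hx).1) ((hsub x hx).2.trans h4),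
        stretchFun_eq_half (h3.trans (hsub y hy).1) ((hsub y hy).2.trans h4), zpow_neg_one]
      ring
    · refine ⟨0, fun x hx y hy => ?_⟩
      rw [stretchFun_of_right_le (h4.trans (hsub x hx).1),
        stretchFun_of_right_le (h4.trans (hsub y hy).1), zpow_zero, one_mul]

/-- A factor fixing the support of a bump does not affect the bump. -/
theorem IsPosBump.mul_right {f g : HomeoI} {u s t v : I} (h : IsPosBump f u s v ∧ f s = t)
    (hg : ∀ x ∈ Set.Icc u v, g x = x) : IsPosBump (f * g) u s v ∧ (f * g) s = t := by
  obtain ⟨h, ht⟩ := h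
  have hlt := h.left_lt.trans h.lt_right
  have e : ∀ x ∈ Set.Icc u v, (f * g) x = f x := fun x hx => by rw [RelIso.mul_apply, hg x hx]
  refine ⟨⟨h.left_lt, h.lt_right, ?_, ?_, fun x hx => ?_⟩, ?_⟩
  · rw [e u ⟨le_rfl, hlt.le⟩, h.map_left]
  · rw [e v ⟨hlt.le, le_rfl⟩, h.map_right]
  · rw [e x ⟨hx.1.le, hx.2.le⟩]
    exact h.lt_map x hx
  · rw [e s ⟨h.left_lt.le, h.lt_right.le⟩, ht]

theorem IsPosBump.mul_left {f g : HomeoI} {u s t v : I} (h : IsPosBump f u s v ∧ f s = t)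
    (hg : ∀ x ∈ Set.Icc u v, g x = x) : IsPosBump (g * f) u s v ∧ (g * f) s = t := by
  obtain ⟨h, ht⟩ := h
  have hlt := h.left_lt.trans h.lt_right
  have e : ∀ x ∈ Set.Icc u v, (g * f) x = f x := fun x hx => by
    refine hg _ ⟨?_, ?_⟩
    · have := f.monotone hx.1
      rwa [h.map_left] at this
    · have := f.monotone hx.2
      rwa [h.map_right] at this
  refine ⟨⟨h.left_lt, h.lt_right, ?_, ?_, fun x hx => ?_⟩, ?_⟩
  · rw [e u ⟨le_rfl, hlt.le⟩, h.map_left]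
  · rw [e v ⟨hlt.le, le_rfl⟩, h.map_right]
  · rw [e x ⟨hx.1.le, hx.2.le⟩]
    exact h.lt_map x hx
  · rw [e s ⟨h.left_lt.le, h.lt_right.le⟩, ht]

/-! ### Fast families in Thompson's group with the two diagrams -/

/-- The point `k / 32`. -/
noncomputable def gridPoint (k : Fin 33) : I :=
  ⟨(k : ℕ) / 32, by positivity, by
    rw [div_le_one (by norm_num)]
    exact_mod_cast Nat.lt_succ_iff.1 k.2⟩

theorem coe_gridPoint (k : Fin 33) : (gridPoint k : ℝ) = (k : ℕ) / 32 := rfl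

theorem gridPoint_strictMono : StrictMono gridPoint := fun i j hij => by
  refine Subtype.coe_lt_coe.1 ?_
  rw [coe_gridPoint, coe_gridPoint]
  have : ((i : ℕ) : ℝ) < (j : ℕ) := by exact_mod_cast hij
  linarith

theorem isDyadic_gridPoint (k : Fin 33) : IsDyadic (gridPoint k) :=
  ⟨(k : ℕ), 5, by rw [coe_gridPoint]; norm_num⟩

/-- The homeomorphism `stretch` between two grid points. -/
noncomputable def gridStretch (i j : Fin 33) : HomeoI := stretch (gridPoint i) (gridPoint j)

theorem gridStretch_mem_thompsonF {i j : Fin 33} (h : i ≤ j) : gridStretch i j ∈ thompsonF :=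
  stretch_mem_thompsonF (gridPoint_strictMono.monotone h) (isDyadic_gridPoint i)
    (isDyadic_gridPoint j)

theorem gridStretch_apply_eq_self {i j k l : Fin 33} (h : l ≤ i ∨ j ≤ k) {x : I}
    (hx : x ∈ Set.Icc (gridPoint k) (gridPoint l)) : gridStretch i j x = x := by
  refine stretch_apply_eq_self fun hx' => ?_
  rcases h with h | h
  · exact (hx.2.trans (gridPoint_strictMono.monotone h)).not_gt hx'.1
  · exact ((gridPoint_strictMono.monotone h).trans hx.1).not_gt hx'.2

theorem gridStretch_inv_apply_eq_self {i j k l : Fin 33} (h : l ≤ i ∨ j ≤ k) {x : I}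
    (hx : x ∈ Set.Icc (gridPoint k) (gridPoint l)) : (gridStretch i j)⁻¹ x = x :=
  homeo_inv_apply_eq_self (gridStretch_apply_eq_self h hx)

/-- On a grid interval of length `8` the stretch moves the point at a quarter of the interval to its
midpoint. -/
theorem isPosBump_gridStretch {i s t j : Fin 33} (hs : (s : ℕ) = i + 2) (ht : (t : ℕ) = i + 4)
    (hj : (j : ℕ) = i + 8) :
    IsPosBump (gridStretch i j) (gridPoint i) (gridPoint s) (gridPoint j) ∧
      gridStretch i j (gridPoint s) = gridPoint t := by
  have e1 : ((s : ℕ) : ℝ) = (i : ℕ) + 2 := by exact_mod_cast hs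
  have e2 : ((t : ℕ) : ℝ) = (i : ℕ) + 4 := by exact_mod_cast ht
  have e3 : ((j : ℕ) : ℝ) = (i : ℕ) + 8 := by exact_mod_cast hj
  refine ⟨isPosBump_stretch ⟨gridPoint_strictMono ?_, gridPoint_strictMono ?_⟩, Subtype.ext ?_⟩
  · exact Fin.lt_def.2 (by omega)
  · exact Fin.lt_def.2 (by omega)
  · rw [gridStretch, coe_stretch, stretchFun_eq_two_mul, coe_gridPoint, coe_gridPoint,
      coe_gridPoint, e1, e2]
    · ring
    · rw [coe_gridPoint, coe_gridPoint, e1]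
      linarith
    · rw [coe_gridPoint, coe_gridPoint, coe_gridPoint, e1, e3]
      linarith

/-- A power of a homeomorphism with a single bump has arbitrarily small feet. -/
theorem exists_gridStretch_pow {i s t j : Fin 33} (his : i < s) (hst : s < t) (htj : t < j) :
    ∃ b ∈ thompsonF, IsPosBump b (gridPoint i) (gridPoint s) (gridPoint j) ∧
      gridPoint t ≤ b (gridPoint s) ∧
      ∀ x, x ∉ Set.Ioo (gridPoint i) (gridPoint j) → b x = x := by
  have h : IsPosBump (gridStretch i j) (gridPoint i) (gridPoint s) (gridPoint j) :=
    isPosBump_stretch ⟨gridPoint_strictMono his, gridPoint_strictMono (hst.trans htj)⟩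
  obtain ⟨n, hn⟩ := h.exists_lt_pow h.mem (gridPoint_strictMono htj)
  have hn0 : n ≠ 0 := by
    rintro rfl
    exact lt_asymm hn (gridPoint_strictMono hst)
  refine ⟨gridStretch i j ^ n,
    pow_mem (gridStretch_mem_thompsonF ((his.trans (hst.trans htj)).le)) n, h.pow hn0, hn.le,
    fun x hx => ?_⟩
  have h1 : gridStretch i j ∈ MulAction.stabilizer HomeoI x := stretch_apply_eq_self hx
  exact pow_mem h1 n

theorem exists_isFastWithDiagram_diagramBZ :
    ∃ a b c : thompsonF, IsFastWithDiagram ![(a : HomeoI), b, c] diagramBZ := by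
  obtain ⟨b, hbF, hb, hbt, hbfix⟩ := exists_gridStretch_pow (i := 3) (s := 4) (t := 10) (j := 11)
    (by decide) (by decide) (by decide)
  have h₁ := isPosBump_gridStretch (i := 0) (s := 2) (t := 4) (j := 8) rfl rfl rfl
  have h₂ := isPosBump_gridStretch (i := 8) (s := 10) (t := 12) (j := 16) rfl rfl rfl
  have h₃ := isPosBump_gridStretch (i := 16) (s := 18) (t := 20) (j := 24) rfl rfl rfl
  let a : HomeoI := (gridStretch 0 8)⁻¹ * gridStretch 8 16
  have ha : a⁻¹ = (gridStretch 8 16)⁻¹ * gridStretch 0 8 := by rw [mul_inv_rev, inv_inv]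
  have ha₁ := ha ▸ IsPosBump.mul_left h₁ fun x hx =>
    gridStretch_inv_apply_eq_self (i := 8) (j := 16) (by decide) hx
  have ha₂ : IsPosBump a _ _ _ ∧ _ := IsPosBump.mul_left h₂ fun x hx =>
    gridStretch_inv_apply_eq_self (i := 0) (j := 8) (by decide) hx
  refine ⟨⟨a, mul_mem (inv_mem (gridStretch_mem_thompsonF (by decide)))
    (gridStretch_mem_thompsonF (by decide))⟩, ⟨b, hbF⟩,
    ⟨gridStretch 16 24, gridStretch_mem_thompsonF (by decide)⟩, ?_⟩
  -- The bumps are numbered as in the diagram, and the last family of points separates the feet.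
  refine isFastWithDiagram_of_bumps (source := ![2, 3, 1, 6]) (target := ![0, 5, 4, 7])
    (label := ![0, 0, 1, 2]) (by decide)
    (fun i => gridPoint (![0, 8, 3, 16] i)) (fun i => gridPoint (![2, 10, 4, 18] i))
    (fun i => gridPoint (![8, 16, 11, 24] i))
    (fun i => gridPoint (![0, 2, 4, 8, 10, 12, 16, 20, 24] i))
    (fun i j hij => gridPoint_strictMono.monotone (by revert i j; decide))
    (fun i hi => ?_) (fun i hi => ?_)
    (fun i => gridPoint_strictMono.monotone (by revert i; decide))
    (fun i => gridPoint_strictMono.monotone (by revert i; decide))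
    (fun i => gridPoint_strictMono.monotone (by revert i; decide)) (fun l x hx => ?_)
  · fin_cases i
    · exact absurd hi (by decide)
    · exact ⟨ha₂.1, ha₂.2.ge⟩
    · exact ⟨hb, hbt⟩
    · exact ⟨h₃.1, h₃.2.ge⟩
  · fin_cases i
    · exact ⟨ha₁.1, ha₁.2.ge⟩
    · exact absurd hi (by decide)
    · exact absurd hi (by decide)
    · exact absurd hi (by decide)
  · fin_cases l
    · change (gridStretch 0 8)⁻¹ (gridStretch 8 16 x) = x
      have h₁₆ : gridStretch 8 16 x = x := stretch_apply_eq_self (hx 1 rfl)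
      have h₈ : gridStretch 0 8 x = x := stretch_apply_eq_self (hx 0 rfl)
      rw [h₁₆, homeo_inv_apply_eq_self h₈]
    · exact hbfix x (hx 2 rfl)
    · exact stretch_apply_eq_self (hx 3 rfl)

theorem exists_isFastWithDiagram_diagramG :
    ∃ f g h : thompsonF, IsFastWithDiagram ![(f : HomeoI), g, h] diagramG := by
  obtain ⟨g, hgF, hg, hgt, hgfix⟩ := exists_gridStretch_pow (i := 3) (s := 4) (t := 26) (j := 27)
    (by decide) (by decide) (by decide)
  obtain ⟨h, hhF, hh, hht, hhfix⟩ := exists_gridStretch_pow (i := 11) (s := 12) (t := 18) (j := 19)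
    (by decide) (by decide) (by decide)
  have h₁ := isPosBump_gridStretch (i := 0) (s := 2) (t := 4) (j := 8) rfl rfl rfl
  have h₂ := isPosBump_gridStretch (i := 8) (s := 10) (t := 12) (j := 16) rfl rfl rfl
  have h₃ := isPosBump_gridStretch (i := 16) (s := 18) (t := 20) (j := 24) rfl rfl rfl
  have h₄ := isPosBump_gridStretch (i := 24) (s := 26) (t := 28) (j := 32) rfl rfl rfl
  let f : HomeoI :=
    (gridStretch 0 8)⁻¹ * ((gridStretch 8 16)⁻¹ * (gridStretch 16 24 * gridStretch 24 32))
  have hf : f⁻¹ =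
      (gridStretch 24 32)⁻¹ * (gridStretch 16 24)⁻¹ * gridStretch 8 16 * gridStretch 0 8 := by
    rw [mul_inv_rev, mul_inv_rev, mul_inv_rev, inv_inv, inv_inv]
  have hf₁ : IsPosBump f⁻¹ _ _ _ ∧ f⁻¹ _ = _ := hf ▸ IsPosBump.mul_left h₁ fun x hx => by
    rw [RelIso.mul_apply, RelIso.mul_apply, gridStretch_apply_eq_self (by decide) hx,
      gridStretch_inv_apply_eq_self (by decide) hx, gridStretch_inv_apply_eq_self (by decide) hx]
  have hf₂ : IsPosBump f⁻¹ _ _ _ ∧ f⁻¹ _ = _ :=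
    hf ▸ IsPosBump.mul_right (IsPosBump.mul_left h₂ fun x hx => by
      rw [RelIso.mul_apply, gridStretch_inv_apply_eq_self (by decide) hx,
        gridStretch_inv_apply_eq_self (by decide) hx])
      fun x hx => gridStretch_apply_eq_self (by decide) hx
  have hf₃ : IsPosBump f _ _ _ ∧ f _ = _ := IsPosBump.mul_left (IsPosBump.mul_left
      (IsPosBump.mul_right h₃ fun x hx => gridStretch_apply_eq_self (i := 24) (j := 32)
        (by decide) hx)
      fun x hx => gridStretch_inv_apply_eq_self (i := 8) (j := 16) (by decide) hx)
      fun x hx => gridStretch_inv_apply_eq_self (i := 0) (j := 8) (by decide) hx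
  have hf₄ : IsPosBump f _ _ _ ∧ f _ = _ := IsPosBump.mul_left (IsPosBump.mul_left
      (IsPosBump.mul_left h₄ fun x hx => gridStretch_apply_eq_self (i := 16) (j := 24)
        (by decide) hx)
      fun x hx => gridStretch_inv_apply_eq_self (i := 8) (j := 16) (by decide) hx)
      fun x hx => gridStretch_inv_apply_eq_self (i := 0) (j := 8) (by decide) hx
  refine ⟨⟨f, mul_mem (inv_mem (gridStretch_mem_thompsonF (by decide)))
    (mul_mem (inv_mem (gridStretch_mem_thompsonF (by decide)))
    (mul_mem (gridStretch_mem_thompsonF (by decide)) (gridStretch_mem_thompsonF (by decide))))⟩,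
    ⟨g, hgF⟩, ⟨h, hhF⟩, ?_⟩
  -- The bumps are numbered as in the diagram, and the last family of points separates the feet.
  refine isFastWithDiagram_of_bumps (source := ![2, 5, 6, 9, 1, 4])
    (target := ![0, 3, 8, 11, 10, 7]) (label := ![0, 0, 0, 0, 1, 2]) (by decide)
    (fun i => gridPoint (![0, 8, 16, 24, 3, 11] i))
    (fun i => gridPoint (![2, 10, 18, 26, 4, 12] i))
    (fun i => gridPoint (![8, 16, 24, 32, 27, 19] i))
    (fun i => gridPoint (![0, 2, 4, 8, 10, 12, 16, 18, 20, 24, 26, 28, 32] i))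
    (fun i j hij => gridPoint_strictMono.monotone (by revert i j; decide))
    (fun i hi => ?_) (fun i hi => ?_)
    (fun i => gridPoint_strictMono.monotone (by revert i; decide))
    (fun i => gridPoint_strictMono.monotone (by revert i; decide))
    (fun i => gridPoint_strictMono.monotone (by revert i; decide)) (fun l x hx => ?_)
  · fin_cases i
    · exact absurd hi (by decide)
    · exact absurd hi (by decide)
    · exact ⟨hf₃.1, hf₃.2.ge⟩
    · exact ⟨hf₄.1, hf₄.2.ge⟩
    · exact ⟨hg, hgt⟩
    · exact ⟨hh, hht⟩
  · fin_cases i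
    · exact ⟨hf₁.1, hf₁.2.ge⟩
    · exact ⟨hf₂.1, hf₂.2.ge⟩
    · exact absurd hi (by decide)
    · exact absurd hi (by decide)
    · exact absurd hi (by decide)
    · exact absurd hi (by decide)
  · fin_cases l
    · change (gridStretch 0 8)⁻¹
        ((gridStretch 8 16)⁻¹ (gridStretch 16 24 (gridStretch 24 32 x))) = x
      have h₃₂ : gridStretch 24 32 x = x := stretch_apply_eq_self (hx 3 rfl)
      have h₂₄ : gridStretch 16 24 x = x := stretch_apply_eq_self (hx 2 rfl)
      have h₁₆ : gridStretch 8 16 x = x := stretch_apply_eq_self (hx 1 rfl)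
      have h₈ : gridStretch 0 8 x = x := stretch_apply_eq_self (hx 0 rfl)
      rw [h₃₂, h₂₄, homeo_inv_apply_eq_self h₁₆, homeo_inv_apply_eq_self h₈]
    · exact hgfix x (hx 4 rfl)
    · exact hhfix x (hx 5 rfl)

end Stretch

/-! ### The groups of arbitrary realizations of the two diagrams -/

section Realizations

theorem homeo_mul_comm_of_fix {f g : HomeoI} {A : Set I} (hf : ∀ x ∈ A, f x = x)
    (hg : ∀ x ∉ A, g x = x) : f * g = g * f := by
  refine RelIso.ext fun x => ?_
  rw [RelIso.mul_apply, RelIso.mul_apply]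
  by_cases hx : x ∈ A
  · have hgx : g x ∈ A := by
      by_contra h
      exact h (by rwa [g.injective (hg _ h)])
    rw [hf _ hgx, hf x hx]
  · have hfx : f x ∉ A := fun h => hx (f.injective (hf _ h) ▸ h)
    rw [hg x hx, hg _ hfx]

/-- A group of homeomorphisms fixing the support of a bump generates together with this bump the
direct product with an infinite cyclic group. -/
theorem nonempty_mulEquiv_prod {a b c : HomeoI} {u s v : I} (hc : IsPosBump c u s v)
    (hcfix : ∀ x, x ∉ Set.Ioo u v → c x = x) (ha : ∀ x ∈ Set.Ioo u v, a x = x)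
    (hb : ∀ x ∈ Set.Ioo u v, b x = x) :
    Nonempty (Subgroup.closure ({a, b, c} : Set HomeoI) ≃*
      Subgroup.closure ({a, b} : Set HomeoI) × Multiplicative ℤ) := by
  have hfix : ∀ β ∈ Subgroup.closure ({a, b} : Set HomeoI), ∀ x ∈ Set.Ioo u v, β x = x := by
    intro β hβ x hx
    have : Subgroup.closure ({a, b} : Set HomeoI) ≤ MulAction.stabilizer HomeoI x := by
      refine (Subgroup.closure_le _).2 ?_
      rintro _ (rfl | rfl)
      exacts [ha x hx, hb x hx]
    exact this hβ
  have hcz : ∀ (k : ℤ) (x : I), x ∉ Set.Ioo u v → (c ^ k) x = x := fun k x hx => by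
    have : c ∈ MulAction.stabilizer HomeoI x := hcfix x hx
    exact zpow_mem this k
  let Φ : Subgroup.closure ({a, b} : Set HomeoI) × Multiplicative ℤ →* HomeoI :=
    MonoidHom.noncommCoprod (Subgroup.subtype _) (zpowersHom HomeoI c) fun β k =>
      homeo_mul_comm_of_fix (hfix β β.2) (hcz (Multiplicative.toAdd k))
  have hΦ : Function.Injective Φ := by
    rw [injective_iff_map_eq_one]
    rintro ⟨β, k⟩ h
    have h' : (β : HomeoI) * c ^ (Multiplicative.toAdd k) = 1 := h
    have hk : Multiplicative.toAdd k = 0 := by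
      have h1 : (β : HomeoI) ((c ^ (Multiplicative.toAdd k)) s) = s := by
        rw [← RelIso.mul_apply, h']
        rfl
      rw [hfix β β.2 _ (hc.zpow_mem hc.mem _)] at h1
      have hs : s ∈ Set.Ico s (c s) := ⟨le_rfl, hc.lt_map_marker⟩
      refine (hc.hasFundamentalDomain hcfix).eq_zero hs ?_
      rw [RelIso.smul_def, h1]
      exact hs
    rw [hk, zpow_zero, mul_one] at h'
    exact Prod.ext (Subtype.ext h') hk
  have hrange : Φ.range = Subgroup.closure ({a, b, c} : Set HomeoI) := by
    have e : ({a, b, c} : Set HomeoI) = {a, b} ∪ {c} := by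
      ext x
      simp only [Set.mem_insert_iff, Set.mem_singleton_iff, Set.mem_union, or_assoc]
    rw [show Φ.range = _ from MonoidHom.noncommCoprod_range _ _ _,
      Subgroup.range_subtype, e, Subgroup.closure_union,
      ← Subgroup.zpowers_eq_closure]
    rfl
  exact ⟨((MonoidHom.ofInjective hΦ).trans (MulEquiv.subgroupCongr hrange)).symm⟩

theorem IsFastWithDiagram.nonempty_mulEquiv_diagramBZ {a b c : HomeoI}
    (h : IsFastWithDiagram ![a, b, c] diagramBZ) :
    Nonempty (Subgroup.closure ({a, b} : Set HomeoI) ≃* shiftGroup succIso) ∧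
      Nonempty (Subgroup.closure ({a, b, c} : Set HomeoI) ≃*
        Subgroup.closure ({a, b} : Set HomeoI) × Multiplicative ℤ) := by
  obtain ⟨u, s, t, v, hpos, hneg, hLL, hLR, hRL, hRR, hcover⟩ :=
    IsFastWithDiagram.exists_bumps (source := ![2, 3, 1, 6]) (target := ![0, 5, 4, 7])
      (label := ![0, 0, 1, 2]) h
  obtain ⟨h₀, t₀⟩ : IsPosBump a⁻¹ (u 0) (s 0) (v 0) ∧ t 0 = a⁻¹ (s 0) := hneg 0 (by decide)
  obtain ⟨h₁, t₁⟩ : IsPosBump a (u 1) (s 1) (v 1) ∧ t 1 = a (s 1) := hpos 1 (by decide)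
  obtain ⟨h₂, t₂⟩ : IsPosBump b (u 2) (s 2) (v 2) ∧ t 2 = b (s 2) := hpos 2 (by decide)
  obtain ⟨h₃, t₃⟩ : IsPosBump c (u 3) (s 3) (v 3) ∧ t 3 = c (s 3) := hpos 3 (by decide)
  have hb : ∀ x, x ∉ Set.Ioo (u 2) (v 2) → b x = x := fun x hx => hcover 1 x fun i hi => by
    obtain rfl : i = 2 := by revert i; decide
    exact hx
  have hc : ∀ x, x ∉ Set.Ioo (u 3) (v 3) → c x = x := fun x hx => hcover 2 x fun i hi => by
    obtain rfl : i = 3 := by revert i; decide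
    exact hx
  have ha : ∀ x, x ∉ Set.Ioo (u 0) (v 0) → x ∉ Set.Ioo (u 1) (v 1) → a x = x :=
    fun x hx hx' => hcover 0 x fun i hi => by
      obtain rfl | rfl : i = 0 ∨ i = 1 := by revert i; decide
      exacts [hx, hx']
  refine ⟨nonempty_mulEquiv_shiftGroup_succIso h₂ hb h₀ h₁ (hLL 0 2 (by decide))
    (t₀ ▸ hLR 2 0 (by decide)) (t₂ ▸ hLR 1 2 (by decide)) (t₁ ▸ hRR 2 1 (by decide))
    (hRL 0 1 (by decide)), nonempty_mulEquiv_prod h₃ hc (fun x hx => ha x ?_ ?_)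
    fun x hx => hb x ?_⟩
  · exact fun h => lt_asymm h.2 ((hRL 0 3 (by decide)).trans_lt hx.1)
  · exact fun h => lt_asymm h.2 ((hRL 1 3 (by decide)).trans_lt hx.1)
  · exact fun h => lt_asymm h.2 ((hRL 2 3 (by decide)).trans_lt hx.1)

theorem IsFastWithDiagram.nonempty_mulEquiv_diagramG {f g h : HomeoI}
    (hD : IsFastWithDiagram ![f, g, h] diagramG) :
    Nonempty (Subgroup.closure ({f, g, h} : Set HomeoI) ≃* shiftGroup succIsoTwo) := by
  obtain ⟨u, s, t, v, hpos, hneg, hLL, hLR, hRL, hRR, hcover⟩ :=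
    IsFastWithDiagram.exists_bumps (source := ![2, 5, 6, 9, 1, 4])
      (target := ![0, 3, 8, 11, 10, 7]) (label := ![0, 0, 0, 0, 1, 2]) hD
  obtain ⟨h₀, t₀⟩ : IsPosBump f⁻¹ (u 0) (s 0) (v 0) ∧ t 0 = f⁻¹ (s 0) := hneg 0 (by decide)
  obtain ⟨h₁, t₁⟩ : IsPosBump f⁻¹ (u 1) (s 1) (v 1) ∧ t 1 = f⁻¹ (s 1) := hneg 1 (by decide)
  obtain ⟨h₂, t₂⟩ : IsPosBump f (u 2) (s 2) (v 2) ∧ t 2 = f (s 2) := hpos 2 (by decide)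
  obtain ⟨h₃, t₃⟩ : IsPosBump f (u 3) (s 3) (v 3) ∧ t 3 = f (s 3) := hpos 3 (by decide)
  obtain ⟨h₄, t₄⟩ : IsPosBump g (u 4) (s 4) (v 4) ∧ t 4 = g (s 4) := hpos 4 (by decide)
  obtain ⟨h₅, t₅⟩ : IsPosBump h (u 5) (s 5) (v 5) ∧ t 5 = h (s 5) := hpos 5 (by decide)
  have hg : ∀ x, x ∉ Set.Ioo (u 4) (v 4) → g x = x := fun x hx => hcover 1 x fun i hi => by
    obtain rfl : i = 4 := by revert i; decide
    exact hx
  have hh : ∀ x, x ∉ Set.Ioo (u 5) (v 5) → h x = x := fun x hx => hcover 2 x fun i hi => by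
    obtain rfl : i = 5 := by revert i; decide
    exact hx
  exact nonempty_mulEquiv_shiftGroup_succIsoTwo h₀ h₁ h₂ h₃ h₄ h₅ hg hh
    (hLL 0 4 (by decide)) (t₀ ▸ hLR 4 0 (by decide)) (t₄ ▸ hLR 3 4 (by decide))
    (t₃ ▸ hRR 4 3 (by decide)) (hLL 1 5 (by decide)) (t₁ ▸ hLR 5 1 (by decide))
    (t₅ ▸ hLR 2 5 (by decide)) (t₂ ▸ hRR 5 2 (by decide)) (hRL 0 1 (by decide))
    (hRL 1 2 (by decide)) (hRL 2 3 (by decide))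

theorem IsFastWithDiagram.nonempty_mulEquiv_shiftGroup_prod {a b c : HomeoI}
    (h : IsFastWithDiagram ![a, b, c] diagramBZ) :
    Nonempty (Subgroup.closure ({a, b, c} : Set HomeoI) ≃*
      shiftGroup succIso × Multiplicative ℤ) := by
  obtain ⟨⟨e₁⟩, ⟨e₂⟩⟩ := h.nonempty_mulEquiv_diagramBZ
  exact ⟨e₂.trans (e₁.prodCongr (MulEquiv.refl _))⟩

theorem closure_triple_fg {G : Type*} [Group G] (a b c : G) :
    (Subgroup.closure ({a, b, c} : Set G)).FG :=
  (Subgroup.fg_iff _).2 ⟨_, rfl, Set.toFinite _⟩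

theorem embeds_thompsonF_of_le {H : Subgroup HomeoI} (h : H ≤ thompsonF) : Embeds H thompsonF :=
  ⟨Subgroup.inclusion h, Subgroup.inclusion_injective h⟩

theorem closure_le_thompsonF (a b c : thompsonF) :
    Subgroup.closure ({(a : HomeoI), (b : HomeoI), (c : HomeoI)} : Set HomeoI) ≤ thompsonF := by
  refine (Subgroup.closure_le _).2 ?_
  rintro _ (rfl | rfl | rfl)
  exacts [a.2, b.2, c.2]

theorem embeds_shiftGroup_succIso_prod_thompsonF :
    Embeds (shiftGroup succIso × Multiplicative ℤ) thompsonF := by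
  obtain ⟨a, b, c, h⟩ := exists_isFastWithDiagram_diagramBZ
  obtain ⟨e⟩ := h.nonempty_mulEquiv_shiftGroup_prod
  exact e.symm.embeds.trans (embeds_thompsonF_of_le (closure_le_thompsonF a b c))

theorem embeds_shiftGroup_succIsoTwo_thompsonF : Embeds (shiftGroup succIsoTwo) thompsonF := by
  obtain ⟨f, g, h, hD⟩ := exists_isFastWithDiagram_diagramG
  obtain ⟨e⟩ := hD.nonempty_mulEquiv_diagramG
  exact e.symm.embeds.trans (embeds_thompsonF_of_le (closure_le_thompsonF f g h))

theorem Embeds.exists_subgroup_mulEquiv {G H : Type*} [Group G] [Group H] (hGH : Embeds G H) :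
    ∃ K : Subgroup H, Nonempty (K ≃* G) := by
  obtain ⟨φ, hφ⟩ := hGH
  exact ⟨φ.range, ⟨(MonoidHom.ofInjective hφ).symm⟩⟩

theorem fg_of_mulEquiv {G H : Type*} [Group G] [Group H] {K : Subgroup H} (e : K ≃* G)
    (hG : Group.FG G) : K.FG :=
  (Group.fg_iff_subgroup_fg K).1
    (Group.fg_of_surjective (f := e.symm.toMonoidHom) e.symm.surjective)

/-- Finitely generated subgroups of Thompson's group isomorphic to the two model groups. -/
theorem exists_incomparable_subgroups :
    ∃ H₀ H₁ : Subgroup thompsonF, H₀.FG ∧ H₁.FG ∧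
      HasEAClass H₀ (ω + 2) ∧ HasEAClass H₁ (ω + 2) ∧ ¬ Embeds H₀ H₁ ∧ ¬ Embeds H₁ H₀ := by
  obtain ⟨H₀, ⟨e₀⟩⟩ := embeds_shiftGroup_succIso_prod_thompsonF.exists_subgroup_mulEquiv
  obtain ⟨H₁, ⟨e₁⟩⟩ := embeds_shiftGroup_succIsoTwo_thompsonF.exists_subgroup_mulEquiv
  have hfg : Group.FG (shiftGroup succIso) := (Group.fg_iff_subgroup_fg _).2 shiftGroup_succIso_fg
  exact ⟨H₀, H₁, fg_of_mulEquiv e₀ inferInstance,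
    fg_of_mulEquiv e₁ ((Group.fg_iff_subgroup_fg _).2 shiftGroup_succIsoTwo_fg),
    hasEAClass_shiftGroup_succIso_prod.congr e₀.symm,
    hasEAClass_shiftGroup_succIsoTwo.congr e₁.symm,
    fun h => not_embeds_shiftGroup_prod _ lt_succIsoTwo
      ((e₀.symm.embeds.trans h).trans e₁.embeds),
    fun h => not_embeds_shiftGroup_succIsoTwo ((e₁.symm.embeds.trans h).trans e₀.embeds)⟩

end Realizations

theorem mainTheorem4 :
    -- both dynamical diagrams are realized by geometrically fast families in `F`
    (∃ a b c : thompsonF, IsFastWithDiagram ![(a : HomeoI), b, c] diagramBZ) ∧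
    (∃ f g h : thompsonF, IsFastWithDiagram ![(f : HomeoI), g, h] diagramG) ∧
    -- for every realization, the group of the first diagram is `B + ℤ` with `B = ⟨a, b⟩`
    (∀ a b c : HomeoI, IsFastWithDiagram ![a, b, c] diagramBZ →
      Nonempty (Subgroup.closure ({a, b, c} : Set HomeoI) ≃*
        Subgroup.closure ({a, b} : Set HomeoI) × Multiplicative ℤ) ∧
      (Subgroup.closure ({a, b, c} : Set HomeoI)).FG ∧
      Embeds (Subgroup.closure ({a, b, c} : Set HomeoI)) thompsonF ∧
      HasEAClass (Subgroup.closure ({a, b, c} : Set HomeoI)) (ω + 2)) ∧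
    (∀ f g h : HomeoI, IsFastWithDiagram ![f, g, h] diagramG →
      (Subgroup.closure ({f, g, h} : Set HomeoI)).FG ∧
      Embeds (Subgroup.closure ({f, g, h} : Set HomeoI)) thompsonF ∧
      HasEAClass (Subgroup.closure ({f, g, h} : Set HomeoI)) (ω + 2)) ∧
    -- neither group embeds into the other
    (∀ a b c f g h : HomeoI, IsFastWithDiagram ![a, b, c] diagramBZ →
      IsFastWithDiagram ![f, g, h] diagramG →
      ¬ Embeds (Subgroup.closure ({a, b, c} : Set HomeoI))
          (Subgroup.closure ({f, g, h} : Set HomeoI)) ∧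
      ¬ Embeds (Subgroup.closure ({f, g, h} : Set HomeoI))
          (Subgroup.closure ({a, b, c} : Set HomeoI))) ∧
    -- hence there is an antichain of finitely generated subgroups of `F` of class `ω + 2`
    (∃ H₀ H₁ : Subgroup thompsonF, H₀.FG ∧ H₁.FG ∧
      HasEAClass H₀ (ω + 2) ∧ HasEAClass H₁ (ω + 2) ∧ ¬ Embeds H₀ H₁ ∧ ¬ Embeds H₁ H₀) ∧
    -- and embeddability of finitely generated subgroups of `F` is not linear
    ¬ ∀ H₀ H₁ : Subgroup thompsonF, H₀.FG → H₁.FG → Embeds H₀ H₁ ∨ Embeds H₁ H₀ := by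
  refine ⟨exists_isFastWithDiagram_diagramBZ, exists_isFastWithDiagram_diagramG, ?_, ?_, ?_,
    exists_incomparable_subgroups, ?_⟩
  · intro a b c h
    obtain ⟨e⟩ := h.nonempty_mulEquiv_shiftGroup_prod
    exact ⟨h.nonempty_mulEquiv_diagramBZ.2, closure_triple_fg a b c,
      e.embeds.trans embeds_shiftGroup_succIso_prod_thompsonF,
      hasEAClass_shiftGroup_succIso_prod.congr e.symm⟩
  · intro f g h hD
    obtain ⟨e⟩ := hD.nonempty_mulEquiv_diagramG
    exact ⟨closure_triple_fg f g h, e.embeds.trans embeds_shiftGroup_succIsoTwo_thompsonF,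
      hasEAClass_shiftGroup_succIsoTwo.congr e.symm⟩
  · intro a b c f g h hBZ hG
    obtain ⟨e₀⟩ := hBZ.nonempty_mulEquiv_shiftGroup_prod
    obtain ⟨e₁⟩ := hG.nonempty_mulEquiv_diagramG
    exact ⟨fun h => not_embeds_shiftGroup_prod _ lt_succIsoTwo
        ((e₀.symm.embeds.trans h).trans e₁.embeds),
      fun h => not_embeds_shiftGroup_succIsoTwo ((e₁.symm.embeds.trans h).trans e₀.embeds)⟩
  · intro hlin
    obtain ⟨H₀, H₁, hfg₀, hfg₁, -, -, h₀₁, h₁₀⟩ := exists_incomparable_subgroups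
    exact (hlin H₀ H₁ hfg₀ hfg₁).elim h₀₁ h₁₀
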